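/- \textbf{Setting.} Let $\alpha_+,\alpha_-,\alpha'_+\in\mathbb C$, put $\mu_1=\mu_2=\alpha_--\alpha'_+$, $\mu_3=\alpha_+-\alpha'_+$, $\mu_4=\mu_5=\alpha_-+\alpha'_+$, $\mu_6=\dots=\mu_9=\alpha_++\alpha'_+$ and $\lambda_i=-\mathrm i\mu_i$, and assume that the numbers $B_i=-\mu_i^2=\lambda_i^2$ are real (e.g. the parameters are all real, or all purely imaginary). Let $M_B=\mathbb R^{11}$ with coordinates $(x^+,x^-,x^1,\dots,x^9)$ carry the Cahen--Wallach metric $$g=2\,dx^+dx^--\sum_i B_i(x^i)^2(dx^-)^2+\sum_i(dx^i)^2,\qquad B=-\mathrm{diag}\big((\alpha_--\alpha_+')^2\mathbf 1_2,(\alpha_+-\alpha_+')^2,(\alpha_-+\alpha_+')^2\mathbf 1_2,(\alpha_++\alpha_+')^2\mathbf 1_4\big).$$ Use the frame $e_+=-\partial_+$, $e_-=-\partial_--\frac12\sum_iB_i(x^i)^2\partial_+$, $e_i=\partial_i$. Let $S$ be an irreducible complex Clifford module with $\Gamma_A\Gamma_C+\Gamma_C\Gamma_A=-2\eta_{AC}$,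 $\Gamma_A$ being the image of $e_A$ and $\eta$ the matrix of $g$ in the frame ($\eta_{+-}=1$, $\eta_{ij}=\delta_{ij}$); spinor fields are maps $M_B\to S$. Let $C$ be the charge conjugation, a non-degenerate skew complex bilinear form on $S$ with $C(\Gamma_A\varphi,\psi)=-C(\varphi,\Gamma_A\psi)$. Put $\sigma_\pm=-\frac12\Gamma_\mp\Gamma_\pm$, $S_\pm=\sigma_\pm S$, $\xi_1=\sigma_-\xi$, $\xi_2=\sigma_+\xi$, $X^\pm=\frac12(1\pm\Gamma_{1245})$, where $\Gamma_{ijk\dots}=\Gamma_i\Gamma_j\Gamma_k\cdots$ for distinct indices, and $$c=(\alpha_+X^++\alpha_-X^-)\Gamma_{123},\qquad d=\alpha'_+X^+\Gamma_{123},\qquad s_i=c\Gamma_i-\Gamma_id.$$ Let $D$ be the connection on spinor fields $$D_{e_+}\xi=\nabla_{e_+}\xi,\quad D_{e_-}\xi=\nabla_{e_-}\xi+c\cdot\xi_1+d\,\xi_2,\quad D_{e_i}\xi=\nabla_{e_i}\xi-\tfrac12\Gamma_+s_i\xi_2,$$ where $\nabla$ is the spin connection of the Levi-Civita connection and $c$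 acts on $S_-$ through the isomorphism $\Gamma_+:S_+\to S_-$, i.e. $c\cdot\Gamma_+\varphi=\Gamma_+c\varphi$ for $\varphi\in S_+$. Consider the Killing fields $$K_{(+)}=-\partial_+,\quad K_{(-)}=-\partial_-,\quad K_{(i)}=\cos(\lambda_ix^-)\partial_i+\lambda_i\sin(\lambda_ix^-)x^i\partial_+,$$ $$K_{(i^*)}=-\lambda_i\sin(\lambda_ix^-)\partial_i+\lambda_i^2\cos(\lambda_ix^-)x^i\partial_+,\quad K_{(ij)}=x^j\partial_i-x^i\partial_j,$$ and let $\mathcal K_0$ be the complex span of all $K_{(\pm)},K_{(i)},K_{(i^*)}$ and of the $K_{(ij)}$ with $i,j$ in the same block of the partition $\{1,2\},\{3\},\{4,5\},\{6,7,8,9\}$. A \emph{geometric superalgebra} extending $\mathcal K_0$ consists of a space $\mathcal K_1$ of smooth $D$-parallel spinor fields, such that $\mathcal K_0$ is a Lie algebra of Killing fields that acts on $\mathcal K_1$, as a Lie algebra, by the spinorial Lie derivative $\mathcal L_X\xi=\nabla_X\xi-\Gamma(\nabla X)\xi$ (with $\Gamma(\nabla X)$ the image of the skew endomorphism $\nabla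 X$ under the spin representation), and of a symmetric complex bilinear map $\{\cdot,\cdot\}:\mathcal K_1\times\mathcal K_1\to\mathcal K_0$ with $2\{\mathcal L_X\xi,\xi\}=[X,\{\xi,\xi\}]$ for $X\in\mathcal K_0$, $\xi\in\mathcal K_1$. It is irreducible if $S$ is an irreducible Clifford module, non-restricted if $\mathcal K_1$ contains all smooth parallel spinor fields, and $\nu=\dim\mathcal K_1/\dim S$. \textbf{Proposition.} Different $(\alpha_+,\alpha_-,\alpha'_+)$ give different pairs $(c,d)$. The connection $D$ is flat if and only if $\alpha'_+=0$ and $\alpha_+^2=\alpha_-^2$. For all other parameters, $\mathcal K_0$ extends to a non-restricted irreducible geometric superalgebra with $\nu=\frac34$; the map $\xi\mapsto\xi(0)=\xi_1^0+\xi_2^0$ is a bijection from $\mathcal K_1$ onto $\{\psi\in S: X^-\sigma_+\psi=0\}$, and the bracket is (by polarization) $$\{\xi,\xi\}=\{\xi,\xi\}^+K_{(+)}+\{\xi,\xi\}^-K_{(-)}+\sum_i\{\xi,\xi\}^iK_{(i)}+\sum_i\{\xi,\xi\}^{i^*}K_{(i^*)}+\tfrac12\sum_{i,j}\{\xi,\xi\}^{ij}K_{(ij)},$$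 $$\{\xi,\xi\}^+=C(\xi_1^0,\Gamma_-\xi_1^0),\quad\{\xi,\xi\}^-=C(\xi_2^0,\Gamma_+\xi_2^0),\quad\{\xi,\xi\}^i=2C(\xi_1^0,\Gamma_i\xi_2^0),\quad\{\xi,\xi\}^{i^*}=\tfrac{2\mathrm i}{\lambda_i}C(\xi_1^0,\Gamma_{123}\Gamma_i\xi_2^0),$$ $$\{\xi,\xi\}^{12}=\mathrm i\lambda_1C(\xi_2^0,\Gamma_+\Gamma_3\xi_2^0),\quad\{\xi,\xi\}^{45}=\mathrm i\lambda_4C(\xi_2^0,\Gamma_+\Gamma_{12345}\xi_2^0),\quad\{\xi,\xi\}^{ij}=\mathrm i\lambda_6C(\xi_2^0,\Gamma_+\Gamma_{123ij}\xi_2^0)\ \ (i\ne j\in\{6,\dots,9\}),$$ where $\{\xi,\xi\}^{ij}$ is skew in $i,j$ and zero for the other pairs, and the term with $K_{(i^*)}$ is absent when $\lambda_i=0$ (then $K_{(i^*)}=0$). If the four values $B_1,B_3,B_4,B_6$ are pairwise distinct, then $\mathcal K_0$ is the span of all the fields above with $K_{(ij)}$ for all $i,j$ with $B_i=B_j$.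 -/

import Mathlib

open scoped ContDiff

noncomputable section

namespace CahenWallach

/-! ## The Cahen-Wallach metric in dimension eleven -/

/-- Directions of the eleven-dimensional space: `+`, `-` and the nine transversal directions.
The transversal direction number `k` (for `k` from one to nine) is `tr (k - 1)`. -/
abbrev Ix := Fin 2 ⊕ Fin 9

/-- The null direction `+`. -/
abbrev pl : Ix := Sum.inl 0

/-- The null direction `-`. -/
abbrev mi : Ix := Sum.inl 1

/-- The transversal directions. -/
abbrev tr (i : Fin 9) : Ix := Sum.inr i

/-- Points, in the global coordinates `(x^+, x^-, x^1, ..., x^9)`. -/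
abbrev Pt := Ix → ℝ

/-- Complexified vector fields, by their components with respect to the coordinate fields. -/
abbrev VField := Pt → Ix → ℂ

/-- Partial derivative in the coordinate direction `a`. -/
def pd {E : Type*} [NormedAddCommGroup E] [NormedSpace ℝ E] (a : Ix) (f : Pt → E) (x : Pt) : E :=
  fderiv ℝ f x (Pi.single a 1)

/-- The Minkowski metric in a null frame: `η_{+-} = η_{-+} = 1`, `η_{ij} = δ_{ij}`.
It is its own inverse. -/
def eta : Matrix Ix Ix ℝ := fun a b =>
  match a, b with
  | Sum.inl s, Sum.inl t => if s = t then 0 else 1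
  | Sum.inr i, Sum.inr j => if i = j then 1 else 0
  | _, _ => 0

/-- The metric `2 dx^+ dx^- - ∑ B_i (x^i)^2 (dx^-)^2 + ∑ (dx^i)^2` of the space defined by the
symmetric map `diag(B_1, ..., B_9)`. -/
def metric (B : Fin 9 → ℝ) (x : Pt) : Matrix Ix Ix ℝ := fun a b =>
  eta a b - if a = mi ∧ b = mi then ∑ i, B i * x (tr i) ^ 2 else 0

/-- The inverse metric, see `metric_mul_metricInv`. -/
def metricInv (B : Fin 9 → ℝ) (x : Pt) : Matrix Ix Ix ℝ := fun a b =>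
  eta a b + if a = pl ∧ b = pl then ∑ i, B i * x (tr i) ^ 2 else 0

theorem metric_mul_metricInv (B : Fin 9 → ℝ) (x : Pt) : metric B x * metricInv B x = 1 := by
  ext a b
  rcases a with a | a <;> rcases b with b | b <;> (try fin_cases a) <;> (try fin_cases b) <;>
    simp [Matrix.mul_apply, metric, metricInv, eta, Fintype.sum_sum_type]

/-- The metric, extended complex-bilinearly. -/
def ip (B : Fin 9 → ℝ) (x : Pt) (u v : Ix → ℂ) : ℂ :=
  ∑ a, ∑ b, (metric B x a b : ℂ) * u a * v b

/-- Christoffel symbols `Γ^e_{ab}` of the Levi-Civita connection. -/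
def christoffel (B : Fin 9 → ℝ) (x : Pt) (e a b : Ix) : ℝ :=
  (1 / 2) * ∑ f, metricInv B x e f *
    (pd a (fun y => metric B y f b) x + pd b (fun y => metric B y f a) x
      - pd f (fun y => metric B y a b) x)

/-- The Levi-Civita derivative `∇_Y X` at `x`, for a tangent vector `Y` at `x`. -/
def covDeriv (B : Fin 9 → ℝ) (Y : Ix → ℂ) (X : VField) (x : Pt) : Ix → ℂ := fun e =>
  ∑ a, Y a * (pd a X x e + ∑ b, (christoffel B x e a b : ℂ) * X x b)

/-- The commutator `[X, Y]` of vector fields. -/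
def lie (X Y : VField) : VField := fun x e =>
  ∑ a, (X x a * pd a Y x e - Y x a * pd a X x e)

/-- Smooth (complexified) Killing vector fields: the Lie derivative of the metric vanishes. -/
def IsKilling (B : Fin 9 → ℝ) (X : VField) : Prop :=
  ContDiff ℝ ∞ X ∧ ∀ x a b,
    ∑ e, (X x e * (pd e (fun y => metric B y a b) x : ℂ)
      + (metric B x e b : ℂ) * pd a X x e + (metric B x a e : ℂ) * pd b X x e) = 0

/-- The null frame `e_+ = -∂_+`, `e_- = -∂_- - (1/2) ∑ B_i (x^i)^2 ∂_+`, `e_i = ∂_i`, in which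
the metric is `eta`. At the origin it consists of the values of the Killing vector fields `K_(+)`,
`K_(-)`, `K_(i)`. -/
def frame (B : Fin 9 → ℝ) (A : Ix) : VField := fun x =>
  match A with
  | Sum.inl s =>
      if s = 0 then -Pi.single pl 1
      else -Pi.single mi 1 - ((1 / 2 : ℂ) * ∑ i, (B i : ℂ) * (x (tr i) : ℂ) ^ 2) • Pi.single pl 1
  | Sum.inr i => Pi.single (tr i) 1

theorem ip_frame (B : Fin 9 → ℝ) (x : Pt) (A C : Ix) :
    ip B x (frame B A x) (frame B C x) = eta A C := by
  rcases A with a | a <;> rcases C with b | b <;> (try fin_cases a) <;> (try fin_cases b) <;>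
    simp [ip, frame, metric, eta, Fintype.sum_sum_type, Pi.single_apply]
  ring

/-- Components of a tangent vector with respect to the frame. -/
def frameCoord (B : Fin 9 → ℝ) (x : Pt) (Y : Ix → ℂ) (A : Ix) : ℂ :=
  ∑ C, (eta A C : ℂ) * ip B x (frame B C x) Y

/-! ## The Killing vector fields -/

/-- `K_(+) = -∂_+`. -/
def Kplus : VField := fun _ => -Pi.single pl 1

/-- `K_(-) = -∂_-`. -/
def Kminus : VField := fun _ => -Pi.single mi 1

/-- `K_(i) = cos(λ_i x^-) ∂_i + λ_i sin(λ_i x^-) x^i ∂_+`. -/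
def Ktr (lam : Fin 9 → ℂ) (i : Fin 9) : VField := fun x =>
  Complex.cos (lam i * x mi) • Pi.single (tr i) 1
    + (lam i * Complex.sin (lam i * x mi) * x (tr i)) • Pi.single pl 1

/-- `K_(i*) = -λ_i sin(λ_i x^-) ∂_i + λ_i^2 cos(λ_i x^-) x^i ∂_+`. -/
def Kdual (lam : Fin 9 → ℂ) (i : Fin 9) : VField := fun x =>
  (-(lam i * Complex.sin (lam i * x mi))) • Pi.single (tr i) 1
    + (lam i ^ 2 * Complex.cos (lam i * x mi) * x (tr i)) • Pi.single pl 1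

/-- `K_(ij) = x^j ∂_i - x^i ∂_j`. -/
def Krot (i j : Fin 9) : VField := fun x =>
  (x (tr j) : ℂ) • Pi.single (tr i) 1 - (x (tr i) : ℂ) • Pi.single (tr j) 1

/-- The complex span of all `K_(+)`, `K_(-)`, `K_(i)`, `K_(i*)` and of those rotations `K_(ij)`
for which `R i j` holds. -/
def killingSpan (lam : Fin 9 → ℂ) (R : Fin 9 → Fin 9 → Prop) : Submodule ℂ VField :=
  Submodule.span ℂ
    ({Kplus, Kminus} ∪ Set.range (Ktr lam) ∪ Set.range (Kdual lam)
      ∪ {X | ∃ i j, R i j ∧ X = Krot i j})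

/-! ## Spinors -/

/-- The quadratic form `v ↦ -⟨v, v⟩`, so that in the Clifford algebra `v w + w v = -2 ⟨v, w⟩`. -/
def cliffordForm : QuadraticForm ℝ (Ix → ℝ) := -Matrix.toQuadraticForm' eta

variable {S : Type*} [NormedAddCommGroup S] [NormedSpace ℂ S]

/-- Complex representations of the Clifford algebra of the eleven-dimensional Minkowski space. -/
abbrev SpinRep (S : Type*) [NormedAddCommGroup S] [NormedSpace ℂ S] :=
  CliffordAlgebra cliffordForm →ₐ[ℝ] Module.End ℂ S

/-- Irreducibility: there are exactly two invariant complex subspaces. -/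
def IsIrreducible (ρ : SpinRep S) : Prop :=
  Nontrivial S ∧ ∀ U : Submodule ℂ S, (∀ a, ∀ ψ ∈ U, ρ a ψ ∈ U) → U = ⊥ ∨ U = ⊤

/-- `Γ_A`, the image of the frame vector `e_A`. -/
def gam (ρ : SpinRep S) (A : Ix) : Module.End ℂ S :=
  ρ (CliffordAlgebra.ι cliffordForm (Pi.single A 1))

/-- `Γ^A = ∑ η^{AC} Γ_C`. -/
def gamUp (ρ : SpinRep S) (A : Ix) : Module.End ℂ S :=
  ∑ C, (eta A C : ℂ) • gam ρ C

/-- The charge conjugation: a non-degenerate skew-symmetric complex bilinear form on the spinors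
with respect to which all `Γ_A` are skew-adjoint. -/
structure IsChargeConjugation (ρ : SpinRep S) (C : LinearMap.BilinForm ℂ S) : Prop where
  nondegenerate : C.Nondegenerate
  skew : ∀ φ ψ, C φ ψ = -C ψ φ
  gam_skew : ∀ A φ ψ, C (gam ρ A φ) ψ = -C φ (gam ρ A ψ)

/-- `σ_+ = -(1/2) Γ_- Γ_+`, the projection on `S_+ = ker Γ_-`. -/
def sigPlus (ρ : SpinRep S) : Module.End ℂ S := -((1 / 2 : ℂ) • (gam ρ mi * gam ρ pl))

/-- `σ_- = -(1/2) Γ_+ Γ_-`, the projection on `S_- = ker Γ_+`. -/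
def sigMinus (ρ : SpinRep S) : Module.End ℂ S := -((1 / 2 : ℂ) • (gam ρ pl * gam ρ mi))

/-- The spin representation of the skew endomorphism `e_C ↦ ∑ η^{AD} w_{AC} e_D`
(in frame components) of Minkowski space, `w` skew. It is normalised by `[spinEnd w, Γ_v] = Γ_{w v}`. -/
def spinEnd (ρ : SpinRep S) (w : Ix → Ix → ℂ) : Module.End ℂ S :=
  -((1 / 4 : ℂ) • ∑ A, ∑ C, w A C • (gamUp ρ A * gamUp ρ C))

/-- The connection `∇_Y` that the Levi-Civita connection induces on the spinor bundle, trivialised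
by the frame; `Y` is a tangent vector at `x`. -/
def spinNabla (ρ : SpinRep S) (B : Fin 9 → ℝ) (Y : Ix → ℂ) (ξ : Pt → S) (x : Pt) : S :=
  ∑ a, Y a • pd a ξ x
    + spinEnd ρ (fun A C => ip B x (frame B A x) (covDeriv B Y (frame B C) x)) (ξ x)

/-- The spinorial Lie derivative `L_X ξ = ∇_X ξ - Γ(∇X) ξ`. -/
def spinLie (ρ : SpinRep S) (B : Fin 9 → ℝ) (X : VField) (ξ : Pt → S) : Pt → S := fun x =>
  spinNabla ρ B (X x) ξ x
    - spinEnd ρ (fun A C => ip B x (frame B A x) (covDeriv B (frame B C x) X x)) (ξ x)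

/-- `s_{c,d}(e_i) = c Γ_i - Γ_i d`. -/
def sMap (ρ : SpinRep S) (c d : Module.End ℂ S) (i : Fin 9) : Module.End ℂ S :=
  c * gam ρ (tr i) - gam ρ (tr i) * d

/-- The difference `D_A - ∇_A` along the frame vector `e_A`, for (images of) elements `c`, `d` of
the Clifford algebra of the transversal space. It is zero for `A = +`; it is `c` on `S_-` and `d`
on `S_+` for `A = -`; and it is `-(1/2) Γ_+ s_{c,d}(e_i)` on `S_+`, zero on `S_-`, for `A = i`.
The transversal Clifford algebra acts on `S_-` through the isomorphism `Γ_+ : S_+ → S_-`, that is,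
`c` acts by `Γ_+ φ ↦ Γ_+ c φ`; on `S_-`, the inverse of this isomorphism is `-(1/2) Γ_-`. -/
def connTerm (ρ : SpinRep S) (c d : Module.End ℂ S) (A : Ix) : Module.End ℂ S :=
  match A with
  | Sum.inl s =>
      if s = 0 then 0
      else -((1 / 2 : ℂ) • (gam ρ pl * c * gam ρ mi)) + d * sigPlus ρ
  | Sum.inr i => -((1 / 2 : ℂ) • (gam ρ pl * sMap ρ c d i * sigPlus ρ))

/-- The connection `D` given by `(c, d)`, along a tangent vector `Y` at `x`. -/
def conn (ρ : SpinRep S) (B : Fin 9 → ℝ) (c d : Module.End ℂ S)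
    (Y : Ix → ℂ) (ξ : Pt → S) (x : Pt) : S :=
  spinNabla ρ B Y ξ x + ∑ A, frameCoord B x Y A • connTerm ρ c d A (ξ x)

/-- Flatness of `D`: the curvature `[D_Y, D_Z] - D_{[Y,Z]}` vanishes. -/
def IsFlat (ρ : SpinRep S) (B : Fin 9 → ℝ) (c d : Module.End ℂ S) : Prop :=
  ∀ (Y Z : VField) (ξ : Pt → S), ContDiff ℝ ∞ Y → ContDiff ℝ ∞ Z → ContDiff ℝ ∞ ξ → ∀ x,
    conn ρ B c d (Y x) (fun y => conn ρ B c d (Z y) ξ y) x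
      - conn ρ B c d (Z x) (fun y => conn ρ B c d (Y y) ξ y) x
      = conn ρ B c d (lie Y Z x) ξ x

theorem conn_zero (ρ : SpinRep S) (B : Fin 9 → ℝ) (c d : Module.End ℂ S) (Y : Ix → ℂ) (x : Pt) :
    conn ρ B c d Y 0 x = 0 := by
  have h : ∀ a, pd a (0 : Pt → S) x = 0 := fun a => by simp [pd]
  simp [conn, spinNabla, h]

theorem conn_add (ρ : SpinRep S) (B : Fin 9 → ℝ) (c d : Module.End ℂ S) (Y : Ix → ℂ) (x : Pt)
    {ξ η : Pt → S} (hξ : ContDiff ℝ ∞ ξ) (hη : ContDiff ℝ ∞ η) :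
    conn ρ B c d Y (ξ + η) x = conn ρ B c d Y ξ x + conn ρ B c d Y η x := by
  have h : ∀ a, pd a (ξ + η) x = pd a ξ x + pd a η x := fun a => by
    simp only [pd]
    rw [fderiv_add (hξ.differentiable (by simp) x) (hη.differentiable (by simp) x)]
    rfl
  simp only [conn, spinNabla, h, Pi.add_apply, map_add, smul_add, Finset.sum_add_distrib]
  abel

theorem conn_smul (ρ : SpinRep S) (B : Fin 9 → ℝ) (c d : Module.End ℂ S) (Y : Ix → ℂ) (x : Pt)
    (z : ℂ) {ξ : Pt → S} (hξ : ContDiff ℝ ∞ ξ) :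
    conn ρ B c d Y (z • ξ) x = z • conn ρ B c d Y ξ x := by
  have h : ∀ a, pd a (z • ξ) x = z • pd a ξ x := fun a => by
    simp only [pd]
    rw [fderiv_const_smul (hξ.differentiable (by simp) x)]
    rfl
  simp only [conn, spinNabla, h, Pi.smul_apply, map_smul, smul_add, Finset.smul_sum,
    smul_comm z]

/-- The space of all smooth spinor fields that are parallel with respect to `D`. -/
def parallelSpinors (ρ : SpinRep S) (B : Fin 9 → ℝ) (c d : Module.End ℂ S) :
    Submodule ℂ (Pt → S) where
  carrier := {ξ | ContDiff ℝ ∞ ξ ∧ ∀ (x : Pt) (Y : Ix → ℂ), conn ρ B c d Y ξ x = 0}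
  zero_mem' := ⟨contDiff_const, fun x Y => conn_zero ρ B c d Y x⟩
  add_mem' := fun hξ hη =>
    ⟨hξ.1.add hη.1, fun x Y => by rw [conn_add ρ B c d Y x hξ.1 hη.1, hξ.2, hη.2, add_zero]⟩
  smul_mem' := fun z _ hξ =>
    ⟨hξ.1.const_smul z, fun x Y => by rw [conn_smul ρ B c d Y x z hξ.1, hξ.2, smul_zero]⟩

/-! ## Geometric superalgebras -/

/-- Geometric superalgebras: an even part of Killing vector fields, an odd part of `D`-parallel
spinor fields, the action of the even part on the odd part by the spinorial Lie derivative, and a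
compatible symmetric bracket on the odd part. -/
structure GeometricSuperalgebra (ρ : SpinRep S) (B : Fin 9 → ℝ) (c d : Module.End ℂ S) where
  K0 : Submodule ℂ VField
  killing : ∀ X ∈ K0, IsKilling B X
  lie_mem : ∀ X ∈ K0, ∀ Y ∈ K0, lie X Y ∈ K0
  K1 : Submodule ℂ (Pt → S)
  parallel : K1 ≤ parallelSpinors ρ B c d
  L : K0 →ₗ[ℂ] Module.End ℂ K1
  L_eq : ∀ (X : K0) (ξ : K1), (L X ξ : Pt → S) = spinLie ρ B X ξ
  L_lie : ∀ X Y : K0, L X * L Y - L Y * L X = L ⟨lie X Y, lie_mem X X.2 Y Y.2⟩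
  bracket : K1 →ₗ[ℂ] K1 →ₗ[ℂ] K0
  symm : ∀ ξ η, bracket ξ η = bracket η ξ
  compat : ∀ (X : K0) (ξ : K1),
    (2 : ℂ) • (bracket (L X ξ) ξ : VField) = lie X (bracket ξ ξ)

/-- Non-restricted: the odd part contains all parallel spinors. -/
def GeometricSuperalgebra.NonRestricted {ρ : SpinRep S} {B : Fin 9 → ℝ} {c d : Module.End ℂ S}
    (K : GeometricSuperalgebra ρ B c d) : Prop :=
  parallelSpinors ρ B c d ≤ K.K1

/-- `ν`, the quotient of the dimensions of the odd part and of the spinor module. -/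
def GeometricSuperalgebra.nu {ρ : SpinRep S} {B : Fin 9 → ℝ} {c d : Module.End ℂ S}
    (K : GeometricSuperalgebra ρ B c d) : ℚ :=
  (Module.finrank ℂ K.K1 : ℚ) / (Module.finrank ℂ S : ℚ)

/-! ## The family -/

/-- `Γ_{123}`. -/
def gam123 (ρ : SpinRep S) : Module.End ℂ S := gam ρ (tr 0) * gam ρ (tr 1) * gam ρ (tr 2)

/-- `Γ_{1245}`. -/
def gam1245 (ρ : SpinRep S) : Module.End ℂ S :=
  gam ρ (tr 0) * gam ρ (tr 1) * gam ρ (tr 3) * gam ρ (tr 4)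

/-- `X^+_{1245} = (1/2) (1 + Γ_{1245})`. -/
def projPlus (ρ : SpinRep S) : Module.End ℂ S := (1 / 2 : ℂ) • (1 + gam1245 ρ)

/-- `X^-_{1245} = (1/2) (1 - Γ_{1245})`. -/
def projMinus (ρ : SpinRep S) : Module.End ℂ S := (1 / 2 : ℂ) • (1 - gam1245 ρ)

/-- `c = (α_+ X^+_{1245} + α_- X^-_{1245}) Γ_{123}`. -/
def cElt (ρ : SpinRep S) (ap am : ℂ) : Module.End ℂ S :=
  (ap • projPlus ρ + am • projMinus ρ) * gam123 ρ

/-- `d = α'_+ X^+_{1245} Γ_{123}`. -/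
def dElt (ρ : SpinRep S) (ap' : ℂ) : Module.End ℂ S := (ap' • projPlus ρ) * gam123 ρ

/-- The partition of the transversal directions into `{1,2}`, `{3}`, `{4,5}`, `{6,7,8,9}`. -/
def block : Fin 9 → Fin 4 := ![0, 0, 1, 2, 2, 3, 3, 3, 3]

/-- `μ_i`, equal to `α_- - α'_+`, `α_+ - α'_+`, `α_- + α'_+`, `α_+ + α'_+` on the four blocks. -/
def mu (ap am ap' : ℂ) (i : Fin 9) : ℂ :=
  (![am - ap', ap - ap', am + ap', ap + ap'] : Fin 4 → ℂ) (block i)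

/-- `λ_i = -i μ_i`. -/
def lam (ap am ap' : ℂ) (i : Fin 9) : ℂ := -Complex.I * mu ap am ap' i

/-- The components `{ξ,ξ}^{ij}` in terms of `φ = ξ_2^0`, skew in `i`, `j`. -/
def rotCoeff (ρ : SpinRep S) (C : LinearMap.BilinForm ℂ S) (l : Fin 9 → ℂ) (φ : S)
    (i j : Fin 9) : ℂ :=
  if i = 0 ∧ j = 1 then Complex.I * l 0 * C φ (gam ρ pl (gam ρ (tr 2) φ))
  else if i = 1 ∧ j = 0 then -(Complex.I * l 0 * C φ (gam ρ pl (gam ρ (tr 2) φ)))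
  else if i = 3 ∧ j = 4 then
    Complex.I * l 3 * C φ ((gam ρ pl * gam123 ρ * gam ρ (tr 3) * gam ρ (tr 4)) φ)
  else if i = 4 ∧ j = 3 then
    -(Complex.I * l 3 * C φ ((gam ρ pl * gam123 ρ * gam ρ (tr 3) * gam ρ (tr 4)) φ))
  else if 5 ≤ i ∧ 5 ≤ j ∧ i ≠ j then
    Complex.I * l 5 * C φ ((gam ρ pl * gam123 ρ * gam ρ (tr i) * gam ρ (tr j)) φ)
  else 0

/-- The vector field `{ξ,ξ}` for the parallel spinor `ξ` with `ξ(0) = ψ`, where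
`ξ_1^0 = σ_- ψ` and `ξ_2^0 = σ_+ ψ`. For `λ_i = 0` the coefficient of `K_(i*)` has no meaning,
and none is needed: then `K_(i*) = 0`. -/
def bracketField (ρ : SpinRep S) (C : LinearMap.BilinForm ℂ S) (l : Fin 9 → ℂ) (ψ : S) : VField :=
  C (sigMinus ρ ψ) (gam ρ mi (sigMinus ρ ψ)) • Kplus
    + C (sigPlus ρ ψ) (gam ρ pl (sigPlus ρ ψ)) • Kminus
    + ∑ i, (2 * C (sigMinus ρ ψ) (gam ρ (tr i) (sigPlus ρ ψ))) • Ktr l i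
    + ∑ i, (2 * Complex.I / l i
        * C (sigMinus ρ ψ) ((gam123 ρ * gam ρ (tr i)) (sigPlus ρ ψ))) • Kdual l i
    + (1 / 2 : ℂ) • ∑ i, ∑ j, rotCoeff ρ C l (sigPlus ρ ψ) i j • Krot i j

end CahenWallach

end

open scoped ContDiff

noncomputable section

namespace CahenWallach

set_option linter.unusedSimpArgs false

variable {S : Type*} [NormedAddCommGroup S] [NormedSpace ℂ S]

/-! ## Relations between the gamma matrices -/

/-! The argument is linear algebra governed by two signs. Γ_i commutes with Γ_123 up to `eps i` and
with Γ_1245 up to `del i`; both signs depend only on the block of i, and together they separate the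
four blocks. Hence the operators that occur are combinations of a few ordered words, and most
identities reduce to comparing coefficients in the four cases eps, del = ±1.

Flatness. On the part of S_+ where Γ_1245 = 1, the map s_i equals μ_i Γ_123 Γ_i
(`connTerm_tr_of_mem`), and B_i = -μ_i² makes the curvature vanish. On the part where Γ_1245 = -1
the element d is zero, and the scalar `curvCoef` survives (`curv_tr_mi`). So D is flat exactly when
these scalars vanish, a small polynomial system solved in `curvCoef_eq_zero_iff`.

Parallel spinors. If some scalar is nonzero, the curvature annihilates a parallel spinor only if X^-
σ_+ annihilates it, at every point (`value_mem_initSpace`). Conversely, every such initial value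
belongs to an explicit solution (`sol_mem`), and the value at the origin determines a parallel
spinor (`parallel_eq_zero`). The space of initial values is the kernel of a projection of trace dim
S / 4 (`finrank_initSpace`), whence ν = 3/4.

Superalgebra. Since ∇ has no torsion, the spinorial Lie derivative only involves the commutators of
X with the frame (`spinLie_eq`); each generator is seen to preserve the parallel spinors
(`spinLie_mem`). Because these are determined at the origin, the representation property is an
identity between initial values (`spinLie_comm_apply_zero`). The bracket is defined through initial
values as well, so its compatibility is a comparison of the coefficients of the generators
(`spinBracket_compat`). The unwanted coefficients vanish because C is skew: C(φ, Aφ) = 0 for every A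
that is self-adjoint with respect to C (`C_apply_self_eq_zero`), and mixed rotations drop out
because Γ_1245 fixes ξ_2^0 (`C_rot_eq_zero`). -/

theorem cliffordForm_polar (v w : Ix → ℝ) :
    QuadraticMap.polar cliffordForm v w = -2 * ∑ a, ∑ b, v a * eta a b * w b := by
  have hs : ∀ v w : Ix → ℝ, ∑ a, ∑ b, v a * eta a b * w b = ∑ a, ∑ b, w a * eta a b * v b := by
    intro v w
    simp [eta, Fintype.sum_sum_type]
    simp only [mul_comm, add_comm]
  have h : ∀ u : Ix → ℝ, cliffordForm u = -∑ a, ∑ b, u a * eta a b * u b := by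
    intro u
    simp only [cliffordForm, Matrix.toQuadraticForm', neg_apply,
      LinearMap.BilinMap.toQuadraticMap_apply, Matrix.toLinearMap₂'_apply, smul_eq_mul]
    refine congrArg Neg.neg
      (Finset.sum_congr rfl fun a _ => Finset.sum_congr rfl fun b _ => by ring)
  have hsw := hs w v
  simp only [QuadraticMap.polar, h, Pi.add_apply, add_mul, mul_add, Finset.sum_add_distrib]
  rw [hsw]; ring

theorem gam_mul_add_swap (ρ : SpinRep S) (A C : Ix) :
    gam ρ A * gam ρ C + gam ρ C * gam ρ A = (-2 * (eta A C : ℂ)) • 1 := by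
  have h := congrArg ρ (CliffordAlgebra.ι_mul_ι_add_swap (Q := cliffordForm)
    (Pi.single A 1) (Pi.single C 1))
  rw [map_add, map_mul, map_mul, cliffordForm_polar] at h
  rw [gam, gam, h, AlgHom.commutes, Algebra.algebraMap_eq_smul_one]
  ext ψ
  simp only [Pi.single_apply, LinearMap.smul_apply, Module.End.one_apply]
  simp
  -- `ρ` is linear over the reals only, so the scalar in the Clifford relation is real and is reread
  -- here as a complex one.
  rw [← Complex.coe_smul]
  simp

theorem gam_gam_swap (ρ : SpinRep S) (A C : Ix) (ψ : S) :
    gam ρ A (gam ρ C ψ) = (-2 * (eta A C : ℂ)) • ψ - gam ρ C (gam ρ A ψ) := by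
  have h := LinearMap.congr_fun (gam_mul_add_swap ρ A C) ψ
  simp only [LinearMap.add_apply, Module.End.mul_apply, LinearMap.smul_apply,
    Module.End.one_apply] at h
  rw [← h]; abel

theorem eq_zero_of_eq_neg {v : S} (h : v = -v) : v = 0 := by
  have h2 : (2 : ℂ) • v = 0 := by
    rw [two_smul]
    nth_rewrite 1 [h]
    exact neg_add_cancel v
  exact (smul_eq_zero.1 h2).resolve_left two_ne_zero

theorem pl_pl (ρ : SpinRep S) (ψ : S) : gam ρ pl (gam ρ pl ψ) = 0 := by
  have h := gam_gam_swap ρ pl pl ψ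
  simp [eta] at h
  exact eq_zero_of_eq_neg h

theorem mi_mi (ρ : SpinRep S) (ψ : S) : gam ρ mi (gam ρ mi ψ) = 0 := by
  have h := gam_gam_swap ρ mi mi ψ
  simp [eta] at h
  exact eq_zero_of_eq_neg h

theorem mi_pl (ρ : SpinRep S) (ψ : S) :
    gam ρ mi (gam ρ pl ψ) = -(2 : ℂ) • ψ - gam ρ pl (gam ρ mi ψ) := by
  have h := gam_gam_swap ρ mi pl ψ
  simpa [eta] using h

theorem tr_pl (ρ : SpinRep S) (i : Fin 9) (ψ : S) :
    gam ρ (tr i) (gam ρ pl ψ) = -gam ρ pl (gam ρ (tr i) ψ) := by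
  have h := gam_gam_swap ρ (tr i) pl ψ
  simpa [eta] using h

theorem tr_mi (ρ : SpinRep S) (i : Fin 9) (ψ : S) :
    gam ρ (tr i) (gam ρ mi ψ) = -gam ρ mi (gam ρ (tr i) ψ) := by
  have h := gam_gam_swap ρ (tr i) mi ψ
  simpa [eta] using h

theorem tr_self (ρ : SpinRep S) (i : Fin 9) (ψ : S) :
    gam ρ (tr i) (gam ρ (tr i) ψ) = -ψ := by
  have h := gam_gam_swap ρ (tr i) (tr i) ψ
  rw [eq_sub_iff_add_eq, ← two_smul ℂ, eta, if_pos rfl] at h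
  have h2 := congrArg (fun v : S => (1 / 2 : ℂ) • v) h
  simp only [smul_smul] at h2
  norm_num at h2
  exact h2

theorem tr_tr (ρ : SpinRep S) {i j : Fin 9} (hij : i ≠ j) (ψ : S) :
    gam ρ (tr i) (gam ρ (tr j) ψ) = -gam ρ (tr j) (gam ρ (tr i) ψ) := by
  have h := gam_gam_swap ρ (tr i) (tr j) ψ
  simpa [eta, hij] using h

theorem tr_tr_of_lt (ρ : SpinRep S) {i j : Fin 9} (hij : j < i) (ψ : S) :
    gam ρ (tr i) (gam ρ (tr j) ψ) = -gam ρ (tr j) (gam ρ (tr i) ψ) :=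
  tr_tr ρ hij.ne' ψ

/-- The sign in `Γ_i Γ_{123} = ± Γ_{123} Γ_i`. -/
def eps (i : Fin 9) : ℂ := (![1, 1, -1, -1] : Fin 4 → ℂ) (block i)

/-- The sign in `Γ_{1245} Γ_i = ± Γ_i Γ_{1245}`. -/
def del (i : Fin 9) : ℂ := (![-1, 1, -1, 1] : Fin 4 → ℂ) (block i)

theorem gam123_pl (ρ : SpinRep S) (ψ : S) :
    gam123 ρ (gam ρ pl ψ) = -gam ρ pl (gam123 ρ ψ) := by
  simp [gam123, tr_pl]

theorem gam123_mi (ρ : SpinRep S) (ψ : S) :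
    gam123 ρ (gam ρ mi ψ) = -gam ρ mi (gam123 ρ ψ) := by
  simp [gam123, tr_mi]

theorem gam123_gam123 (ρ : SpinRep S) (ψ : S) : gam123 ρ (gam123 ρ ψ) = ψ := by
  simp [gam123, tr_tr_of_lt, tr_self]

theorem tr_gam123 (ρ : SpinRep S) (i : Fin 9) (ψ : S) :
    gam ρ (tr i) (gam123 ρ ψ) = eps i • gam123 ρ (gam ρ (tr i) ψ) := by
  fin_cases i <;>
    simp +decide [gam123, eps, block, tr_tr_of_lt, tr_self]

theorem gam1245_pl (ρ : SpinRep S) (ψ : S) :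
    gam1245 ρ (gam ρ pl ψ) = gam ρ pl (gam1245 ρ ψ) := by
  simp [gam1245, tr_pl]

theorem gam1245_mi (ρ : SpinRep S) (ψ : S) :
    gam1245 ρ (gam ρ mi ψ) = gam ρ mi (gam1245 ρ ψ) := by
  simp [gam1245, tr_mi]

theorem gam1245_gam1245 (ρ : SpinRep S) (ψ : S) : gam1245 ρ (gam1245 ρ ψ) = ψ := by
  simp +decide [gam1245, tr_tr_of_lt, tr_self]

theorem gam1245_gam123 (ρ : SpinRep S) (ψ : S) :
    gam1245 ρ (gam123 ρ ψ) = gam123 ρ (gam1245 ρ ψ) := by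
  simp +decide [gam1245, gam123, tr_tr_of_lt, tr_self]

theorem gam1245_tr (ρ : SpinRep S) (i : Fin 9) (ψ : S) :
    gam1245 ρ (gam ρ (tr i) ψ) = del i • gam ρ (tr i) (gam1245 ρ ψ) := by
  fin_cases i <;>
    simp +decide [gam1245, del, block, tr_tr_of_lt, tr_self]

theorem eps_sq (i : Fin 9) : eps i * eps i = 1 := by
  fin_cases i <;> simp [eps, block]

/-- On vectors fixed by Γ_1245, c sees α_+ or α_- after Γ_i according to whether Γ_i preserves or
exchanges the eigenspaces of Γ_1245 (`del`), and moving Γ_i past the Γ_123 in d costs `eps`. This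
form lets later computations treat all blocks at once. -/
theorem mu_eq (ap am ap' : ℂ) (i : Fin 9) :
    mu ap am ap' i = ap * (1 + del i) / 2 + am * (1 - del i) / 2 - eps i * ap' := by
  fin_cases i <;> simp [mu, del, eps, block] <;> ring

-- As rewriting rules these bring a word into the order Γ_+, Γ_-, Γ_123, Γ_i, Γ_1245, after which
-- `module` compares coefficients. Several different Γ_i are not reordered among themselves;
-- `tr_tr_of_lt` is added where that is needed.
attribute [simp] pl_pl mi_mi mi_pl tr_pl tr_mi tr_self gam123_pl gam123_mi gam123_gam123 tr_gam123
  gam1245_pl gam1245_mi gam1245_gam1245 gam1245_gam123 gam1245_tr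

/-! ## Partial derivatives -/

section PartialDerivatives
variable {E : Type*} [NormedAddCommGroup E] [NormedSpace ℝ E]

theorem diffAt {f : Pt → E} (hf : ContDiff ℝ ∞ f) (x : Pt) : DifferentiableAt ℝ f x :=
  hf.differentiable (by simp) x

theorem pd_const (a : Ix) (v : E) (x : Pt) : pd a (fun _ : Pt => v) x = 0 := by
  simp [pd]

theorem pd_add (a : Ix) {f g : Pt → E} {x : Pt} (hf : DifferentiableAt ℝ f x)
    (hg : DifferentiableAt ℝ g x) : pd a (fun y => f y + g y) x = pd a f x + pd a g x := by
  simp only [pd]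
  rw [fderiv_fun_add hf hg]
  rfl

theorem pd_sub (a : Ix) {f g : Pt → E} {x : Pt} (hf : DifferentiableAt ℝ f x)
    (hg : DifferentiableAt ℝ g x) : pd a (fun y => f y - g y) x = pd a f x - pd a g x := by
  simp only [pd]
  rw [fderiv_fun_sub hf hg]
  rfl

theorem pd_neg (a : Ix) (f : Pt → E) (x : Pt) : pd a (fun y => -f y) x = -pd a f x := by
  simp only [pd]
  rw [fderiv_fun_neg]
  rfl

theorem pd_sum {ι : Type*} (s : Finset ι) (a : Ix) {f : ι → Pt → E} {x : Pt}
    (hf : ∀ i ∈ s, DifferentiableAt ℝ (f i) x) :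
    pd a (fun y => ∑ i ∈ s, f i y) x = ∑ i ∈ s, pd a (f i) x := by
  simp only [pd]
  rw [fderiv_fun_sum hf]
  simp

theorem pd_clm {F : Type*} [NormedAddCommGroup F] [NormedSpace ℝ F] (T : E →L[ℝ] F) (a : Ix)
    {f : Pt → E} {x : Pt} (hf : DifferentiableAt ℝ f x) :
    pd a (fun y => T (f y)) x = T (pd a f x) := by
  simp only [pd]
  have := (T.hasFDerivAt.comp x hf.hasFDerivAt).fderiv
  rw [show (fun y => T (f y)) = T ∘ f from rfl, this]
  rfl

theorem pd_comp_coord (a b : Ix) {h : ℝ → E} {h' : E} {x : Pt} (hh : HasDerivAt h h' (x b)) :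
    pd a (fun y => h (y b)) x = if a = b then h' else 0 := by
  have h1 : HasFDerivAt (fun y : Pt => y b) (ContinuousLinearMap.proj (R := ℝ) b) x :=
    (ContinuousLinearMap.proj (R := ℝ) (φ := fun _ : Ix => ℝ) b).hasFDerivAt
  have h2 := (hh.hasFDerivAt.comp x h1).fderiv
  simp only [pd]
  rw [show (fun y : Pt => h (y b)) = h ∘ (fun y : Pt => y b) from rfl, h2]
  simp only [ContinuousLinearMap.comp_apply, ContinuousLinearMap.proj_apply]
  by_cases hab : a = b
  · subst hab; simp
  · simp [hab, Ne.symm hab]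

theorem pd_smul {F : Type*} [NormedAddCommGroup F] [NormedSpace ℂ F] (a : Ix) {f : Pt → ℂ}
    {g : Pt → F} {x : Pt} (hf : DifferentiableAt ℝ f x) (hg : DifferentiableAt ℝ g x) :
    pd a (fun y => f y • g y) x = pd a f x • g x + f x • pd a g x := by
  simp only [pd]
  rw [fderiv_fun_smul hf hg]
  simp [add_comm]

theorem pd_mul (a : Ix) {f g : Pt → ℂ} {x : Pt} (hf : DifferentiableAt ℝ f x)
    (hg : DifferentiableAt ℝ g x) :
    pd a (fun y => f y * g y) x = pd a f x * g x + f x * pd a g x :=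
  pd_smul a hf hg

theorem pd_coord (a b : Ix) (x : Pt) :
    pd a (fun y : Pt => (y b : ℂ)) x = if a = b then 1 else 0 :=
  pd_comp_coord a b (h := fun t : ℝ => (t : ℂ)) Complex.ofRealCLM.hasDerivAt

theorem pd_apply {ι : Type*} [Fintype ι] (a : Ix) {X : Pt → ι → ℂ} {x : Pt}
    (hX : DifferentiableAt ℝ X x) (e : ι) : pd a X x e = pd a (fun y => X y e) x :=
  (pd_clm (ContinuousLinearMap.proj (R := ℝ) (φ := fun _ : ι => ℂ) e) a hX).symm

theorem pd_comm {f : Pt → E} (hf : ContDiff ℝ ∞ f) (a b : Ix) (x : Pt) :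
    pd a (fun y => pd b f y) x = pd b (fun y => pd a f y) x := by
  have hd : Differentiable ℝ (fderiv ℝ f) :=
    (hf.fderiv_right (m := ∞) (by simp)).differentiable (by simp)
  have key : ∀ a b : Ix, pd a (fun y => pd b f y) x
      = fderiv ℝ (fderiv ℝ f) x (Pi.single a 1) (Pi.single b 1) := by
    intro a b
    simp only [pd]
    rw [fderiv_clm_apply (hd x) (differentiableAt_const _)]
    simp
  rw [key, key]
  exact (hf.contDiffAt.isSymmSndFDerivAt
    (by simpa using (WithTop.coe_le_coe.2 (le_top : (2 : ℕ∞) ≤ ⊤)))).eq _ _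

theorem contDiff_pd {f : Pt → E} (hf : ContDiff ℝ ∞ f) (a : Ix) : ContDiff ℝ ∞ (pd a f) :=
  (hf.fderiv_right (m := ∞) (by simp)).clm_apply contDiff_const

end PartialDerivatives

theorem contDiff_coord (b : Ix) : ContDiff ℝ ∞ (fun y : Pt => (y b : ℂ)) :=
  Complex.ofRealCLM.contDiff.comp (contDiff_apply ℝ ℝ b)

/-! ## The Levi-Civita connection -/

theorem ix_cases {P : Ix → Prop} (hp : P pl) (hm : P mi) (ht : ∀ i, P (tr i)) (A : Ix) : P A := by
  rcases A with a | a
  · fin_cases a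
    · exact hp
    · exact hm
  · exact ht a

theorem sum_ix {M : Type*} [AddCommMonoid M] (f : Ix → M) :
    ∑ a, f a = f pl + f mi + ∑ i, f (tr i) := by
  rw [Fintype.sum_sum_type, Fin.sum_univ_two]

theorem pd_metric (B : Fin 9 → ℝ) (x : Pt) (f a b : Ix) :
    pd f (fun y => metric B y a b) x
      = if a = mi ∧ b = mi then -Sum.elim (fun _ => 0) (fun i => 2 * B i * x (tr i)) f else 0 := by
  by_cases h : a = mi ∧ b = mi
  · simp only [metric, h, and_self, if_true]
    rw [pd_sub _ (by fun_prop) (by fun_prop), pd_const, pd_sum _ _ (by fun_prop)]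
    have h1 : ∀ i, pd f (fun y : Pt => B i * y (tr i) ^ 2) x
        = if f = tr i then 2 * B i * x (tr i) else 0 := fun i =>
      pd_comp_coord f (tr i) (h := fun t => B i * t ^ 2)
        (((hasDerivAt_pow 2 (x (tr i))).const_mul (B i)).congr_deriv (by push_cast; ring))
    simp only [h1, zero_sub]
    rcases f with f | f <;> simp
  · simp only [metric, h, if_false, sub_zero, pd_const]

theorem metric_symm (B : Fin 9 → ℝ) (x : Pt) (a b : Ix) : metric B x a b = metric B x b a := by
  rcases a with a | a <;> rcases b with b | b <;> simp [metric, eta, and_comm, eq_comm]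

theorem christoffel_symm (B : Fin 9 → ℝ) (x : Pt) (e a b : Ix) :
    christoffel B x e a b = christoffel B x e b a := by
  simp only [christoffel]
  refine congrArg _ (Finset.sum_congr rfl fun f _ => ?_)
  simp only [metric_symm _ _ a b]
  ring

theorem christoffel_pl (B : Fin 9 → ℝ) (x : Pt) (a b : Ix) :
    christoffel B x pl a b
      = (if a = mi then Sum.elim (fun _ => 0) (fun k => -(B k * x (tr k))) b else 0)
        + (if b = mi then Sum.elim (fun _ => 0) (fun k => -(B k * x (tr k))) a else 0) := by
  simp only [christoffel, pd_metric, metricInv, eta, sum_ix]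
  induction a using ix_cases <;> induction b using ix_cases <;> simp <;> ring

theorem christoffel_mi (B : Fin 9 → ℝ) (x : Pt) (a b : Ix) : christoffel B x mi a b = 0 := by
  simp only [christoffel, pd_metric, metricInv, eta, sum_ix]
  induction a using ix_cases <;> induction b using ix_cases <;> simp

theorem christoffel_tr (B : Fin 9 → ℝ) (x : Pt) (k : Fin 9) (a b : Ix) :
    christoffel B x (tr k) a b = if a = mi ∧ b = mi then B k * x (tr k) else 0 := by
  simp only [christoffel, pd_metric, metricInv, eta, sum_ix]
  induction a using ix_cases <;> induction b using ix_cases <;> simp; ring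

theorem covDeriv_pl (B : Fin 9 → ℝ) (Y : Ix → ℂ) (X : VField) (x : Pt) :
    covDeriv B Y X x pl = ∑ a, Y a * pd a X x pl
      - ∑ k, (B k * x (tr k)) * (Y mi * X x (tr k) + Y (tr k) * X x mi) := by
  simp only [covDeriv, mul_add, Finset.sum_add_distrib, christoffel_pl]
  simp only [sum_ix]
  simp [Finset.mul_sum]
  simp only [mul_left_comm, mul_comm]
  ring

theorem covDeriv_mi (B : Fin 9 → ℝ) (Y : Ix → ℂ) (X : VField) (x : Pt) :
    covDeriv B Y X x mi = ∑ a, Y a * pd a X x mi := by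
  simp [covDeriv, christoffel_mi]

theorem covDeriv_tr (B : Fin 9 → ℝ) (Y : Ix → ℂ) (X : VField) (x : Pt) (k : Fin 9) :
    covDeriv B Y X x (tr k) = ∑ a, Y a * pd a X x (tr k) + (B k * x (tr k)) * (Y mi * X x mi) := by
  simp only [covDeriv, mul_add, Finset.sum_add_distrib, christoffel_tr]
  simp
  ring

/-- Vanishing torsion, from the symmetry of the Christoffel symbols. It removes the connection from
the spinorial Lie derivative. -/
theorem covDeriv_sub_covDeriv (B : Fin 9 → ℝ) (X Y : VField) (x : Pt) :
    covDeriv B (X x) Y x - covDeriv B (Y x) X x = lie X Y x := by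
  ext e
  have h : ∑ a, X x a * ∑ b, (christoffel B x e a b : ℂ) * Y x b
      = ∑ a, Y x a * ∑ b, (christoffel B x e a b : ℂ) * X x b := by
    simp only [Finset.mul_sum]
    rw [Finset.sum_comm]
    refine Finset.sum_congr rfl fun a _ => Finset.sum_congr rfl fun b _ => ?_
    rw [christoffel_symm]
    ring
  simp only [covDeriv, lie, Pi.sub_apply, mul_add, Finset.sum_add_distrib,
    Finset.sum_sub_distrib, h]
  ring

theorem ip_frame_pl (B : Fin 9 → ℝ) (x : Pt) (V : Ix → ℂ) : ip B x (frame B pl x) V = -V mi := by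
  simp [ip, frame, metric, eta]

theorem ip_frame_mi (B : Fin 9 → ℝ) (x : Pt) (V : Ix → ℂ) :
    ip B x (frame B mi x) V
      = -V pl + (1 / 2) * (∑ i, (B i : ℂ) * (x (tr i) : ℂ) ^ 2) * V mi := by
  simp [ip, frame, metric, eta]
  ring

theorem ip_frame_tr (B : Fin 9 → ℝ) (x : Pt) (V : Ix → ℂ) (i : Fin 9) :
    ip B x (frame B (tr i) x) V = V (tr i) := by
  simp [ip, frame, metric, eta, Pi.single_apply, apply_ite]

theorem contDiff_frame (B : Fin 9 → ℝ) (A : Ix) : ContDiff ℝ ∞ (frame B A) := by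
  refine contDiff_pi.2 fun e => ?_
  have h : ContDiff ℝ ∞ fun x : Pt => ∑ i, (B i : ℂ) * (x (tr i) : ℂ) ^ 2 :=
    ContDiff.sum fun i _ => contDiff_const.mul ((contDiff_coord _).pow 2)
  induction A using ix_cases
  · exact contDiff_const
  · simp only [frame]
    simp
    exact contDiff_const.sub ((contDiff_const.mul h).mul contDiff_const)
  · exact contDiff_const

theorem pd_frame_pl (B : Fin 9 → ℝ) (x : Pt) (a : Ix) : pd a (frame B pl) x = 0 :=
  pd_const _ _ _

theorem pd_frame_tr (B : Fin 9 → ℝ) (x : Pt) (a : Ix) (i : Fin 9) : pd a (frame B (tr i)) x = 0 :=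
  pd_const _ _ _

theorem pd_frame_mi (B : Fin 9 → ℝ) (x : Pt) (a : Ix) :
    pd a (frame B mi) x
      = -(Sum.elim (fun _ => 0) (fun i => (B i : ℂ) * x (tr i)) a : ℂ) • Pi.single pl 1 := by
  ext e
  have hd : ∀ i, DifferentiableAt ℝ (fun x : Pt => (B i : ℂ) * (x (tr i) : ℂ) ^ 2) x := fun i =>
    (contDiff_const.mul ((contDiff_coord _).pow 2)).differentiable (by simp) x
  have h1 : ∀ i, pd a (fun x : Pt => (B i : ℂ) * (x (tr i) : ℂ) ^ 2) x
      = if a = tr i then (2 * B i * x (tr i) : ℂ) else 0 := fun i =>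
    pd_comp_coord a (tr i) (h := fun t : ℝ => (B i : ℂ) * (t : ℂ) ^ 2) (h' := 2 * B i * x (tr i))
      ((((Complex.ofRealCLM.hasDerivAt (x := x (tr i))).pow 2).const_mul (B i : ℂ)).congr_deriv
        (by simp; ring))
  rw [pd_apply a ((contDiff_frame B mi).differentiable (by simp) x)]
  have h2 : (fun y => frame B mi y e) = fun y => (Pi.single mi (-1) : Ix → ℂ) e
      - ((1 / 2 : ℂ) * ∑ i, (B i : ℂ) * (y (tr i) : ℂ) ^ 2) * (Pi.single pl 1 : Ix → ℂ) e := by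
    ext y
    simp [frame, Pi.single_neg]
  have hs : DifferentiableAt ℝ (fun x : Pt => ∑ i, (B i : ℂ) * (x (tr i) : ℂ) ^ 2) x :=
    DifferentiableAt.fun_sum fun i _ => hd i
  rw [h2, pd_sub _ (differentiableAt_const _) ((hs.const_mul _).mul_const _), pd_const,
    pd_mul _ (hs.const_mul _) (differentiableAt_const _), pd_const,
    pd_mul _ (differentiableAt_const _) hs, pd_const, pd_sum _ _ fun i _ => hd i]
  simp only [h1]
  rcases a with a | a <;> simp
  left; ring

/-! ## The spin connection -/

theorem gamUp_pl (ρ : SpinRep S) : gamUp ρ pl = gam ρ mi := by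
  simp [gamUp, sum_ix, eta]

theorem gamUp_mi (ρ : SpinRep S) : gamUp ρ mi = gam ρ pl := by
  simp [gamUp, sum_ix, eta]

theorem gamUp_tr (ρ : SpinRep S) (i : Fin 9) : gamUp ρ (tr i) = gam ρ (tr i) := by
  simp [gamUp, sum_ix, eta, apply_ite]

/-- Components of the infinitesimal null rotation with parameters `u`. -/
def boost (u : Fin 9 → ℂ) (A C : Ix) : ℂ :=
  (if A = mi then Sum.elim (fun _ => 0) u C else 0)
    - (if C = mi then Sum.elim (fun _ => 0) u A else 0)

/-- Only index pairs with exactly one `mi` contribute. Raising it turns it into Γ_+, and the two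
orders agree because Γ_+ anticommutes with Γ_k, so 1/4 becomes 1/2. -/
theorem spinEnd_boost (ρ : SpinRep S) (u : Fin 9 → ℂ) (ψ : S) :
    spinEnd ρ (boost u) ψ = -((1 / 2 : ℂ) • ∑ k, u k • gam ρ pl (gam ρ (tr k) ψ)) := by
  simp only [spinEnd, sum_ix, gamUp_pl, gamUp_mi, gamUp_tr, boost]
  simp [tr_pl]
  module

theorem spinEnd_sub (ρ : SpinRep S) (w w' : Ix → Ix → ℂ) :
    spinEnd ρ w - spinEnd ρ w' = spinEnd ρ (fun A C => w A C - w' A C) := by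
  simp only [spinEnd, sub_smul, Finset.sum_sub_distrib, smul_sub]
  abel

theorem spinEnd_add (ρ : SpinRep S) (w w' : Ix → Ix → ℂ) :
    spinEnd ρ (fun A C => w A C + w' A C) = spinEnd ρ w + spinEnd ρ w' := by
  simp only [spinEnd, add_smul, Finset.sum_add_distrib, smul_add]
  abel

theorem spinEnd_smul (ρ : SpinRep S) (z : ℂ) (w : Ix → Ix → ℂ) :
    spinEnd ρ (fun A C => z * w A C) = z • spinEnd ρ w := by
  simp only [spinEnd, mul_smul, ← Finset.smul_sum, smul_neg]
  rw [smul_comm z]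

theorem spinEnd_zero (ρ : SpinRep S) : spinEnd ρ (fun _ _ => 0) = 0 := by
  simp [spinEnd]

/-- In the chosen frame the Levi-Civita connection form is an infinitesimal null rotation with
parameters Y^- B_k x^k. -/
theorem spinNabla_eq (ρ : SpinRep S) (B : Fin 9 → ℝ) (Y : Ix → ℂ) (ξ : Pt → S) (x : Pt) :
    spinNabla ρ B Y ξ x = ∑ a, Y a • pd a ξ x
      - (1 / 2 * Y mi : ℂ) • ∑ k, ((B k : ℂ) * x (tr k)) • gam ρ pl (gam ρ (tr k) (ξ x)) := by
  have h : (fun A C => ip B x (frame B A x) (covDeriv B Y (frame B C) x))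
      = boost (fun k => Y mi * (B k * x (tr k))) := by
    funext A C
    induction A using ix_cases <;> induction C using ix_cases <;>
      simp [ip_frame_pl, ip_frame_mi, ip_frame_tr, covDeriv_pl, covDeriv_mi, covDeriv_tr,
        pd_frame_pl, pd_frame_mi, pd_frame_tr, boost] <;> simp [frame]
    · rw [neg_add_eq_zero]
      exact Finset.sum_congr rfl fun k _ => mul_comm _ _
    · simp [Pi.single_apply]
      ring
    · ring
  rw [spinNabla, h, spinEnd_boost, sub_eq_add_neg]
  simp only [mul_smul, ← Finset.smul_sum]

theorem frameCoord_mi (B : Fin 9 → ℝ) (x : Pt) (Y : Ix → ℂ) : frameCoord B x Y mi = -Y mi := by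
  simp [frameCoord, sum_ix, eta, ip_frame_pl]

theorem frameCoord_tr (B : Fin 9 → ℝ) (x : Pt) (Y : Ix → ℂ) (i : Fin 9) :
    frameCoord B x Y (tr i) = Y (tr i) := by
  simp [frameCoord, sum_ix, eta, ip_frame_tr, apply_ite]

/-- The connection coefficients of `D` with respect to the coordinate fields. -/
def connCoef (ρ : SpinRep S) (B : Fin 9 → ℝ) (c d : Module.End ℂ S) (x : Pt) (a : Ix) :
    Module.End ℂ S :=
  match a with
  | Sum.inl s =>
      if s = 0 then 0
      else -((1 / 2 : ℂ) • ∑ k, ((B k : ℂ) * x (tr k)) • (gam ρ pl * gam ρ (tr k)))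
        - connTerm ρ c d mi
  | Sum.inr i => connTerm ρ c d (tr i)

theorem conn_eq (ρ : SpinRep S) (B : Fin 9 → ℝ) (c d : Module.End ℂ S) (Y : Ix → ℂ) (ξ : Pt → S)
    (x : Pt) : conn ρ B c d Y ξ x = ∑ a, Y a • (pd a ξ x + connCoef ρ B c d x a (ξ x)) := by
  have h0 : connTerm ρ c d pl = 0 := by simp [connTerm]
  rw [conn, spinNabla_eq]
  simp only [smul_add, Finset.sum_add_distrib]
  -- The component of Y along e_- is -Y^-, which is the origin of the minus sign of `connTerm` in
  -- `connCoef`; the component along e_+ is not needed.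
  rw [sum_ix (fun A => frameCoord B x Y A • connTerm ρ c d A (ξ x)),
    sum_ix (fun a => Y a • connCoef ρ B c d x a (ξ x)), h0, frameCoord_mi]
  simp [frameCoord_tr, connCoef, smul_sub]
  module

/-! ## Normal forms -/

section
variable (ρ : SpinRep S)

theorem cElt_apply (ap am : ℂ) (ψ : S) :
    cElt ρ ap am ψ = ((ap + am) / 2) • gam123 ρ ψ + ((ap - am) / 2) • gam123 ρ (gam1245 ρ ψ) := by
  simp [cElt, projPlus, projMinus, gam1245_gam123]
  module

theorem dElt_apply (ap' : ℂ) (ψ : S) :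
    dElt ρ ap' ψ = (ap' / 2) • (gam123 ρ ψ + gam123 ρ (gam1245 ρ ψ)) := by
  simp [dElt, projPlus, gam1245_gam123]
  module

theorem sigPlus_apply (ψ : S) : sigPlus ρ ψ = ψ + (1 / 2 : ℂ) • gam ρ pl (gam ρ mi ψ) := by
  simp [sigPlus, mi_pl]
  module

theorem sigMinus_apply (ψ : S) : sigMinus ρ ψ = -(1 / 2 : ℂ) • gam ρ pl (gam ρ mi ψ) := by
  simp [sigMinus]

theorem projMinus_apply (ψ : S) : projMinus ρ ψ = (1 / 2 : ℂ) • (ψ - gam1245 ρ ψ) := by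
  simp [projMinus]

/-- The projection σ_+ disappears: ψ - σ_+ψ lies in the image of Γ_+, and Γ_+ s_i Γ_+ = 0 because
Γ_+ commutes with s_i up to sign. -/
theorem connTerm_tr (ap am ap' : ℂ) (i : Fin 9) (ψ : S) :
    connTerm ρ (cElt ρ ap am) (dElt ρ ap') (tr i) ψ
      = -(((ap + am) / 2 - eps i * ap' / 2) / 2) • gam ρ pl (gam123 ρ (gam ρ (tr i) ψ))
        - (((ap - am) / 2 * del i - eps i * ap' / 2) / 2) •
          gam ρ pl (gam123 ρ (gam ρ (tr i) (gam1245 ρ ψ))) := by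
  simp [connTerm, sMap, cElt_apply, dElt_apply, sigPlus_apply]
  module

theorem connTerm_mi (ap am ap' : ℂ) (ψ : S) :
    connTerm ρ (cElt ρ ap am) (dElt ρ ap') mi ψ
      = (((ap + am) / 2) / 2) • gam ρ pl (gam ρ mi (gam123 ρ ψ))
        + (((ap - am) / 2) / 2) • gam ρ pl (gam ρ mi (gam123 ρ (gam1245 ρ ψ)))
        + (ap' / 2) • (gam123 ρ ψ + gam123 ρ (gam1245 ρ ψ)
          + (1 / 2 : ℂ) • gam ρ pl (gam ρ mi (gam123 ρ ψ))
          + (1 / 2 : ℂ) • gam ρ pl (gam ρ mi (gam123 ρ (gam1245 ρ ψ)))) := by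
  simp [connTerm, sMap, cElt_apply, dElt_apply, sigPlus_apply]
  module

end

/-! ## Curvature -/

theorem connCoef_apply_mi (ρ : SpinRep S) (B : Fin 9 → ℝ) (c d : Module.End ℂ S) (x : Pt) (ψ : S) :
    connCoef ρ B c d x mi ψ
      = -((1 / 2 : ℂ) • ∑ k, ((B k : ℂ) * x (tr k)) • gam ρ pl (gam ρ (tr k) ψ))
        - connTerm ρ c d mi ψ := by
  simp [connCoef]

/-- The covariant derivative `D` along a coordinate field. -/
def covd (ρ : SpinRep S) (B : Fin 9 → ℝ) (c d : Module.End ℂ S) (a : Ix) (ξ : Pt → S) (x : Pt) :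
    S :=
  pd a ξ x + connCoef ρ B c d x a (ξ x)

theorem conn_eq_covd (ρ : SpinRep S) (B : Fin 9 → ℝ) (c d : Module.End ℂ S) (Y : Ix → ℂ)
    (ξ : Pt → S) (x : Pt) : conn ρ B c d Y ξ x = ∑ a, Y a • covd ρ B c d a ξ x :=
  conn_eq ρ B c d Y ξ x

section
variable [FiniteDimensional ℂ S]

/-- A linear endomorphism as a continuous real-linear map. -/
def toRealCLM (T : Module.End ℂ S) : S →L[ℝ] S :=
  (LinearMap.toContinuousLinearMap T).restrictScalars ℝ

theorem toRealCLM_apply (T : Module.End ℂ S) (ψ : S) : toRealCLM T ψ = T ψ := rfl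

theorem pd_end (T : Module.End ℂ S) (a : Ix) {f : Pt → S} {x : Pt} (hf : DifferentiableAt ℝ f x) :
    pd a (fun y => T (f y)) x = T (pd a f x) :=
  pd_clm (toRealCLM T) a hf

theorem contDiff_end (T : Module.End ℂ S) {f : Pt → S} (hf : ContDiff ℝ ∞ f) :
    ContDiff ℝ ∞ (fun y => T (f y)) :=
  (toRealCLM T).contDiff.comp hf

/-- The derivative `∂_b` of the connection coefficient `A_a`. -/
def dConnCoef (ρ : SpinRep S) (B : Fin 9 → ℝ) (b a : Ix) : Module.End ℂ S :=
  if a = mi then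
    Sum.elim (fun _ => 0) (fun k => -((1 / 2 * B k : ℂ) • (gam ρ pl * gam ρ (tr k)))) b
  else 0

/-- The curvature of `D` with respect to the coordinate fields. -/
def curv (ρ : SpinRep S) (B : Fin 9 → ℝ) (c d : Module.End ℂ S) (x : Pt) (b a : Ix) :
    Module.End ℂ S :=
  dConnCoef ρ B b a - dConnCoef ρ B a b
    + (connCoef ρ B c d x b * connCoef ρ B c d x a - connCoef ρ B c d x a * connCoef ρ B c d x b)

theorem contDiff_connCoef (ρ : SpinRep S) (B : Fin 9 → ℝ) (c d : Module.End ℂ S) (a : Ix)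
    {ξ : Pt → S} (hξ : ContDiff ℝ ∞ ξ) :
    ContDiff ℝ ∞ (fun y => connCoef ρ B c d y a (ξ y)) := by
  induction a using ix_cases
  · exact contDiff_const
  · simp only [connCoef_apply_mi]
    refine (ContDiff.neg (contDiff_const.smul (ContDiff.sum fun k _ => ?_))).sub
      (contDiff_end _ hξ)
    exact (contDiff_const.mul (contDiff_coord _)).smul (contDiff_end _ (contDiff_end _ hξ))
  · exact contDiff_end _ hξ

theorem pd_connCoef (ρ : SpinRep S) (B : Fin 9 → ℝ) (c d : Module.End ℂ S) (b a : Ix)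
    {ξ : Pt → S} (hξ : ContDiff ℝ ∞ ξ) (x : Pt) :
    pd b (fun y => connCoef ρ B c d y a (ξ y)) x
      = dConnCoef ρ B b a (ξ x) + connCoef ρ B c d x a (pd b ξ x) := by
  have hd : DifferentiableAt ℝ ξ x := hξ.differentiable (by simp) x
  induction a using ix_cases with
  | hp => simp [connCoef, dConnCoef, pd_const]
  | hm =>
    have h1 : ∀ k, DifferentiableAt ℝ (fun y : Pt => (B k : ℂ) * (y (tr k) : ℂ)) x := fun k =>
      (contDiff_const.mul (contDiff_coord _)).differentiable (by simp) x
    have h2 : ∀ k, DifferentiableAt ℝ (fun y : Pt => gam ρ pl (gam ρ (tr k) (ξ y))) x := fun k =>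
      (contDiff_end _ (contDiff_end _ hξ)).differentiable (by simp) x
    have h2' : ∀ k, DifferentiableAt ℝ (fun y : Pt => gam ρ (tr k) (ξ y)) x := fun k =>
      (contDiff_end _ hξ).differentiable (by simp) x
    have h3 : DifferentiableAt ℝ (fun y : Pt => ∑ k, ((B k : ℂ) * (y (tr k) : ℂ)) •
        gam ρ pl (gam ρ (tr k) (ξ y))) x :=
      DifferentiableAt.fun_sum fun k _ => (h1 k).fun_smul (h2 k)
    have h4 : ∀ k, pd b (fun y : Pt => (B k : ℂ) * (y (tr k) : ℂ)) x
        = if b = tr k then (B k : ℂ) else 0 := by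
      intro k
      rw [pd_mul _ (differentiableAt_const _) ((contDiff_coord _).differentiable (by simp) x),
        pd_const, pd_coord]
      simp
    simp only [connCoef_apply_mi]
    rw [pd_sub _ ((differentiableAt_const _).fun_smul h3).fun_neg
      ((contDiff_end _ hξ).differentiable (by simp) x), pd_neg,
      pd_smul _ (differentiableAt_const _) h3, pd_const, pd_end _ _ hd,
      pd_sum _ _ fun k _ => (h1 k).fun_smul (h2 k)]
    have h5 : ∀ k, pd b
        (fun y : Pt => ((B k : ℂ) * (y (tr k) : ℂ)) • gam ρ pl (gam ρ (tr k) (ξ y))) x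
        = (if b = tr k then (B k : ℂ) else 0) • gam ρ pl (gam ρ (tr k) (ξ x))
          + ((B k : ℂ) * x (tr k)) • gam ρ pl (gam ρ (tr k) (pd b ξ x)) := by
      intro k
      rw [pd_smul _ (h1 k) (h2 k), h4, pd_end _ _ (h2' k), pd_end _ _ hd]
    simp only [h5, Finset.sum_add_distrib]
    rcases b with b | b
    · simp [dConnCoef]
    · simp [dConnCoef, smul_smul]
      module
  | ht i =>
    simp only [connCoef]
    rw [pd_end _ _ hd]
    simp [dConnCoef]

theorem contDiff_covd (ρ : SpinRep S) (B : Fin 9 → ℝ) (c d : Module.End ℂ S) (a : Ix)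
    {ξ : Pt → S} (hξ : ContDiff ℝ ∞ ξ) : ContDiff ℝ ∞ (covd ρ B c d a ξ) :=
  (contDiff_pd hξ a).add (contDiff_connCoef ρ B c d a hξ)

/-- Second derivatives cancel by Schwarz and the first-order terms are symmetric in a and b, so only
an endomorphism remains. -/
theorem covd_covd_sub (ρ : SpinRep S) (B : Fin 9 → ℝ) (c d : Module.End ℂ S) (b a : Ix)
    {ξ : Pt → S} (hξ : ContDiff ℝ ∞ ξ) (x : Pt) :
    covd ρ B c d b (covd ρ B c d a ξ) x - covd ρ B c d a (covd ρ B c d b ξ) x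
      = curv ρ B c d x b a (ξ x) := by
  have h : ∀ b a, covd ρ B c d b (covd ρ B c d a ξ) x
      = pd b (fun y => pd a ξ y) x + dConnCoef ρ B b a (ξ x) + connCoef ρ B c d x a (pd b ξ x)
        + connCoef ρ B c d x b (pd a ξ x)
        + connCoef ρ B c d x b (connCoef ρ B c d x a (ξ x)) := by
    intro b a
    have h1 : pd b (covd ρ B c d a ξ) x = pd b (fun y => pd a ξ y) x
        + pd b (fun y => connCoef ρ B c d y a (ξ y)) x :=
      pd_add b ((contDiff_pd hξ a).differentiable (by simp) x)
        ((contDiff_connCoef ρ B c d a hξ).differentiable (by simp) x)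
    rw [covd, h1, pd_connCoef ρ B c d b a hξ]
    simp only [covd, map_add]
    abel
  rw [h, h, pd_comm hξ a b]
  simp only [curv, LinearMap.add_apply, LinearMap.sub_apply, Module.End.mul_apply]
  abel

theorem conn_conn (ρ : SpinRep S) (B : Fin 9 → ℝ) (c d : Module.End ℂ S) (Y Z : VField)
    (ξ : Pt → S) (hZ : ContDiff ℝ ∞ Z) (hξ : ContDiff ℝ ∞ ξ) (x : Pt) :
    conn ρ B c d (Y x) (fun y => conn ρ B c d (Z y) ξ y) x
      = ∑ b, ∑ a, (Y x b * Z x a) • covd ρ B c d b (covd ρ B c d a ξ) x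
        + ∑ a, (∑ b, Y x b * pd b Z x a) • covd ρ B c d a ξ x := by
  have hZa : ∀ a, DifferentiableAt ℝ (fun y => Z y a) x := fun a =>
    (contDiff_pi.1 hZ a).differentiable (by simp) x
  have hc : ∀ a, DifferentiableAt ℝ (covd ρ B c d a ξ) x := fun a =>
    (contDiff_covd ρ B c d a hξ).differentiable (by simp) x
  have h : ∀ b, covd ρ B c d b (fun y => conn ρ B c d (Z y) ξ y) x
      = ∑ a, (pd b Z x a • covd ρ B c d a ξ x + Z x a • covd ρ B c d b (covd ρ B c d a ξ) x) := by
    intro b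
    simp only [conn_eq_covd]
    rw [covd, pd_sum _ _ fun a _ => (hZa a).fun_smul (hc a), map_sum, ← Finset.sum_add_distrib]
    refine Finset.sum_congr rfl fun a _ => ?_
    rw [pd_smul _ (hZa a) (hc a), pd_apply b (hZ.differentiable (by simp) x)]
    rw [map_smul, covd.eq_def ρ B c d b (covd ρ B c d a ξ) x, smul_add]
    abel
  rw [conn_eq_covd]
  simp only [h, Finset.smul_sum, smul_add, Finset.sum_add_distrib, Finset.sum_smul, smul_smul]
  rw [add_comm, Finset.sum_comm (γ := Ix) (f := fun b a => (Y x b * pd b Z x a) • _)]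

/-- Curvature is tensorial: coordinate fields and constant spinors detect it, and for general fields
the derivatives of the coefficients add up to the term with the commutator (`conn_conn`). -/
theorem isFlat_iff_curv (ρ : SpinRep S) (B : Fin 9 → ℝ) (c d : Module.End ℂ S) :
    IsFlat ρ B c d ↔ ∀ x b a, curv ρ B c d x b a = 0 := by
  constructor
  · intro h x b a
    ext ψ
    have h1 := h (fun _ => Pi.single b 1) (fun _ => Pi.single a 1) (fun _ => ψ) contDiff_const
      contDiff_const contDiff_const x
    have h0 : lie (fun _ => Pi.single b 1) (fun _ => Pi.single a 1) x = 0 := by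
      ext e
      simp [lie, pd_const]
    have hc : ∀ (a : Ix) (f : Pt → S) (x : Pt),
        conn ρ B c d (Pi.single a 1) f x = covd ρ B c d a f x := by
      intro a f x
      simp [conn_eq_covd, Pi.single_apply]
    rw [h0] at h1
    simp only [hc] at h1
    have h2 := covd_covd_sub ρ B c d b a (contDiff_const (c := ψ)) x
    rw [← h2, LinearMap.zero_apply]
    refine h1.trans ?_
    simp [conn_eq_covd]
  · intro h Y Z ξ hY hZ hξ x
    rw [conn_conn ρ B c d Y Z ξ hZ hξ, conn_conn ρ B c d Z Y ξ hY hξ, conn_eq_covd]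
    have hcc : ∀ b a, covd ρ B c d b (covd ρ B c d a ξ) x
        = covd ρ B c d a (covd ρ B c d b ξ) x := by
      intro b a
      have := covd_covd_sub ρ B c d b a hξ x
      rwa [h, LinearMap.zero_apply, sub_eq_zero] at this
    have h1 : ∑ b, ∑ a, (Y x b * Z x a) • covd ρ B c d b (covd ρ B c d a ξ) x
        = ∑ b, ∑ a, (Z x b * Y x a) • covd ρ B c d b (covd ρ B c d a ξ) x := by
      rw [Finset.sum_comm]
      refine Finset.sum_congr rfl fun b _ => Finset.sum_congr rfl fun a _ => ?_
      rw [hcc, mul_comm]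
    rw [h1]
    simp only [lie, Finset.sum_sub_distrib, sub_smul]
    abel

end

/-! ### The curvature of the family and the flatness criterion. -/

section
variable (ρ : SpinRep S)

/-- The coefficients of the curvature of `D`. -/
def curvCoef (B : Fin 9 → ℝ) (ap am : ℂ) (i : Fin 9) : ℂ :=
  (am * (1 + del i) / 2 + ap * (1 - del i) / 2) ^ 2 + B i

theorem del_sq (i : Fin 9) : del i * del i = 1 := by
  fin_cases i <;> simp [del, block]

/-- Where Γ_1245 = 1 the connection contributes μ_i², which cancels B_i. Where Γ_1245 = -1 one has d
= 0, and s_i is cΓ_i with the roles of α_+ and α_- interchanged; its square does not cancel in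
general. -/
theorem curv_tr_mi (B : Fin 9 → ℝ) (ap am ap' : ℂ) (hB : ∀ i, (B i : ℂ) = -(mu ap am ap' i) ^ 2)
    (x : Pt) (i : Fin 9) (ψ : S) :
    curv ρ B (cElt ρ ap am) (dElt ρ ap') x (tr i) mi ψ
      = -(curvCoef B ap am i / 4) • (gam ρ pl (gam ρ (tr i) ψ)
        - gam ρ pl (gam ρ (tr i) (gam1245 ρ ψ))) := by
  have h1 : eps i = 1 ∨ eps i = -1 := mul_self_eq_one_iff.1 (eps_sq i)
  have h2 : del i = 1 ∨ del i = -1 := mul_self_eq_one_iff.1 (del_sq i)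
  have h3 := hB i
  simp only [curv, LinearMap.add_apply, LinearMap.sub_apply, Module.End.mul_apply,
    connCoef_apply_mi]
  simp only [connCoef, connTerm_tr, connTerm_mi]
  simp [dConnCoef, connTerm_tr, connTerm_mi, smul_smul]
  simp only [curvCoef]
  rw [mu_eq] at h3
  rw [h3]
  rcases h1 with h1 | h1 <;> rcases h2 with h2 | h2 <;> rw [h1, h2] <;> simp <;> module

theorem curv_mi_tr (B : Fin 9 → ℝ) (c d : Module.End ℂ S) (x : Pt) (a b : Ix) :
    curv ρ B c d x a b = -curv ρ B c d x b a := by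
  simp only [curv]; abel

theorem curv_tr_tr (B : Fin 9 → ℝ) (ap am ap' : ℂ) (x : Pt) (i j : Fin 9) :
    curv ρ B (cElt ρ ap am) (dElt ρ ap') x (tr i) (tr j) = 0 := by
  ext ψ
  simp [curv, dConnCoef, connCoef, connTerm_tr]

theorem curv_pl (B : Fin 9 → ℝ) (c d : Module.End ℂ S) (x : Pt) (a : Ix) :
    curv ρ B c d x pl a = 0 := by
  induction a using ix_cases <;> simp [curv, dConnCoef, connCoef]

/-- Γ_1 anticommutes with Γ_1245 and so exchanges its eigenspaces; a vector outside the
(-1)-eigenspace has a nonzero projection to the other one. -/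
theorem exists_gam1245_eq [Nontrivial S] : ∃ ψ : S, ψ ≠ 0 ∧ gam1245 ρ ψ = ψ := by
  obtain ⟨ψ, hψ⟩ := exists_ne (0 : S)
  by_cases h : gam1245 ρ ψ = -ψ
  · refine ⟨gam ρ (tr 0) ψ, fun h0 => hψ ?_, ?_⟩
    · have := congrArg (gam ρ (tr 0)) h0
      simpa using this
    · simp [h, del, block]
  · refine ⟨ψ + gam1245 ρ ψ, fun h0 => h ?_, ?_⟩
    · rwa [add_comm, add_eq_zero_iff_eq_neg] at h0
    · simp [add_comm]

theorem exists_gam1245_eq_neg [Nontrivial S] : ∃ ψ : S, ψ ≠ 0 ∧ gam1245 ρ ψ = -ψ := by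
  obtain ⟨ψ, hψ, h⟩ := exists_gam1245_eq ρ
  refine ⟨gam ρ (tr 0) ψ, fun h0 => hψ ?_, ?_⟩
  · have := congrArg (gam ρ (tr 0)) h0
    simpa using this
  · simp [h, del, block]

theorem exists_gam_pl_ne_zero [Nontrivial S] : ∃ ψ : S, gam ρ pl ψ ≠ 0 ∧ gam1245 ρ ψ = -ψ := by
  obtain ⟨ψ, hψ, h⟩ := exists_gam1245_eq_neg ρ
  by_cases hp : gam ρ pl ψ = 0
  -- If Γ_+ kills ψ then Γ_+Γ_-ψ = -2ψ, so Γ_-ψ can serve instead; Γ_- commutes with Γ_1245.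
  · refine ⟨gam ρ mi ψ, fun h0 => hψ ?_, by simp [h]⟩
    have := mi_pl ρ ψ
    simpa [hp, h0] using this
  · exact ⟨ψ, hp, h⟩

theorem isFlat_iff_curvCoef [FiniteDimensional ℂ S] [Nontrivial S] (B : Fin 9 → ℝ) (ap am ap' : ℂ)
    (hB : ∀ i, (B i : ℂ) = -(mu ap am ap' i) ^ 2) :
    IsFlat ρ B (cElt ρ ap am) (dElt ρ ap') ↔ ∀ i, curvCoef B ap am i = 0 := by
  rw [isFlat_iff_curv]
  constructor
  · intro h i
    obtain ⟨ψ, hψ, hH⟩ := exists_gam_pl_ne_zero ρ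
    have h1 := curv_tr_mi ρ B ap am ap' hB 0 i ψ
    rw [h, hH, LinearMap.zero_apply, eq_comm, smul_eq_zero] at h1
    rcases h1 with h1 | h1
    · linear_combination -4 * h1
    · exfalso
      have h2 := congrArg (gam ρ (tr i)) h1
      simp only [map_neg, sub_neg_eq_add, map_add, tr_pl, tr_self, map_zero, neg_neg] at h2
      rw [← two_smul ℂ, smul_eq_zero] at h2
      exact hψ (h2.resolve_left two_ne_zero)
  · intro h x b a
    have h1 : ∀ i, curv ρ B (cElt ρ ap am) (dElt ρ ap') x (tr i) mi = 0 := by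
      intro i
      ext ψ
      rw [curv_tr_mi ρ B ap am ap' hB, h]
      simp
    induction b using ix_cases with
    | hp => exact curv_pl ρ B _ _ x a
    | hm =>
      rw [curv_mi_tr]
      induction a using ix_cases with
      | hp => rw [curv_pl, neg_zero]
      | hm => simp [curv]
      | ht i => rw [h1, neg_zero]
    | ht j =>
      induction a using ix_cases with
      | hp => rw [curv_mi_tr, curv_pl, neg_zero]
      | hm => exact h1 j
      | ht i => exact curv_tr_tr ρ B ap am ap' x j i

/-- One equation per block: α_+² = (α_- ± α'_+)² and α_-² = (α_+ ± α'_+)². Differences give α'_+α_±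
= 0; if α'_+ were nonzero, α_± would vanish and the last block would force α'_+ = 0. -/
theorem curvCoef_eq_zero_iff (B : Fin 9 → ℝ) (ap am ap' : ℂ)
    (hB : ∀ i, (B i : ℂ) = -(mu ap am ap' i) ^ 2) :
    (∀ i, curvCoef B ap am i = 0) ↔ ap' = 0 ∧ ap ^ 2 = am ^ 2 := by
  simp only [curvCoef, hB]
  constructor
  · intro h
    have h0 := h 0
    have h2 := h 2
    have h3 := h 3
    have h5 := h 5
    simp [mu, del, block] at h0 h2 h3 h5
    have e1 : ap' * ap = 0 := by linear_combination (h2 - h5) / 4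
    have e2 : ap' * am = 0 := by linear_combination (h0 - h3) / 4
    have e0 : ap' = 0 := by
      by_contra hne
      have a1 : ap = 0 := (mul_eq_zero.1 e1).resolve_left hne
      have a2 : am = 0 := (mul_eq_zero.1 e2).resolve_left hne
      rw [a1, a2] at h5
      apply hne
      simpa using h5
    refine ⟨e0, ?_⟩
    rw [e0] at h5
    linear_combination -h5
  · rintro ⟨rfl, h⟩ i
    fin_cases i <;> simp [mu, del, block] <;>
      first | linear_combination h | linear_combination -h
end

/-! ## Parallel spinors -/

theorem mem_parallelSpinors_iff (ρ : SpinRep S) (B : Fin 9 → ℝ) (c d : Module.End ℂ S)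
    (ξ : Pt → S) :
    ξ ∈ parallelSpinors ρ B c d ↔ ContDiff ℝ ∞ ξ ∧ ∀ a x, covd ρ B c d a ξ x = 0 := by
  refine and_congr_right fun _ => ⟨fun h a x => ?_, fun h x Y => ?_⟩
  · have := h x (Pi.single a 1)
    simpa [conn_eq_covd, Pi.single_apply] using this
  · simp [conn_eq_covd, h]

/-! ### The integrability condition and the values of parallel spinors. -/

section
variable (ρ : SpinRep S)

/-- Γ_+ is injective on S_+ and kills S_-, so a condition on σ_+ψ can be tested after applying Γ_+
to ψ itself. This is the form in which the condition is used in rewriting. -/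
theorem projMinus_sigPlus_eq_zero_iff (ψ : S) :
    projMinus ρ (sigPlus ρ ψ) = 0 ↔ gam ρ pl (gam1245 ρ ψ) = gam ρ pl ψ := by
  have h : projMinus ρ (sigPlus ρ ψ)
      = (1 / 4 : ℂ) • gam ρ mi (gam ρ pl (gam1245 ρ ψ) - gam ρ pl ψ) := by
    simp [projMinus_apply, sigPlus_apply]
    module
  refine ⟨fun h0 => ?_, fun h0 => by rw [h, h0, sub_self, map_zero, smul_zero]⟩
  rw [h] at h0
  have h1 := congrArg (gam ρ pl) h0
  simp [smul_sub] at h1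
  have h2 : (1 / 2 : ℂ) • (gam ρ pl (gam1245 ρ ψ) - gam ρ pl ψ) = 0 := by
    rw [← neg_eq_zero, ← h1]
    module
  rw [smul_eq_zero, sub_eq_zero] at h2
  exact h2.resolve_left (by norm_num)

/-- The space of the initial values of parallel spinors. -/
def initSpace : Submodule ℂ S := LinearMap.ker (projMinus ρ * sigPlus ρ)

theorem mem_initSpace_iff {ψ : S} :
    ψ ∈ initSpace ρ ↔ gam ρ pl (gam1245 ρ ψ) = gam ρ pl ψ := by
  rw [initSpace, LinearMap.mem_ker, Module.End.mul_apply, projMinus_sigPlus_eq_zero_iff]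

/-- Apply Γ_i to the hypothesis and move it past Γ_+. With its two companions it discards Γ_1245 in
words that begin with Γ_+. -/
theorem pl_tr_gam1245 {ψ : S} (h : gam ρ pl (gam1245 ρ ψ) = gam ρ pl ψ) (i : Fin 9) :
    gam ρ pl (gam ρ (tr i) (gam1245 ρ ψ)) = gam ρ pl (gam ρ (tr i) ψ) := by
  have := congrArg (gam ρ (tr i)) h
  simpa using this

theorem pl_gam123_gam1245 {ψ : S} (h : gam ρ pl (gam1245 ρ ψ) = gam ρ pl ψ) :
    gam ρ pl (gam123 ρ (gam1245 ρ ψ)) = gam ρ pl (gam123 ρ ψ) := by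
  have := congrArg (gam123 ρ) h
  simpa using this

theorem pl_gam123_tr_gam1245 {ψ : S} (h : gam ρ pl (gam1245 ρ ψ) = gam ρ pl ψ) (i : Fin 9) :
    gam ρ pl (gam123 ρ (gam ρ (tr i) (gam1245 ρ ψ))) = gam ρ pl (gam123 ρ (gam ρ (tr i) ψ)) := by
  have := congrArg (gam123 ρ) (pl_tr_gam1245 ρ h i)
  simpa using this

/-- This is where μ_i enters: on admissible values, Γ_+ s_i reduces to μ_i Γ_+Γ_123Γ_i. -/
theorem connTerm_tr_of_mem (ap am ap' : ℂ) (i : Fin 9) {ψ : S}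
    (h : gam ρ pl (gam1245 ρ ψ) = gam ρ pl ψ) :
    connTerm ρ (cElt ρ ap am) (dElt ρ ap') (tr i) ψ
      = -(mu ap am ap' i / 2) • gam ρ pl (gam123 ρ (gam ρ (tr i) ψ)) := by
  rw [connTerm_tr, pl_gam123_tr_gam1245 ρ h, mu_eq]
  module

theorem connTerm_tr_pl (ap am ap' : ℂ) (i : Fin 9) (ψ : S) :
    connTerm ρ (cElt ρ ap am) (dElt ρ ap') (tr i) (gam ρ pl ψ) = 0 := by
  simp [connTerm_tr]

theorem connCoef_mi_pl (B : Fin 9 → ℝ) (ap am ap' : ℂ) (x : Pt) (ψ : S) :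
    connCoef ρ B (cElt ρ ap am) (dElt ρ ap') x mi (gam ρ pl ψ)
      = -gam ρ pl (cElt ρ ap am ψ) := by
  simp [connCoef_apply_mi, connTerm_mi, cElt_apply]
  module

theorem pl_connCoef_mi (B : Fin 9 → ℝ) (ap am ap' : ℂ) (x : Pt) {ψ : S}
    (h : gam ρ pl (gam1245 ρ ψ) = gam ρ pl ψ) :
    gam ρ pl (connCoef ρ B (cElt ρ ap am) (dElt ρ ap') x mi ψ)
      = -ap' • gam ρ pl (gam123 ρ ψ) := by
  simp [connCoef_apply_mi, connTerm_mi, pl_gam123_gam1245 ρ h]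
  module

end

section
variable [FiniteDimensional ℂ S] (ρ : SpinRep S) {B : Fin 9 → ℝ} {ap am ap' : ℂ}

/-- Integrability: the curvature annihilates a parallel spinor. A nonzero coefficient leaves
Γ_+Γ_i(1 - Γ_1245)ξ = 0, and Γ_i is invertible. -/
theorem value_mem_initSpace (hB : ∀ i, (B i : ℂ) = -(mu ap am ap' i) ^ 2)
    (hne : ∃ i, curvCoef B ap am i ≠ 0) {ξ : Pt → S}
    (hξ : ξ ∈ parallelSpinors ρ B (cElt ρ ap am) (dElt ρ ap')) (x : Pt) :
    ξ x ∈ initSpace ρ := by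
  obtain ⟨i, hi⟩ := hne
  rw [mem_parallelSpinors_iff] at hξ
  have h0 : ∀ a, covd ρ B (cElt ρ ap am) (dElt ρ ap') a ξ = fun _ => 0 := fun a =>
    funext fun y => hξ.2 a y
  have h1 := covd_covd_sub ρ B (cElt ρ ap am) (dElt ρ ap') (tr i) mi hξ.1 x
  rw [h0, h0, curv_tr_mi ρ B ap am ap' hB] at h1
  have h2 : ∀ a, covd ρ B (cElt ρ ap am) (dElt ρ ap') a (fun _ => (0 : S)) x = 0 := fun a => by
    simp [covd, pd_const]
  rw [h2, h2, sub_self, eq_comm, smul_eq_zero] at h1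
  have h3 := h1.resolve_left (by
    rw [neg_eq_zero]
    exact div_ne_zero hi (by norm_num))
  have h4 := congrArg (gam ρ (tr i)) h3
  rw [mem_initSpace_iff]
  simp only [map_sub, tr_pl, tr_self, map_zero, map_neg, neg_neg] at h4
  exact (sub_eq_zero.1 h4).symm

end

/-! ## The spinorial Lie derivative -/

theorem lie_apply_eq (X Y : VField) (x : Pt) :
    lie X Y x = ∑ a, X x a • pd a Y x - ∑ a, Y x a • pd a X x := by
  ext e
  simp [lie, Finset.sum_apply]

theorem ip_sub (B : Fin 9 → ℝ) (x : Pt) (u v w : Ix → ℂ) :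
    ip B x u (v - w) = ip B x u v - ip B x u w := by
  simp [ip, mul_sub, Finset.sum_sub_distrib]

/-- Without torsion, ∇_X e_C - ∇_{e_C} X = [X, e_C]: the zeroth-order term only measures how X moves
the frame. -/
theorem spinLie_eq (ρ : SpinRep S) (B : Fin 9 → ℝ) (X : VField) (ξ : Pt → S) (x : Pt) :
    spinLie ρ B X ξ x = ∑ a, X x a • pd a ξ x
      + spinEnd ρ (fun A C => ip B x (frame B A x) (lie X (frame B C) x)) (ξ x) := by
  simp only [spinLie, spinNabla, ← covDeriv_sub_covDeriv B, ip_sub, ← spinEnd_sub,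
    LinearMap.sub_apply]
  abel

/-- The vector field `f(x^-) ∂_i + g(x^-) x^i ∂_+`. -/
def heis (i : Fin 9) (f g : ℝ → ℂ) : VField := fun x =>
  f (x mi) • Pi.single (tr i) 1 + (g (x mi) * x (tr i)) • Pi.single pl 1

theorem pd_smul_const {E : Type*} [NormedAddCommGroup E] [NormedSpace ℂ E] (a : Ix) {f : Pt → ℂ}
    {x : Pt} (hf : DifferentiableAt ℝ f x) (v : E) :
    pd a (fun y => f y • v) x = pd a f x • v := by
  rw [pd_smul a hf (differentiableAt_const v), pd_const, smul_zero, add_zero]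

theorem pd_smul_const_apply (a : Ix) {f : Pt → ℂ} {x : Pt} (hf : DifferentiableAt ℝ f x)
    (v : Ix → ℂ) (e : Ix) : pd a (fun y => f y • v) x e = pd a f x * v e := by
  have h := hf.smul_const v
  rw [pd_apply a h]
  exact pd_smul_const a hf (v e)

theorem differentiableAt_comp_coord {E : Type*} [NormedAddCommGroup E] [NormedSpace ℝ E] {f : ℝ → E}
    {f' : E} {x : Pt} (b : Ix) (hf : HasDerivAt f f' (x b)) :
    DifferentiableAt ℝ (fun y : Pt => f (y b)) x :=
  hf.differentiableAt.comp x (differentiableAt_apply b x)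

theorem pd_heis (i : Fin 9) {f g : ℝ → ℂ} {f' g' : ℂ} {x : Pt} (hf : HasDerivAt f f' (x mi))
    (hg : HasDerivAt g g' (x mi)) (a e : Ix) :
    pd a (heis i f g) x e = (if a = mi then f' else 0) * (Pi.single (tr i) 1 : Ix → ℂ) e
      + ((if a = mi then g' else 0) * x (tr i) + g (x mi) * (if a = tr i then 1 else 0))
        * (Pi.single pl 1 : Ix → ℂ) e := by
  have h1 := differentiableAt_comp_coord mi hf
  have h2 := differentiableAt_comp_coord mi hg
  have h3 : DifferentiableAt ℝ (fun y : Pt => (y (tr i) : ℂ)) x :=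
    (contDiff_coord _).differentiable (by simp) x
  have h4 := pd_add (E := Ix → ℂ) a (h1.smul_const (Pi.single (tr i) 1 : Ix → ℂ))
    ((h2.mul h3).smul_const (Pi.single pl 1 : Ix → ℂ))
  have h5 := congrFun h4 e
  rw [Pi.add_apply] at h5
  refine h5.trans ?_
  rw [pd_smul_const_apply a h1, pd_comp_coord a mi hf]
  refine congrArg _ ((pd_smul_const_apply a (h2.mul h3) _ _).trans ?_)
  refine congrArg (· * _) ?_
  refine (pd_mul a h2 h3).trans ?_
  rw [pd_comp_coord a mi hg, pd_coord]

theorem pd_Krot (i j : Fin 9) (x : Pt) (a e : Ix) :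
    pd a (Krot i j) x e = (if a = tr j then 1 else 0) * (Pi.single (tr i) 1 : Ix → ℂ) e
      - (if a = tr i then 1 else 0) * (Pi.single (tr j) 1 : Ix → ℂ) e := by
  have h3 : ∀ i, DifferentiableAt ℝ (fun y : Pt => (y (tr i) : ℂ)) x := fun i =>
    (contDiff_coord _).differentiable (by simp) x
  have h4 := pd_sub (E := Ix → ℂ) a ((h3 j).smul_const (Pi.single (tr i) 1 : Ix → ℂ))
    ((h3 i).smul_const (Pi.single (tr j) 1 : Ix → ℂ))
  have h5 := congrFun h4 e
  rw [Pi.sub_apply] at h5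
  refine h5.trans ?_
  rw [pd_smul_const_apply a (h3 j), pd_smul_const_apply a (h3 i), pd_coord, pd_coord]

theorem pd_Kplus (a : Ix) (x : Pt) : pd a Kplus x = 0 := pd_const _ _ _

theorem pd_Kminus (a : Ix) (x : Pt) : pd a Kminus x = 0 := pd_const _ _ _

theorem spinLie_Kplus (ρ : SpinRep S) (B : Fin 9 → ℝ) (ξ : Pt → S) (x : Pt) :
    spinLie ρ B Kplus ξ x = -pd pl ξ x := by
  have h : (fun A C => ip B x (frame B A x) (lie Kplus (frame B C) x)) = fun _ _ => 0 := by
    funext A C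
    have : lie Kplus (frame B C) x = 0 := by
      rw [lie_apply_eq]
      induction C using ix_cases <;>
        simp [pd_Kplus, pd_frame_pl, pd_frame_mi, pd_frame_tr, Kplus, sum_ix]
    rw [this]
    simp [ip]
  rw [spinLie_eq, h, spinEnd_zero]
  simp [Kplus, sum_ix]

theorem spinLie_Kminus (ρ : SpinRep S) (B : Fin 9 → ℝ) (ξ : Pt → S) (x : Pt) :
    spinLie ρ B Kminus ξ x = -pd mi ξ x := by
  have h : (fun A C => ip B x (frame B A x) (lie Kminus (frame B C) x)) = fun _ _ => 0 := by
    funext A C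
    have : lie Kminus (frame B C) x = 0 := by
      rw [lie_apply_eq]
      induction C using ix_cases <;>
        simp [pd_Kminus, pd_frame_pl, pd_frame_mi, pd_frame_tr, Kminus, sum_ix]
    rw [this]
    simp [ip]
  rw [spinLie_eq, h, spinEnd_zero]
  simp [Kminus, sum_ix]

/-- Because f' = -g and g' = B_i f, the commutators with the frame are [X, e_-] = -g e_i and [X,
e_i] = g e_+, a null rotation with the single parameter g. -/
theorem spinLie_heis (ρ : SpinRep S) (B : Fin 9 → ℝ) (i : Fin 9) {f g : ℝ → ℂ}
    (hf : ∀ t, HasDerivAt f (-g t) t) (hg : ∀ t, HasDerivAt g (B i * f t) t) (ξ : Pt → S) (x : Pt) :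
    spinLie ρ B (heis i f g) ξ x = f (x mi) • pd (tr i) ξ x + (g (x mi) * x (tr i)) • pd pl ξ x
      - (1 / 2 * g (x mi)) • gam ρ pl (gam ρ (tr i) (ξ x)) := by
  have h : (fun A C => ip B x (frame B A x) (lie (heis i f g) (frame B C) x))
      = boost (fun k => if k = i then g (x mi) else 0) := by
    funext A C
    induction A using ix_cases <;> induction C using ix_cases <;>
      simp [ip_frame_pl, ip_frame_mi, ip_frame_tr, lie, pd_frame_pl, pd_frame_mi, pd_frame_tr,
        pd_heis i (hf _) (hg _), boost] <;> simp [frame, heis, sum_ix, Pi.single_apply]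
    · ring
    · simp only [eq_comm]
    · split_ifs <;> simp
  rw [spinLie_eq, h, spinEnd_boost]
  simp [heis, sum_ix, Pi.single_apply]
  module

/-- Components of the infinitesimal rotation in the plane of `i` and `j`. -/
def rotComp (i j : Fin 9) (A C : Ix) : ℂ :=
  (if A = tr j ∧ C = tr i then 1 else 0) - (if A = tr i ∧ C = tr j then 1 else 0)

theorem spinEnd_rotComp (ρ : SpinRep S) {i j : Fin 9} (hij : i ≠ j) (ψ : S) :
    spinEnd ρ (rotComp i j) ψ = (1 / 2 : ℂ) • gam ρ (tr i) (gam ρ (tr j) ψ) := by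
  have h := tr_tr ρ hij ψ
  simp [spinEnd, sum_ix, gamUp_pl, gamUp_mi, gamUp_tr, rotComp, sub_smul, ite_and,
    Finset.sum_sub_distrib]
  rw [h]
  module

/-- B_i = B_j makes the rotation preserve ∑ B_k (x^k)² and hence e_-, so the frame is merely rotated
in the plane of i and j. -/
theorem spinLie_Krot (ρ : SpinRep S) (B : Fin 9 → ℝ) {i j : Fin 9} (hij : i ≠ j)
    (hB : B i = B j) (ξ : Pt → S) (x : Pt) :
    spinLie ρ B (Krot i j) ξ x = (x (tr j) : ℂ) • pd (tr i) ξ x - (x (tr i) : ℂ) • pd (tr j) ξ x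
      + (1 / 2 : ℂ) • gam ρ (tr i) (gam ρ (tr j) (ξ x)) := by
  have h : (fun A C => ip B x (frame B A x) (lie (Krot i j) (frame B C) x)) = rotComp i j := by
    funext A C
    induction A using ix_cases <;> induction C using ix_cases <;>
      simp [ip_frame_pl, ip_frame_mi, ip_frame_tr, lie, pd_frame_pl, pd_frame_mi, pd_frame_tr,
        pd_Krot, rotComp] <;> simp [frame, Krot, sum_ix, Pi.single_apply]
    · simp [sub_mul, Finset.sum_sub_distrib, hB]
      ring
    · simp only [ite_and]
      split_ifs <;> rfl
  rw [spinLie_eq, h, spinEnd_rotComp ρ hij]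
  simp [Krot, sum_ix, Pi.single_apply, sub_smul, Finset.sum_sub_distrib]

/-! ## The action of the Killing fields on parallel spinors -/

section
variable (ρ : SpinRep S)

/-- Γ_iΓ_j acts on the Γ_k as an infinitesimal rotation. The formula remains valid for i = j, where
the two corrections cancel. -/
theorem rot_tr (i j k : Fin 9) (ψ : S) :
    gam ρ (tr i) (gam ρ (tr j) (gam ρ (tr k) ψ))
      = gam ρ (tr k) (gam ρ (tr i) (gam ρ (tr j) ψ))
        + (if k = i then (2 : ℂ) else 0) • gam ρ (tr j) ψ
        - (if k = j then (2 : ℂ) else 0) • gam ρ (tr i) ψ := by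
  have h : ∀ (a b : Fin 9) (ψ : S), gam ρ (tr a) (gam ρ (tr b) ψ)
      = -(if b = a then (2 : ℂ) else 0) • ψ - gam ρ (tr b) (gam ρ (tr a) ψ) := by
    intro a b ψ
    rw [gam_gam_swap]
    congr 2
    by_cases hab : b = a
    · simp [eta, hab]
    · simp [eta, hab, Ne.symm hab]
  rw [h j k, map_sub, map_smul, h i k]
  module

theorem eps_eq_of_block {i j : Fin 9} (h : block i = block j) : eps i = eps j := by
  rw [eps, eps, h]

theorem del_eq_of_block {i j : Fin 9} (h : block i = block j) : del i = del j := by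
  rw [del, del, h]

theorem mu_eq_of_block (ap am ap' : ℂ) {i j : Fin 9} (h : block i = block j) :
    mu ap am ap' i = mu ap am ap' j := by
  rw [mu, mu, h]

theorem rot_gam123 {i j : Fin 9} (h : block i = block j) (ψ : S) :
    gam ρ (tr i) (gam ρ (tr j) (gam123 ρ ψ)) = gam123 ρ (gam ρ (tr i) (gam ρ (tr j) ψ)) := by
  rw [tr_gam123, map_smul, tr_gam123, smul_smul, eps_eq_of_block h, eps_sq, one_smul]

theorem gam1245_rot {i j : Fin 9} (h : block i = block j) (ψ : S) :
    gam1245 ρ (gam ρ (tr i) (gam ρ (tr j) ψ)) = gam ρ (tr i) (gam ρ (tr j) (gam1245 ρ ψ)) := by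
  rw [gam1245_tr, gam1245_tr, map_smul, smul_smul, del_eq_of_block h, del_sq, one_smul]

theorem rot_mem_initSpace {i j : Fin 9} (h : block i = block j) {ψ : S} (hψ : ψ ∈ initSpace ρ) :
    gam ρ (tr i) (gam ρ (tr j) ψ) ∈ initSpace ρ := by
  rw [mem_initSpace_iff] at hψ ⊢
  rw [gam1245_rot ρ h, ← neg_neg (gam ρ pl _), ← tr_pl, ← map_neg, ← tr_pl, hψ]
  simp

end

section
variable (ρ : SpinRep S) {B : Fin 9 → ℝ} {ap am ap' : ℂ}

theorem covd_eq_zero_iff (c d : Module.End ℂ S) (a : Ix) (ξ : Pt → S) (x : Pt) :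
    covd ρ B c d a ξ x = 0 ↔ pd a ξ x = -connCoef ρ B c d x a (ξ x) :=
  add_eq_zero_iff_eq_neg

theorem pd_pl_parallel {ξ : Pt → S}
    (hξ : ξ ∈ parallelSpinors ρ B (cElt ρ ap am) (dElt ρ ap')) (x : Pt) : pd pl ξ x = 0 := by
  have := ((mem_parallelSpinors_iff ρ B _ _ ξ).1 hξ).2 pl x
  simpa [covd, connCoef] using this

theorem pd_mi_parallel {ξ : Pt → S}
    (hξ : ξ ∈ parallelSpinors ρ B (cElt ρ ap am) (dElt ρ ap')) (x : Pt) :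
    pd mi ξ x = -connCoef ρ B (cElt ρ ap am) (dElt ρ ap') x mi (ξ x) :=
  (covd_eq_zero_iff ρ _ _ _ _ _).1 (((mem_parallelSpinors_iff ρ B _ _ ξ).1 hξ).2 mi x)

theorem pd_tr_parallel {ξ : Pt → S}
    (hξ : ξ ∈ parallelSpinors ρ B (cElt ρ ap am) (dElt ρ ap')) (x : Pt)
    (hV : ξ x ∈ initSpace ρ) (i : Fin 9) :
    pd (tr i) ξ x = (mu ap am ap' i / 2) • gam ρ pl (gam123 ρ (gam ρ (tr i) (ξ x))) := by
  have h := ((mem_parallelSpinors_iff ρ B _ _ ξ).1 hξ).2 (tr i) x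
  rw [covd_eq_zero_iff, connCoef, connTerm_tr_of_mem ρ ap am ap' i
    ((mem_initSpace_iff ρ).1 hV)] at h
  rw [h]
  module

/-- The connection coefficients do not depend on x^-, so ∂_- commutes with D. -/
theorem pd_mi_mem_parallelSpinors [FiniteDimensional ℂ S] {ξ : Pt → S}
    (hξ : ξ ∈ parallelSpinors ρ B (cElt ρ ap am) (dElt ρ ap')) :
    pd mi ξ ∈ parallelSpinors ρ B (cElt ρ ap am) (dElt ρ ap') := by
  have h := (mem_parallelSpinors_iff ρ B _ _ ξ).1 hξ
  refine (mem_parallelSpinors_iff ρ B _ _ _).2 ⟨contDiff_pd h.1 mi, fun a x => ?_⟩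
  have h1 : pd mi (covd ρ B (cElt ρ ap am) (dElt ρ ap') a ξ) x = 0 := by
    have : covd ρ B (cElt ρ ap am) (dElt ρ ap') a ξ = fun _ => 0 := funext fun y => h.2 a y
    rw [this, pd_const]
  have h2 : pd mi (covd ρ B (cElt ρ ap am) (dElt ρ ap') a ξ) x = pd mi (fun y => pd a ξ y) x
      + pd mi (fun y => connCoef ρ B (cElt ρ ap am) (dElt ρ ap') y a (ξ y)) x :=
    pd_add mi ((contDiff_pd h.1 a).differentiable (by simp) x)
      ((contDiff_connCoef ρ B _ _ a h.1).differentiable (by simp) x)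
  rw [h2, pd_connCoef ρ B _ _ mi a h.1, pd_comm h.1] at h1
  have h3 : dConnCoef ρ B mi a = 0 := by simp [dConnCoef]
  rw [h3, LinearMap.zero_apply, zero_add] at h1
  exact h1

theorem spinLie_heis_parallel {ξ : Pt → S}
    (hξ : ξ ∈ parallelSpinors ρ B (cElt ρ ap am) (dElt ρ ap'))
    (hV : ∀ x, ξ x ∈ initSpace ρ) (i : Fin 9) {f g : ℝ → ℂ}
    (hf : ∀ t, HasDerivAt f (-g t) t) (hg : ∀ t, HasDerivAt g (B i * f t) t) (x : Pt) :
    spinLie ρ B (heis i f g) ξ x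
      = f (x mi) • ((mu ap am ap' i / 2) • gam ρ pl (gam123 ρ (gam ρ (tr i) (ξ x))))
        - g (x mi) • ((1 / 2 : ℂ) • gam ρ pl (gam ρ (tr i) (ξ x))) := by
  rw [spinLie_heis ρ B i hf hg, pd_pl_parallel ρ hξ, pd_tr_parallel ρ hξ x (hV x)]
  module

/-- The result takes values in the image of Γ_+, where the transversal part of D is trivial. Along
x^- the derivatives f' = -g and g' = -μ_i² f balance the commutators of c and d with Γ_i. -/
theorem spinLie_heis_mem [FiniteDimensional ℂ S] {ξ : Pt → S}
    (hξ : ξ ∈ parallelSpinors ρ B (cElt ρ ap am) (dElt ρ ap'))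
    (hB : ∀ i, (B i : ℂ) = -(mu ap am ap' i) ^ 2)
    (hV : ∀ x, ξ x ∈ initSpace ρ) (i : Fin 9) {f g : ℝ → ℂ}
    (hfs : ContDiff ℝ ∞ f) (hgs : ContDiff ℝ ∞ g)
    (hf : ∀ t, HasDerivAt f (-g t) t) (hg : ∀ t, HasDerivAt g (B i * f t) t) :
    spinLie ρ B (heis i f g) ξ ∈ parallelSpinors ρ B (cElt ρ ap am) (dElt ρ ap') := by
  have h := (mem_parallelSpinors_iff ρ B _ _ ξ).1 hξ
  have he : spinLie ρ B (heis i f g) ξ = fun x =>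
      f (x mi) • ((mu ap am ap' i / 2) • gam ρ pl (gam123 ρ (gam ρ (tr i) (ξ x))))
        - g (x mi) • ((1 / 2 : ℂ) • gam ρ pl (gam ρ (tr i) (ξ x))) :=
    funext (spinLie_heis_parallel ρ hξ hV i hf hg)
  have s1 : ContDiff ℝ ∞ (fun x : Pt => f (x mi)) := hfs.comp (contDiff_apply ℝ ℝ mi)
  have s2 : ContDiff ℝ ∞ (fun x : Pt => g (x mi)) := hgs.comp (contDiff_apply ℝ ℝ mi)
  let T1 : Module.End ℂ S := (mu ap am ap' i / 2) • (gam ρ pl * gam123 ρ * gam ρ (tr i))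
  let T2 : Module.End ℂ S := (1 / 2 : ℂ) • (gam ρ pl * gam ρ (tr i))
  have he2 : spinLie ρ B (heis i f g) ξ = fun x => f (x mi) • T1 (ξ x) - g (x mi) • T2 (ξ x) := he
  have s3 := contDiff_end T1 h.1
  have s4 := contDiff_end T2 h.1
  rw [he2]
  refine (mem_parallelSpinors_iff ρ B _ _ _).2 ⟨(s1.smul s3).sub (s2.smul s4), fun a x => ?_⟩
  rw [covd_eq_zero_iff, pd_sub a ((diffAt s1 x).fun_smul (diffAt s3 x))
      ((diffAt s2 x).fun_smul (diffAt s4 x)), pd_smul a (diffAt s1 x) (diffAt s3 x),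
    pd_smul a (diffAt s2 x) (diffAt s4 x), pd_end _ _ (diffAt h.1 x), pd_end _ _ (diffAt h.1 x),
    pd_comp_coord a mi (hf _), pd_comp_coord a mi (hg _)]
  have hx := (mem_initSpace_iff ρ).1 (hV x)
  have e1 : T1 (ξ x) = gam ρ pl ((mu ap am ap' i / 2) • gam123 ρ (gam ρ (tr i) (ξ x))) := by
    simp [T1]
  have e2 : T2 (ξ x) = gam ρ pl ((1 / 2 : ℂ) • gam ρ (tr i) (ξ x)) := by simp [T2]
  induction a using ix_cases with
  | hp => simp [pd_pl_parallel ρ hξ, connCoef]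
  | hm =>
    rw [map_sub, map_smul, map_smul, e1, e2, connCoef_mi_pl, connCoef_mi_pl, pd_mi_parallel ρ hξ]
    -- With Γ_+ innermost, the derivative of ξ enters only through Γ_+ of its connection term, where
    -- the null rotation drops out and `pl_connCoef_mi` applies.
    have f1 : ∀ v, T1 v = (mu ap am ap' i / 2 * eps i) • gam ρ (tr i) (gam123 ρ (gam ρ pl v)) := by
      intro v
      simp [T1, smul_smul, mul_assoc, eps_sq]
    have f2 : ∀ v, T2 v = (-1 / 2 : ℂ) • gam ρ (tr i) (gam ρ pl v) := by
      intro v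
      simp [T2]
      module
    rw [f1, f2, map_neg, pl_connCoef_mi ρ B ap am ap' x hx]
    have h1 : eps i = 1 ∨ eps i = -1 := mul_self_eq_one_iff.1 (eps_sq i)
    have h2 : del i = 1 ∨ del i = -1 := mul_self_eq_one_iff.1 (del_sq i)
    have h3 := hB i
    rw [mu_eq] at h3
    simp [cElt_apply, mu_eq, h3, pl_tr_gam1245 ρ hx, pl_gam123_tr_gam1245 ρ hx]
    rcases h1 with h1 | h1 <;> rcases h2 with h2 | h2 <;> rw [h1, h2] <;> simp <;> module
  | ht k =>
    simp [pd_tr_parallel ρ hξ x (hV x), connCoef, e1, e2, T1, T2, connTerm_tr]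

theorem spinLie_Krot_mem [FiniteDimensional ℂ S] {ξ : Pt → S}
    (hξ : ξ ∈ parallelSpinors ρ B (cElt ρ ap am) (dElt ρ ap'))
    (hB : ∀ i, (B i : ℂ) = -(mu ap am ap' i) ^ 2)
    (hV : ∀ x, ξ x ∈ initSpace ρ) {i j : Fin 9} (hij : i ≠ j) (hb : block i = block j) :
    spinLie ρ B (Krot i j) ξ ∈ parallelSpinors ρ B (cElt ρ ap am) (dElt ρ ap') := by
  have h := (mem_parallelSpinors_iff ρ B _ _ ξ).1 hξ
  have hm := mu_eq_of_block ap am ap' hb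
  have hBij : B i = B j := by
    have : (B i : ℂ) = B j := by rw [hB, hB, hm]
    exact_mod_cast this
  let T : Fin 9 → Module.End ℂ S := fun k =>
    (mu ap am ap' k / 2) • (gam ρ pl * gam123 ρ * gam ρ (tr k))
  let R : Module.End ℂ S := (1 / 2 : ℂ) • (gam ρ (tr i) * gam ρ (tr j))
  have he : spinLie ρ B (Krot i j) ξ = fun x =>
      (x (tr j) : ℂ) • T i (ξ x) - (x (tr i) : ℂ) • T j (ξ x) + R (ξ x) := by
    funext x
    rw [spinLie_Krot ρ B hij hBij, pd_tr_parallel ρ hξ x (hV x), pd_tr_parallel ρ hξ x (hV x)]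
    rfl
  have s1 := contDiff_coord (tr i)
  have s2 := contDiff_coord (tr j)
  have s3 := fun k => contDiff_end (T k) h.1
  have s4 := contDiff_end R h.1
  rw [he]
  refine (mem_parallelSpinors_iff ρ B _ _ _).2
    ⟨((s2.smul (s3 i)).sub (s1.smul (s3 j))).add s4, fun a x => ?_⟩
  rw [covd_eq_zero_iff, pd_add a (((diffAt s2 x).fun_smul (diffAt (s3 i) x)).fun_sub
      ((diffAt s1 x).fun_smul (diffAt (s3 j) x))) (diffAt s4 x),
    pd_sub a ((diffAt s2 x).fun_smul (diffAt (s3 i) x))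
      ((diffAt s1 x).fun_smul (diffAt (s3 j) x)), pd_smul a (diffAt s1 x) (diffAt (s3 j) x),
    pd_smul a (diffAt s2 x) (diffAt (s3 i) x), pd_end _ _ (diffAt h.1 x),
    pd_end _ _ (diffAt h.1 x), pd_end _ _ (diffAt h.1 x),
    pd_coord, pd_coord]
  have hx := (mem_initSpace_iff ρ).1 (hV x)
  have hRx := (mem_initSpace_iff ρ).1 (rot_mem_initSpace ρ hb (hV x))
  have e1 : ∀ k, T k (ξ x)
      = gam ρ pl ((mu ap am ap' k / 2) • gam123 ρ (gam ρ (tr k) (ξ x))) := by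
    intro k
    simp [T]
  induction a using ix_cases with
  | hp => simp [pd_pl_parallel ρ hξ, connCoef]
  | hm =>
    have f1 : ∀ k v,
        T k v = (mu ap am ap' k / 2 * eps k) • gam ρ (tr k) (gam123 ρ (gam ρ pl v)) := by
      intro k v
      simp [T, smul_smul, mul_assoc, eps_sq]
    rw [map_add, map_sub, map_smul, map_smul, e1, e1, connCoef_mi_pl, connCoef_mi_pl,
      pd_mi_parallel ρ hξ, f1, f1, map_neg, pl_connCoef_mi ρ B ap am ap' x hx]
    -- R commutes with c, d and Γ_±, but rotates the index in ∑ B_k x^k Γ_+Γ_k; the resulting defect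
    -- is to cancel against the terms with explicit factors x^i and x^j.
    have g1 : connCoef ρ B (cElt ρ ap am) (dElt ρ ap') x mi (R (ξ x))
        = R (connCoef ρ B (cElt ρ ap am) (dElt ρ ap') x mi (ξ x))
          + (1 / 2 * B i : ℂ) • ((x (tr i) : ℂ) • gam ρ pl (gam ρ (tr j) (ξ x))
            - (x (tr j) : ℂ) • gam ρ pl (gam ρ (tr i) (ξ x))) := by
      have hcm : connTerm ρ (cElt ρ ap am) (dElt ρ ap') mi (R (ξ x))
          = R (connTerm ρ (cElt ρ ap am) (dElt ρ ap') mi (ξ x)) := by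
        have hR1 : ∀ v, R (gam123 ρ v) = gam123 ρ (R v) := fun v => by
          simp only [R, LinearMap.smul_apply, Module.End.mul_apply, rot_gam123 ρ hb, map_smul]
        have hR2 : ∀ v, gam1245 ρ (R v) = R (gam1245 ρ v) := fun v => by
          simp only [R, LinearMap.smul_apply, Module.End.mul_apply, gam1245_rot ρ hb, map_smul]
        have hR3 : ∀ v, R (gam ρ pl v) = gam ρ pl (R v) := fun v => by simp [R]
        have hR4 : ∀ v, R (gam ρ mi v) = gam ρ mi (R v) := fun v => by simp [R]
        simp only [connTerm_mi, map_add, map_smul, hR1, hR2, hR3, hR4]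
      have hk : ∀ k, R (gam ρ pl (gam ρ (tr k) (ξ x))) = gam ρ pl (gam ρ (tr k) (R (ξ x)))
          + ((if k = i then (1 : ℂ) else 0) • gam ρ pl (gam ρ (tr j) (ξ x))
            - (if k = j then (1 : ℂ) else 0) • gam ρ pl (gam ρ (tr i) (ξ x))) := by
        intro k
        simp only [R, LinearMap.smul_apply, Module.End.mul_apply, tr_pl, map_neg, rot_tr ρ i j k,
          map_add, map_sub, map_smul, neg_neg]
        split_ifs <;> module
      simp only [connCoef_apply_mi, map_sub, map_neg, map_smul, map_sum, hcm, hk, smul_add,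
        Finset.sum_add_distrib, smul_sub, Finset.sum_sub_distrib, smul_smul]
      simp [hBij]
      module
    rw [g1]
    have h1 : eps j = 1 ∨ eps j = -1 := mul_self_eq_one_iff.1 (eps_sq j)
    have h2 : del j = 1 ∨ del j = -1 := mul_self_eq_one_iff.1 (del_sq j)
    have h3 := hB j
    rw [mu_eq] at h3
    rw [hm, eps_eq_of_block hb, hBij]
    simp [cElt_apply, mu_eq, h3, pl_tr_gam1245 ρ hx, pl_gam123_tr_gam1245 ρ hx,
      del_eq_of_block hb, eps_eq_of_block hb]
    rcases h1 with h1 | h1 <;> rcases h2 with h2 | h2 <;> rw [h1, h2] <;> simp <;> module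
  | ht k =>
    have hR : connTerm ρ (cElt ρ ap am) (dElt ρ ap') (tr k) (R (ξ x))
        = -(mu ap am ap' k / 2) • (1 / 2 : ℂ) •
          gam ρ pl (gam123 ρ (gam ρ (tr k) (gam ρ (tr i) (gam ρ (tr j) (ξ x))))) := by
      simp only [R, LinearMap.smul_apply, Module.End.mul_apply, map_smul]
      rw [connTerm_tr_of_mem ρ ap am ap' k hRx, smul_comm]
    simp only [connCoef, map_add, map_sub, map_smul, e1, connTerm_tr_pl, hR,
      pd_tr_parallel ρ hξ x (hV x)]
    simp [T, R, rot_gam123 ρ hb, rot_tr ρ i j k]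
    have he := eps_eq_of_block hb
    have h1 : eps j = 1 ∨ eps j = -1 := mul_self_eq_one_iff.1 (eps_sq j)
    rw [he]
    by_cases hki : k = i
    · subst hki
      rcases h1 with h1 | h1 <;> simp [hij, hm, he, h1]
    · by_cases hkj : k = j
      · subst hkj
        rcases h1 with h1 | h1 <;> simp [hki, hm, h1] <;> module
      · rcases h1 with h1 | h1 <;> simp [hki, hkj, h1]

end

/-! ## The space of parallel spinors -/

section
variable (ρ : SpinRep S)

/-- The solution `e^{t z Γ_{123}} v` of `ψ' = z Γ_{123} ψ`. -/
def expGam (z : ℂ) (v : S) (t : ℝ) : S :=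
  Complex.cosh (z * t) • v + Complex.sinh (z * t) • gam123 ρ v

theorem hasDerivAt_expGam (z : ℂ) (v : S) (t : ℝ) :
    HasDerivAt (expGam ρ z v) (z • gam123 ρ (expGam ρ z v t)) t := by
  have h := (hasDerivAt_id (t : ℂ)).const_mul z
  have h1 := (h.ccosh.comp_ofReal.smul_const v).add (h.csinh.comp_ofReal.smul_const (gam123 ρ v))
  refine h1.congr_deriv ?_
  simp only [expGam, map_add, map_smul, gam123_gam123, id]
  module

theorem contDiff_expGam (z : ℂ) (v : S) : ContDiff ℝ ∞ (expGam ρ z v) := by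
  have h : ContDiff ℝ ∞ fun s : ℝ => z * (s : ℂ) := contDiff_const.mul Complex.ofRealCLM.contDiff
  have h1 : ContDiff ℝ ∞ Complex.cosh := (Complex.contDiff_cosh (n := ∞)).restrict_scalars ℝ
  have h2 : ContDiff ℝ ∞ Complex.sinh := (Complex.contDiff_sinh (n := ∞)).restrict_scalars ℝ
  exact ((h1.comp h).smul contDiff_const).add ((h2.comp h).smul contDiff_const)

theorem expGam_zero (z : ℂ) (v : S) : expGam ρ z v 0 = v := by
  simp [expGam]

/-- The component in `S_+` of the parallel spinor with initial value `ψ`. -/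
def solPlus (ap' : ℂ) (ψ : S) (t : ℝ) : S := expGam ρ ap' (sigPlus ρ ψ) t

/-- The component in `S_-` of the restriction to the line `x^i = 0` of the parallel spinor with
initial value `ψ`. -/
def solMinus (ap am : ℂ) (ψ : S) (t : ℝ) : S :=
  expGam ρ (-ap) (projPlus ρ (sigMinus ρ ψ)) t + expGam ρ (-am) (projMinus ρ (sigMinus ρ ψ)) t

/-- The parallel spinor with initial value `ψ`. -/
def sol (ap am ap' : ℂ) (ψ : S) (x : Pt) : S :=
  solPlus ρ ap' ψ (x mi) + solMinus ρ ap am ψ (x mi)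
    + ∑ k, (x (tr k) : ℂ) • (mu ap am ap' k / 2) •
        gam ρ pl (gam123 ρ (gam ρ (tr k) (solPlus ρ ap' ψ (x mi))))

theorem sigPlus_add_sigMinus (ψ : S) : sigPlus ρ ψ + sigMinus ρ ψ = ψ := by
  simp [sigPlus_apply, sigMinus_apply]

theorem sol_zero (ap am ap' : ℂ) (ψ : S) : sol ρ ap am ap' ψ 0 = ψ := by
  have h : projPlus ρ (sigMinus ρ ψ) + projMinus ρ (sigMinus ρ ψ) = sigMinus ρ ψ := by
    simp [projPlus, projMinus]
    module
  simp [sol, solPlus, solMinus, expGam_zero, h, sigPlus_add_sigMinus]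

theorem hasDerivAt_solPlus (ap' : ℂ) (ψ : S) (t : ℝ) :
    HasDerivAt (solPlus ρ ap' ψ) (ap' • gam123 ρ (solPlus ρ ap' ψ t)) t :=
  hasDerivAt_expGam ρ ap' _ t

theorem hasDerivAt_solMinus (ap am : ℂ) (ψ : S) (t : ℝ) :
    HasDerivAt (solMinus ρ ap am ψ) (-cElt ρ ap am (solMinus ρ ap am ψ t)) t := by
  refine ((hasDerivAt_expGam ρ _ _ t).add (hasDerivAt_expGam ρ _ _ t)).congr_deriv ?_
  simp [solMinus, expGam, cElt_apply, projPlus, projMinus]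
  module

theorem mi_solPlus (ap' : ℂ) (ψ : S) (t : ℝ) : gam ρ mi (solPlus ρ ap' ψ t) = 0 := by
  have h : gam ρ mi (sigPlus ρ ψ) = 0 := by
    simp [sigPlus_apply]
  have h2 : gam ρ mi (gam123 ρ (sigPlus ρ ψ)) = 0 := by
    rw [← neg_neg (gam ρ mi _), ← gam123_mi, h, map_zero, neg_zero]
  simp [solPlus, expGam, h, h2]

theorem pl_solMinus (ap am : ℂ) (ψ : S) (t : ℝ) : gam ρ pl (solMinus ρ ap am ψ t) = 0 := by
  simp [solMinus, expGam, projPlus, projMinus, sigMinus_apply]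

theorem gam1245_solPlus (ap' : ℂ) {ψ : S} (hψ : ψ ∈ initSpace ρ) (t : ℝ) :
    gam1245 ρ (solPlus ρ ap' ψ t) = solPlus ρ ap' ψ t := by
  have h : gam1245 ρ (sigPlus ρ ψ) = sigPlus ρ ψ := by
    have h0 : projMinus ρ (sigPlus ρ ψ) = 0 := hψ
    rw [projMinus_apply, smul_eq_zero, sub_eq_zero] at h0
    exact (h0.resolve_left (by norm_num)).symm
  simp [solPlus, expGam, h]

theorem pd_smul_coord (a : Ix) (k : Fin 9) {f : Pt → S} {x : Pt} (hf : DifferentiableAt ℝ f x) :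
    pd a (fun y => (y (tr k) : ℂ) • f y) x
      = (if a = tr k then (1 : ℂ) else 0) • f x + (x (tr k) : ℂ) • pd a f x := by
  rw [pd_smul a (diffAt (contDiff_coord _) x) hf, pd_coord]

/-- On the line x^i = 0 the two components satisfy φ' = dφ and χ' = -cχ. The dependence on x^i is
only affine, because the transversal derivative lands in the image of Γ_+ and Γ_+² = 0. -/
theorem sol_mem [FiniteDimensional ℂ S] {B : Fin 9 → ℝ} {ap am ap' : ℂ}
    (hB : ∀ i, (B i : ℂ) = -(mu ap am ap' i) ^ 2) {ψ : S} (hψ : ψ ∈ initSpace ρ) :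
    sol ρ ap am ap' ψ ∈ parallelSpinors ρ B (cElt ρ ap am) (dElt ρ ap') := by
  let T : Fin 9 → Module.End ℂ S := fun k =>
    (mu ap am ap' k / 2) • (gam ρ pl * gam123 ρ * gam ρ (tr k))
  have hp : ContDiff ℝ ∞ (fun x : Pt => solPlus ρ ap' ψ (x mi)) :=
    (contDiff_expGam ρ _ _).comp (contDiff_apply ℝ ℝ mi)
  have hm : ContDiff ℝ ∞ (fun x : Pt => solMinus ρ ap am ψ (x mi)) :=
    ((contDiff_expGam ρ _ _).add (contDiff_expGam ρ _ _)).comp (contDiff_apply ℝ ℝ mi)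
  have hT := fun k => contDiff_end (T k) hp
  have hTk := fun k => (contDiff_coord (tr k)).smul (hT k)
  have he : sol ρ ap am ap' ψ = fun x => solPlus ρ ap' ψ (x mi) + solMinus ρ ap am ψ (x mi)
      + ∑ k, (x (tr k) : ℂ) • T k (solPlus ρ ap' ψ (x mi)) := rfl
  refine (mem_parallelSpinors_iff ρ B _ _ _).2
    ⟨(hp.add hm).add (ContDiff.sum fun k _ => hTk k), fun a x => ?_⟩
  have dT : ∀ k ∈ Finset.univ, DifferentiableAt ℝ
      (fun y : Pt => (y (tr k) : ℂ) • T k (solPlus ρ ap' ψ (y mi))) x := fun k _ =>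
    (diffAt (contDiff_coord (tr k)) x).fun_smul (diffAt (hT k) x)
  have hd : ∀ a, pd a (sol ρ ap am ap' ψ) x
      = pd a (fun x : Pt => solPlus ρ ap' ψ (x mi)) x
        + pd a (fun x : Pt => solMinus ρ ap am ψ (x mi)) x
        + ∑ k, ((if a = tr k then (1 : ℂ) else 0) • T k (solPlus ρ ap' ψ (x mi))
          + (x (tr k) : ℂ) • T k (pd a (fun x : Pt => solPlus ρ ap' ψ (x mi)) x)) := by
    intro a
    rw [he, pd_add a ((diffAt hp x).fun_add (diffAt hm x)) (DifferentiableAt.fun_sum dT),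
      pd_add a (diffAt hp x) (diffAt hm x), pd_sum _ a dT]
    refine congrArg _ (Finset.sum_congr rfl fun k _ => ?_)
    rw [pd_smul_coord a k (diffAt (hT k) x), pd_end _ _ (diffAt hp x)]
  rw [covd, hd, pd_comp_coord a mi (hasDerivAt_solPlus ρ ap' ψ _),
    pd_comp_coord a mi (hasDerivAt_solMinus ρ ap am ψ _), he]
  beta_reduce
  have h1 := mi_solPlus ρ ap' ψ (x mi)
  have h2 := pl_solMinus ρ ap am ψ (x mi)
  have h3 := gam1245_solPlus ρ ap' hψ (x mi)
  -- From here on only Γ_-φ = 0, Γ_1245φ = φ and Γ_+χ = 0 matter; the exponentials are forgotten.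
  generalize solPlus ρ ap' ψ (x mi) = φ at h1 h3 ⊢
  generalize solMinus ρ ap am ψ (x mi) = χ at h2 ⊢
  have e1 : ∀ k, T k φ = gam ρ pl ((mu ap am ap' k / 2) • gam123 ρ (gam ρ (tr k) φ)) := by
    intro k
    simp [T]
  have i2 : gam ρ pl (gam123 ρ χ) = 0 := by
    rw [← neg_neg (gam ρ pl _), ← gam123_pl, h2, map_zero, neg_zero]
  have i3 : ∀ k, gam ρ pl (gam ρ (tr k) χ) = 0 := fun k => by
    rw [← neg_neg (gam ρ pl _), ← tr_pl, h2, map_zero, neg_zero]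
  induction a using ix_cases with
  | hp => simp [connCoef]
  | hm =>
    have i1 : gam ρ mi (gam123 ρ φ) = 0 := by
      rw [← neg_neg (gam ρ mi _), ← gam123_mi, h1, map_zero, neg_zero]
    have i4 : gam ρ pl (gam123 ρ (gam1245 ρ χ)) = 0 := by
      rw [← gam1245_gam123, ← gam1245_pl, i2, map_zero]
    have i5 : ∀ v, gam ρ pl v = 0 → gam ρ pl (gam ρ mi v) = -(2 : ℂ) • v := fun v hv => by
      have := mi_pl ρ v
      rw [hv, map_zero, eq_comm, sub_eq_zero] at this
      exact this.symm
    have jφ : connCoef ρ B (cElt ρ ap am) (dElt ρ ap') x mi φ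
        = -(1 / 2 : ℂ) • ∑ k, ((B k : ℂ) * x (tr k)) • gam ρ pl (gam ρ (tr k) φ)
          - ap' • gam123 ρ φ := by
      simp [connCoef_apply_mi, connTerm_mi, h3, i1]
      module
    have jχ : connCoef ρ B (cElt ρ ap am) (dElt ρ ap') x mi χ = cElt ρ ap am χ := by
      simp only [connCoef_apply_mi, connTerm_mi, i3, i5 _ i2, i5 _ i4, cElt_apply]
      simp
      module
    simp only [map_add, map_sum, jφ, jχ, e1, map_smul (connCoef ρ B _ _ x mi), connCoef_mi_pl]
    -- The part of D_-ξ linear in x^k: the evolution of φ, the null rotation and the action of c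
    -- cancel for each k since B_k = -μ_k².
    have hsum : ∑ k, (x (tr k) : ℂ) • T k (ap' • gam123 ρ φ)
        + -(1 / 2 : ℂ) • ∑ k, ((B k : ℂ) * x (tr k)) • gam ρ pl (gam ρ (tr k) φ)
        + ∑ k, (x (tr k) : ℂ) • -gam ρ pl (cElt ρ ap am ((mu ap am ap' k / 2) •
            gam123 ρ (gam ρ (tr k) φ))) = 0 := by
      rw [Finset.smul_sum, ← Finset.sum_add_distrib, ← Finset.sum_add_distrib]
      refine Finset.sum_eq_zero fun k _ => ?_
      have h1 : eps k = 1 ∨ eps k = -1 := mul_self_eq_one_iff.1 (eps_sq k)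
      have h2 : del k = 1 ∨ del k = -1 := mul_self_eq_one_iff.1 (del_sq k)
      simp [T, cElt_apply, hB k, mu_eq, h3]
      rcases h1 with h1 | h1 <;> rcases h2 with h2 | h2 <;> rw [h1, h2] <;> simp <;> module
    rw [← hsum]
    simp
    abel
  | ht k =>
    have h4 : gam ρ pl (gam1245 ρ φ) = gam ρ pl φ := by rw [h3]
    have h5 : gam ρ pl (gam1245 ρ χ) = gam ρ pl χ := by
      rw [← gam1245_pl, h2, map_zero]
    have i6 : gam ρ pl (gam123 ρ (gam ρ (tr k) χ)) = 0 := by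
      rw [← neg_neg (gam ρ pl _), ← gam123_pl, i3, map_zero, neg_zero]
    simp only [connCoef, map_add, map_sum, map_smul (connTerm ρ _ _ _),
      connTerm_tr_of_mem ρ ap am ap' k h4, connTerm_tr_of_mem ρ ap am ap' k h5, i6]
    simp only [e1, connTerm_tr_pl]
    simp

/-- Along each ray t ↦ t x parallelism is a linear ordinary differential equation, so a zero at the
origin propagates. -/
theorem parallel_eq_zero [FiniteDimensional ℂ S] {B : Fin 9 → ℝ} {c d : Module.End ℂ S}
    {ξ : Pt → S} (hξ : ξ ∈ parallelSpinors ρ B c d) (h0 : ξ 0 = 0) : ξ = 0 := by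
  rw [mem_parallelSpinors_iff] at hξ
  funext x
  -- The connection coefficients are affine in the point, so the equation on the ray has the matrix
  -- P + tQ, with Lipschitz constant at most ‖P‖ + ‖Q‖ on [0, 1).
  let P : S →L[ℝ] S := -∑ a, x a • toRealCLM (connCoef ρ B c d 0 a)
  let Q : S →L[ℝ] S :=
    -∑ a, x a • (toRealCLM (connCoef ρ B c d x a) - toRealCLM (connCoef ρ B c d 0 a))
  have haff : ∀ (t : ℝ) (a : Ix) (s : S), connCoef ρ B c d (t • x) a s
      = connCoef ρ B c d 0 a s + t • (connCoef ρ B c d x a s - connCoef ρ B c d 0 a s) := by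
    intro t a s
    induction a using ix_cases with
    | hp => simp [connCoef]
    | hm =>
      simp only [connCoef_apply_mi]
      simp [mul_left_comm _ (t : ℂ), mul_smul, ← Finset.smul_sum]
      rw [smul_comm]
      abel
    | ht i => simp [connCoef]
  have hder : ∀ t : ℝ, HasDerivAt (fun t : ℝ => ξ (t • x)) ((P + t • Q) (ξ (t • x))) t := by
    intro t
    have h1 : HasDerivAt (fun t : ℝ => t • x) x t := by
      simpa using (hasDerivAt_id t).smul_const x
    have h2 := (diffAt hξ.1 (t • x)).hasFDerivAt.comp_hasDerivAt t h1
    refine h2.congr_deriv ?_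
    have h3 : fderiv ℝ ξ (t • x) x = ∑ a, x a • pd a ξ (t • x) := by
      simp only [pd]
      generalize fderiv ℝ ξ (t • x) = D
      conv_lhs => rw [← Finset.univ_sum_single x, map_sum]
      refine Finset.sum_congr rfl fun a _ => ?_
      rw [← map_smul, ← Pi.single_smul, smul_eq_mul, mul_one]
    have h4 : ∀ a, pd a ξ (t • x) = -connCoef ρ B c d (t • x) a (ξ (t • x)) := fun a =>
      (covd_eq_zero_iff ρ c d a ξ _).1 (hξ.2 a _)
    rw [h3]
    simp only [h4, haff]
    simp [P, Q, toRealCLM_apply, smul_add, smul_sub, Finset.sum_add_distrib, Finset.smul_sum,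
      smul_comm t]
    abel
  have hK : ∀ t ∈ Set.Ico (0 : ℝ) 1, LipschitzOnWith (‖P‖₊ + ‖Q‖₊) (P + t • Q) Set.univ := by
    intro t ht
    refine ((P + t • Q).lipschitz.weaken ?_).lipschitzOnWith
    refine (nnnorm_add_le _ _).trans (add_le_add_right ?_ _)
    rw [nnnorm_smul]
    refine mul_le_of_le_one_left zero_le ?_
    rw [← NNReal.coe_le_coe, coe_nnnorm, Real.norm_eq_abs, abs_of_nonneg ht.1]
    exact ht.2.le
  have hu := ODE_solution_unique_of_mem_Icc_right (a := 0) (b := 1) (v := fun t => P + t • Q)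
    (s := fun _ => Set.univ) (f := fun t : ℝ => ξ (t • x)) (g := fun _ => 0) hK
    (fun t _ => (hder t).continuousAt.continuousWithinAt) (fun t _ => (hder t).hasDerivWithinAt)
    (fun _ _ => trivial) continuousOn_const
    (fun t _ => by simpa using hasDerivWithinAt_const t (Set.Ici t) (0 : S)) (fun _ _ => trivial)
    (by simpa using h0)
  simpa using hu (Set.right_mem_Icc.2 zero_le_one)

/-- X^- and σ_+ are commuting projections, and the rank of their product is its trace. The Clifford
relation gives the trace of Γ_+Γ_-, and the terms containing Γ_1245 are traceless, which leaves n/4.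
-/
theorem finrank_initSpace [FiniteDimensional ℂ S] :
    4 * Module.finrank ℂ (initSpace ρ) = 3 * Module.finrank ℂ S := by
  set n := Module.finrank ℂ S
  let Q : Module.End ℂ S := projMinus ρ * sigPlus ρ
  have hQ : IsIdempotentElem Q := by
    ext ψ
    simp [Q, projMinus_apply, sigPlus_apply]
    module
  have ht1 : LinearMap.trace ℂ S (gam ρ pl * gam ρ mi) = -n := by
    have h := congrArg (LinearMap.trace ℂ S) (gam_mul_add_swap ρ pl mi)
    rw [map_add, LinearMap.trace_mul_comm ℂ (gam ρ mi), map_smul, LinearMap.trace_one] at h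
    simp [eta] at h
    linear_combination h / 2
  let U : Module.End ℂ S := gam ρ (tr 0) * gam ρ (tr 5)
  have hU : U * U = -1 := by
    ext ψ
    simp +decide [U, tr_tr_of_lt]
  -- U = Γ_1Γ_6 commutes with Γ_± and anticommutes with Γ_1245. If U anticommutes with T, then UTU =
  -- T as U² = -1, while cyclicity gives it the trace -tr T.
  have hUtr : ∀ T : Module.End ℂ S, U * T = -(T * U) → LinearMap.trace ℂ S T = 0 := by
    intro T hT
    have h1 : LinearMap.trace ℂ S (U * (T * U)) = LinearMap.trace ℂ S (T * U * U) :=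
      LinearMap.trace_mul_comm ℂ _ _
    rw [← mul_assoc, hT, neg_mul, map_neg, mul_assoc, hU, mul_neg, mul_one, map_neg] at h1
    rw [neg_neg] at h1
    linear_combination h1 / 2
  have ht2 : LinearMap.trace ℂ S (gam1245 ρ) = 0 := hUtr _ (by
    ext ψ
    simp [U, del, block])
  have ht3 : LinearMap.trace ℂ S (gam1245 ρ * (gam ρ pl * gam ρ mi)) = 0 := hUtr _ (by
    ext ψ
    simp [U, del, block])
  have hQt : LinearMap.trace ℂ S Q = n / 4 := by
    have hQe : Q = (1 / 2 : ℂ) • (1 - gam1245 ρ) + (1 / 4 : ℂ) • (gam ρ pl * gam ρ mi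
        - gam1245 ρ * (gam ρ pl * gam ρ mi)) := by
      ext ψ
      simp [Q, projMinus_apply, sigPlus_apply]
      module
    rw [hQe]
    simp only [map_add, map_sub, map_smul, ht1, ht2, ht3, LinearMap.trace_one]
    simp [n]
    ring
  have hr : LinearMap.trace ℂ S Q = Module.finrank ℂ (LinearMap.range Q) :=
    LinearMap.IsProj.trace (LinearMap.IsIdempotentElem.isProj_range Q hQ)
  have hrn := LinearMap.finrank_range_add_finrank_ker Q
  have h4 : 4 * Module.finrank ℂ (LinearMap.range Q) = n := by
    have h5 : (4 * Module.finrank ℂ (LinearMap.range Q) : ℂ) = n := by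
      rw [← hr, hQt]
      ring
    exact_mod_cast h5
  change 4 * Module.finrank ℂ (LinearMap.ker Q) = 3 * n
  omega

end

/-! ## Commutators of the Killing vector fields -/

theorem lie_swap (X Y : VField) : lie X Y = -lie Y X := by
  funext x e
  simp only [lie, Pi.neg_apply, ← Finset.sum_neg_distrib]
  exact Finset.sum_congr rfl fun a _ => by ring

theorem lie_add_right (X : VField) {Y Z : VField} (hY : ContDiff ℝ ∞ Y) (hZ : ContDiff ℝ ∞ Z) :
    lie X (Y + Z) = lie X Y + lie X Z := by
  funext x e
  have h : ∀ a, pd a (Y + Z) x = pd a Y x + pd a Z x := fun a =>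
    pd_add a (diffAt hY x) (diffAt hZ x)
  simp only [lie, h, Pi.add_apply, ← Finset.sum_add_distrib]
  exact Finset.sum_congr rfl fun a _ => by ring

theorem pd_const_smul (a : Ix) (z : ℂ) (Y : VField) (x : Pt) : pd a (z • Y) x = z • pd a Y x := by
  simp only [pd]
  rw [fderiv_const_smul_field]
  rfl

theorem lie_smul_right (X Y : VField) (z : ℂ) : lie X (z • Y) = z • lie X Y := by
  funext x e
  simp only [lie, pd_const_smul, Pi.smul_apply, smul_eq_mul, Finset.mul_sum]
  exact Finset.sum_congr rfl fun a _ => by ring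

theorem lie_zero_right (X : VField) : lie X 0 = 0 := by
  simpa using lie_smul_right X 0 0

theorem lie_sum_right {ι : Type*} (s : Finset ι) (X : VField) {Y : ι → VField}
    (hY : ∀ i, ContDiff ℝ ∞ (Y i)) : lie X (∑ i ∈ s, Y i) = ∑ i ∈ s, lie X (Y i) := by
  classical
  induction s using Finset.induction_on with
  | empty => simp [lie_zero_right]
  | insert i s hi ih =>
    have hs : ContDiff ℝ ∞ (∑ i ∈ s, Y i) := by
      have h := ContDiff.sum (s := s) fun i _ => hY i
      convert h using 1
      funext x
      simp
    rw [Finset.sum_insert hi, Finset.sum_insert hi, lie_add_right X (hY i) hs, ih]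

theorem contDiff_Kplus : ContDiff ℝ ∞ Kplus := contDiff_const

theorem contDiff_Kminus : ContDiff ℝ ∞ Kminus := contDiff_const

theorem contDiff_heis (i : Fin 9) {f g : ℝ → ℂ} (hf : ContDiff ℝ ∞ f) (hg : ContDiff ℝ ∞ g) :
    ContDiff ℝ ∞ (heis i f g) :=
  ((hf.comp (contDiff_apply ℝ ℝ mi)).smul contDiff_const).add
    (((hg.comp (contDiff_apply ℝ ℝ mi)).mul (contDiff_coord _)).smul contDiff_const)

theorem contDiff_Krot (i j : Fin 9) : ContDiff ℝ ∞ (Krot i j) :=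
  ((contDiff_coord _).smul contDiff_const).sub ((contDiff_coord _).smul contDiff_const)

section Trig
variable (z : ℂ)

theorem contDiff_cos_mul : ContDiff ℝ ∞ fun t : ℝ => Complex.cos (z * t) :=
  ((Complex.contDiff_cos (n := ∞)).restrict_scalars ℝ).comp
    (contDiff_const.mul Complex.ofRealCLM.contDiff)

theorem contDiff_sin_mul : ContDiff ℝ ∞ fun t : ℝ => Complex.sin (z * t) :=
  ((Complex.contDiff_sin (n := ∞)).restrict_scalars ℝ).comp
    (contDiff_const.mul Complex.ofRealCLM.contDiff)

theorem hasDerivAt_cos_mul (t : ℝ) :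
    HasDerivAt (fun t : ℝ => Complex.cos (z * t)) (-(z * Complex.sin (z * t))) t := by
  refine (((hasDerivAt_id (t : ℂ)).const_mul z).ccos.comp_ofReal).congr_deriv ?_
  simp only [id]; ring

theorem hasDerivAt_sin_mul (t : ℝ) :
    HasDerivAt (fun t : ℝ => Complex.sin (z * t)) (z * Complex.cos (z * t)) t := by
  refine (((hasDerivAt_id (t : ℂ)).const_mul z).csin.comp_ofReal).congr_deriv ?_
  simp only [id]; ring

end Trig

/-- Solutions of the equations under which `heis i f g` is a Killing vector field. -/
structure IsHeis (b : ℂ) (f g : ℝ → ℂ) : Prop where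
  contDiff_left : ContDiff ℝ ∞ f
  contDiff_right : ContDiff ℝ ∞ g
  deriv_left : ∀ t, HasDerivAt f (-g t) t
  deriv_right : ∀ t, HasDerivAt g (b * f t) t

theorem isHeis_tr (z : ℂ) :
    IsHeis (z ^ 2) (fun t => Complex.cos (z * t)) (fun t => z * Complex.sin (z * t)) where
  contDiff_left := contDiff_cos_mul z
  contDiff_right := contDiff_const.mul (contDiff_sin_mul z)
  deriv_left := hasDerivAt_cos_mul z
  deriv_right t := ((hasDerivAt_sin_mul z t).const_mul z).congr_deriv (by ring)

theorem isHeis_dual (z : ℂ) :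
    IsHeis (z ^ 2) (fun t => -(z * Complex.sin (z * t)))
      (fun t => z ^ 2 * Complex.cos (z * t)) where
  contDiff_left := (contDiff_const.mul (contDiff_sin_mul z)).neg
  contDiff_right := contDiff_const.mul (contDiff_cos_mul z)
  deriv_left t := ((hasDerivAt_sin_mul z t).const_mul z).fun_neg.congr_deriv (by ring)
  deriv_right t := ((hasDerivAt_cos_mul z t).const_mul (z ^ 2)).congr_deriv (by ring)

theorem Ktr_eq (l : Fin 9 → ℂ) (i : Fin 9) :
    Ktr l i = heis i (fun t => Complex.cos (l i * t)) (fun t => l i * Complex.sin (l i * t)) := rfl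

theorem Kdual_eq (l : Fin 9 → ℂ) (i : Fin 9) :
    Kdual l i = heis i (fun t => -(l i * Complex.sin (l i * t)))
      (fun t => l i ^ 2 * Complex.cos (l i * t)) := rfl

theorem contDiff_Ktr (l : Fin 9 → ℂ) (i : Fin 9) : ContDiff ℝ ∞ (Ktr l i) :=
  contDiff_heis i (isHeis_tr (l i)).contDiff_left (isHeis_tr (l i)).contDiff_right

theorem contDiff_Kdual (l : Fin 9 → ℂ) (i : Fin 9) : ContDiff ℝ ∞ (Kdual l i) :=
  contDiff_heis i (isHeis_dual (l i)).contDiff_left (isHeis_dual (l i)).contDiff_right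

theorem lie_Kplus_Kminus : lie Kplus Kminus = 0 := by
  funext x e
  simp [lie, pd_Kplus, pd_Kminus]

theorem lie_self (X : VField) : lie X X = 0 := by
  funext x e
  simp [lie]

theorem lie_Kplus_heis (i : Fin 9) {b : ℂ} {f g : ℝ → ℂ} (h : IsHeis b f g) :
    lie Kplus (heis i f g) = 0 := by
  funext x e
  simp only [lie, pd_Kplus, pd_heis i (h.deriv_left _) (h.deriv_right _)]
  simp [Kplus, sum_ix]

theorem lie_Kplus_Krot (i j : Fin 9) : lie Kplus (Krot i j) = 0 := by
  funext x e
  simp only [lie, pd_Kplus, pd_Krot]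
  simp [Kplus, sum_ix]

theorem lie_Kminus_heis (i : Fin 9) {b : ℂ} {f g : ℝ → ℂ} (h : IsHeis b f g) :
    lie Kminus (heis i f g) = heis i g (fun t => -(b * f t)) := by
  funext x e
  simp only [lie, pd_Kminus, pd_heis i (h.deriv_left _) (h.deriv_right _)]
  simp [Kminus, sum_ix, heis]
  ring

theorem lie_Kminus_Krot (i j : Fin 9) : lie Kminus (Krot i j) = 0 := by
  funext x e
  simp only [lie, pd_Kminus, pd_Krot]
  simp [Kminus, sum_ix]

/-- The Heisenberg relation: the coefficient of the central field is the Wronskian of the two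
solutions. Here f' and g' name the second solution, not derivatives. -/
theorem lie_heis_heis (i j : Fin 9) {b b' : ℂ} {f g f' g' : ℝ → ℂ} (h : IsHeis b f g)
    (h' : IsHeis b' f' g') (x : Pt) :
    lie (heis i f g) (heis j f' g') x
      = (if i = j then f' (x mi) * g (x mi) - f (x mi) * g' (x mi) else 0) • Kplus x := by
  funext e
  simp only [lie, pd_heis i (h.deriv_left _) (h.deriv_right _),
    pd_heis j (h'.deriv_left _) (h'.deriv_right _)]
  by_cases hij : i = j
  · subst hij
    simp [sum_ix, heis, Kplus, Pi.single_apply]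
    split_ifs <;> ring
  · simp [sum_ix, heis, Kplus, Pi.single_apply, hij, Ne.symm hij]

theorem Krot_apply (i j : Fin 9) (x : Pt) (e : Ix) :
    Krot i j x e = x (tr j) * (Pi.single (tr i) 1 : Ix → ℂ) e
      - x (tr i) * (Pi.single (tr j) 1 : Ix → ℂ) e := rfl

theorem heis_apply (i : Fin 9) (f g : ℝ → ℂ) (x : Pt) (e : Ix) :
    heis i f g x e = f (x mi) * (Pi.single (tr i) 1 : Ix → ℂ) e
      + g (x mi) * x (tr i) * (Pi.single pl 1 : Ix → ℂ) e := rfl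

theorem sum_Krot_mul (i j : Fin 9) (x : Pt) (F : Ix → ℂ) :
    ∑ a, Krot i j x a * F a = x (tr j) * F (tr i) - x (tr i) * F (tr j) := by
  simp [Krot_apply, sub_mul, Finset.sum_sub_distrib, Pi.single_apply]

theorem sum_heis_mul (i : Fin 9) (f g : ℝ → ℂ) (x : Pt) (F : Ix → ℂ) :
    ∑ a, heis i f g x a * F a = f (x mi) * F (tr i) + g (x mi) * x (tr i) * F pl := by
  simp [heis_apply, add_mul, Finset.sum_add_distrib, Pi.single_apply]

theorem lie_Krot_heis (i j k : Fin 9) {b : ℂ} {f g : ℝ → ℂ} (h : IsHeis b f g) :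
    lie (Krot i j) (heis k f g)
      = (if k = i then (1 : ℂ) else 0) • heis j f g
        - (if k = j then (1 : ℂ) else 0) • heis i f g := by
  funext x e
  simp only [lie, Finset.sum_sub_distrib, sum_Krot_mul, sum_heis_mul,
    pd_heis k (h.deriv_left _) (h.deriv_right _), pd_Krot, Pi.sub_apply, Pi.smul_apply]
  simp only [heis_apply, smul_eq_mul]
  by_cases hi : k = i <;> by_cases hj : k = j
  · subst hi; subst hj; simp
  · subst hi; simp [hj, Ne.symm hj]; ring
  · subst hj; simp [hi, Ne.symm hi]; ring
  · simp [hi, hj, Ne.symm hi, Ne.symm hj]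

theorem lie_Krot_Krot (i j k l : Fin 9) :
    lie (Krot i j) (Krot k l)
      = (if i = l then (1 : ℂ) else 0) • Krot k j + (if j = l then (1 : ℂ) else 0) • Krot i k
        + (if i = k then (1 : ℂ) else 0) • Krot j l
        + (if j = k then (1 : ℂ) else 0) • Krot l i := by
  funext x e
  simp only [lie, Finset.sum_sub_distrib, sum_Krot_mul, pd_Krot, Pi.add_apply, Pi.smul_apply]
  simp only [Krot_apply, smul_eq_mul, Sum.inr.injEq]
  rw [if_congr (eq_comm (a := k) (b := j)) rfl rfl, if_congr (eq_comm (a := k) (b := i)) rfl rfl,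
    if_congr (eq_comm (a := l) (b := j)) rfl rfl, if_congr (eq_comm (a := l) (b := i)) rfl rfl]
  by_cases h1 : i = l
  · subst h1
    by_cases h2 : j = k
    · subst h2
      by_cases h3 : i = j
      · subst h3; simp; try ring
      · simp [h3, Ne.symm h3]; try ring
    · by_cases h3 : j = i
      · subst h3; by_cases h4 : j = k <;> simp [h2, h4]
      · by_cases h4 : i = k
        · subst h4; simp [h2, h3]; try ring
        · simp [h2, h3, h4]; try ring
  · by_cases h2 : j = k
    · subst h2
      by_cases h3 : i = j
      · subst h3; simp [h1]; try ring
      · by_cases h4 : j = l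
        · subst h4; simp [h1, h3]; try ring
        · simp [h1, h3, h4]; try ring
    · by_cases h3 : i = k <;> by_cases h4 : j = l <;>
        simp only [h1, h2, h3, h4, if_true, if_false] <;> ring

theorem lie_Kminus_Ktr (l : Fin 9 → ℂ) (i : Fin 9) : lie Kminus (Ktr l i) = -Kdual l i := by
  rw [Ktr_eq, lie_Kminus_heis i (isHeis_tr (l i))]
  funext x e
  simp [heis, Kdual]
  ring

theorem lie_Kminus_Kdual (l : Fin 9 → ℂ) (i : Fin 9) :
    lie Kminus (Kdual l i) = (l i ^ 2) • Ktr l i := by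
  rw [Kdual_eq, lie_Kminus_heis i (isHeis_dual (l i))]
  funext x e
  simp [heis, Ktr]
  ring

theorem lie_Ktr_Ktr (l : Fin 9 → ℂ) (i j : Fin 9) : lie (Ktr l i) (Ktr l j) = 0 := by
  funext x
  rw [Ktr_eq, Ktr_eq, lie_heis_heis i j (isHeis_tr (l i)) (isHeis_tr (l j))]
  by_cases h : i = j
  · subst h
    simp [mul_comm]
  · simp [h]

theorem lie_Kdual_Kdual (l : Fin 9 → ℂ) (i j : Fin 9) : lie (Kdual l i) (Kdual l j) = 0 := by
  funext x
  rw [Kdual_eq, Kdual_eq, lie_heis_heis i j (isHeis_dual (l i)) (isHeis_dual (l j))]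
  by_cases h : i = j
  · subst h
    simp [mul_comm]
  · simp [h]

theorem lie_Ktr_Kdual (l : Fin 9 → ℂ) (i j : Fin 9) :
    lie (Ktr l i) (Kdual l j) = (if i = j then -l i ^ 2 else 0) • Kplus := by
  funext x
  rw [Ktr_eq, Kdual_eq, lie_heis_heis i j (isHeis_tr (l i)) (isHeis_dual (l j))]
  by_cases h : i = j
  · subst h
    simp only [if_true, Pi.smul_apply]
    congr 1
    linear_combination (-l i ^ 2) * Complex.sin_sq_add_cos_sq (l i * x mi)
  · simp [h]

theorem lie_Krot_Ktr (l : Fin 9 → ℂ) {i j : Fin 9} (h : l i = l j) (k : Fin 9) :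
    lie (Krot i j) (Ktr l k)
      = (if k = i then (1 : ℂ) else 0) • Ktr l j - (if k = j then (1 : ℂ) else 0) • Ktr l i := by
  rw [Ktr_eq, lie_Krot_heis i j k (isHeis_tr (l k))]
  by_cases hi : k = i
  · subst hi
    by_cases hj : k = j
    · subst hj
      rfl
    · simp only [hj, Ktr_eq, h]
  · by_cases hj : k = j
    · subst hj
      simp only [hi, Ktr_eq, h]
    · simp [hi, hj]

theorem lie_Krot_Kdual (l : Fin 9 → ℂ) {i j : Fin 9} (h : l i = l j) (k : Fin 9) :
    lie (Krot i j) (Kdual l k)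
      = (if k = i then (1 : ℂ) else 0) • Kdual l j
        - (if k = j then (1 : ℂ) else 0) • Kdual l i := by
  rw [Kdual_eq, lie_Krot_heis i j k (isHeis_dual (l k))]
  by_cases hi : k = i
  · subst hi
    by_cases hj : k = j
    · subst hj
      rfl
    · simp only [hj, Kdual_eq, h]
  · by_cases hj : k = j
    · subst hj
      simp only [hi, Kdual_eq, h]
    · simp [hi, hj]

/-! ## The Lie algebra of Killing vector fields -/

/-- The generators of the even part. -/
def gens (l : Fin 9 → ℂ) : Set VField :=
  {Kplus, Kminus} ∪ Set.range (Ktr l) ∪ Set.range (Kdual l)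
    ∪ {X | ∃ i j, block i = block j ∧ X = Krot i j}

theorem gens_cases {l : Fin 9 → ℂ} {P : VField → Prop} (hp : P Kplus) (hm : P Kminus)
    (htr : ∀ i, P (Ktr l i)) (hd : ∀ i, P (Kdual l i))
    (hr : ∀ i j, block i = block j → P (Krot i j)) : ∀ X ∈ gens l, P X := by
  rintro X ((((rfl | rfl) | ⟨i, rfl⟩) | ⟨i, rfl⟩) | ⟨i, j, hij, rfl⟩)
  exacts [hp, hm, htr i, hd i, hr i j hij]

theorem Kplus_mem (l : Fin 9 → ℂ) : Kplus ∈ Submodule.span ℂ (gens l) :=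
  Submodule.subset_span (Or.inl (Or.inl (Or.inl (Or.inl rfl))))

theorem Kminus_mem (l : Fin 9 → ℂ) : Kminus ∈ Submodule.span ℂ (gens l) :=
  Submodule.subset_span (Or.inl (Or.inl (Or.inl (Or.inr rfl))))

theorem Ktr_mem (l : Fin 9 → ℂ) (i : Fin 9) : Ktr l i ∈ Submodule.span ℂ (gens l) :=
  Submodule.subset_span (Or.inl (Or.inl (Or.inr ⟨i, rfl⟩)))

theorem Kdual_mem (l : Fin 9 → ℂ) (i : Fin 9) : Kdual l i ∈ Submodule.span ℂ (gens l) :=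
  Submodule.subset_span (Or.inl (Or.inr ⟨i, rfl⟩))

theorem Krot_mem (l : Fin 9 → ℂ) {i j : Fin 9} (h : block i = block j) :
    Krot i j ∈ Submodule.span ℂ (gens l) :=
  Submodule.subset_span (Or.inr ⟨i, j, h, rfl⟩)

/-! ### The Killing equation. -/

theorem isKilling_zero (B : Fin 9 → ℝ) : IsKilling B 0 := by
  refine ⟨contDiff_const, fun x a b => ?_⟩
  have h : ∀ a, pd a (0 : VField) x = 0 := fun a => pd_const _ _ _
  simp [h]

theorem isKilling_add {B : Fin 9 → ℝ} {X Y : VField} (hX : IsKilling B X) (hY : IsKilling B Y) :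
    IsKilling B (X + Y) := by
  refine ⟨hX.1.add hY.1, fun x a b => ?_⟩
  have h : ∀ a, pd a (X + Y) x = pd a X x + pd a Y x := fun a =>
    pd_add a (diffAt hX.1 x) (diffAt hY.1 x)
  have hs := congrArg₂ (· + ·) (hX.2 x a b) (hY.2 x a b)
  simp only [← Finset.sum_add_distrib, add_zero] at hs
  refine Eq.trans (Finset.sum_congr rfl fun e _ => ?_) hs
  rw [h, h]
  simp only [Pi.add_apply]
  ring

theorem isKilling_smul {B : Fin 9 → ℝ} (z : ℂ) {X : VField} (hX : IsKilling B X) :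
    IsKilling B (z • X) := by
  refine ⟨hX.1.const_smul z, fun x a b => ?_⟩
  rw [← mul_zero z, ← hX.2 x a b, Finset.mul_sum]
  refine Finset.sum_congr rfl fun e _ => ?_
  rw [pd_const_smul, pd_const_smul]
  simp only [Pi.smul_apply, smul_eq_mul]
  ring

theorem pd_metric_complex (B : Fin 9 → ℝ) (x : Pt) (f a b : Ix) :
    pd f (fun y => (metric B y a b : ℂ)) x
      = if a = mi ∧ b = mi then -Sum.elim (fun _ => 0) (fun i => 2 * (B i : ℂ) * x (tr i)) f
        else 0 := by
  have hd : DifferentiableAt ℝ (fun y => metric B y a b) x := by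
    simp only [metric]
    split_ifs <;> fun_prop
  refine (pd_clm Complex.ofRealCLM f hd).trans ?_
  rw [pd_metric]
  by_cases h : a = mi ∧ b = mi
  · rcases f with f | f <;> simp [h]
  · simp [h]

theorem isKilling_Kplus (B : Fin 9 → ℝ) : IsKilling B Kplus := by
  refine ⟨contDiff_Kplus, fun x a b => ?_⟩
  simp only [pd_Kplus, pd_metric_complex, sum_ix]
  simp [Kplus]

theorem isKilling_Kminus (B : Fin 9 → ℝ) : IsKilling B Kminus := by
  refine ⟨contDiff_Kminus, fun x a b => ?_⟩
  simp only [pd_Kminus, pd_metric_complex, sum_ix]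
  simp [Kminus]

/-- The nontrivial components of the Killing equation are f' = -g, for the pair (-, i), and g' = B_i
f, for the pair (-, -). -/
theorem isKilling_heis (B : Fin 9 → ℝ) (i : Fin 9) {f g : ℝ → ℂ} (h : IsHeis (B i) f g) :
    IsKilling B (heis i f g) := by
  refine ⟨contDiff_heis i h.contDiff_left h.contDiff_right, fun x a b => ?_⟩
  simp only [pd_heis i (h.deriv_left _) (h.deriv_right _), pd_metric_complex, sum_ix]
  induction a using ix_cases <;> induction b using ix_cases <;>
    simp [heis_apply, metric, eta, Pi.single_apply]
  · ring
  · simp only [eq_comm (a := i), apply_ite (Complex.ofReal), Complex.ofReal_one,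
      Complex.ofReal_zero]
    split_ifs <;> simp
  · split_ifs <;> simp

theorem isKilling_Krot (B : Fin 9 → ℝ) {i j : Fin 9} (h : B i = B j) :
    IsKilling B (Krot i j) := by
  refine ⟨contDiff_Krot i j, fun x a b => ?_⟩
  simp only [pd_Krot, pd_metric_complex, sum_ix]
  induction a using ix_cases <;> induction b using ix_cases <;>
    simp [Krot, metric, eta, Pi.single_apply]
  · simp [sub_mul, Finset.sum_sub_distrib, h]
    ring
  · simp only [apply_ite (Complex.ofReal), Complex.ofReal_one, Complex.ofReal_zero]
    simp [Finset.sum_add_distrib, mul_sub, Finset.sum_sub_distrib]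
    rename_i p q
    rw [if_congr (eq_comm (a := i) (b := q)) rfl rfl, if_congr (eq_comm (a := j) (b := q)) rfl rfl]
    split_ifs <;> ring

theorem lam_sq (ap am ap' : ℂ) (i : Fin 9) : lam ap am ap' i ^ 2 = -(mu ap am ap' i) ^ 2 := by
  rw [lam, mul_pow, neg_sq, Complex.I_sq]
  ring

theorem lam_eq_of_block (ap am ap' : ℂ) {i j : Fin 9} (h : block i = block j) :
    lam ap am ap' i = lam ap am ap' j := by
  rw [lam, lam, mu_eq_of_block ap am ap' h]

theorem mu_eq_I_mul_lam (ap am ap' : ℂ) (i : Fin 9) :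
    mu ap am ap' i = Complex.I * lam ap am ap' i := by
  rw [lam, ← mul_assoc, mul_neg, Complex.I_mul_I, neg_neg, one_mul]

theorem Krot_self (i : Fin 9) : Krot i i = 0 := by
  funext x
  simp [Krot]

section
variable {B : Fin 9 → ℝ} {ap am ap' : ℂ}

theorem real_eq_of_block (hB : ∀ i, (B i : ℂ) = -(mu ap am ap' i) ^ 2) {i j : Fin 9}
    (h : block i = block j) : B i = B j := by
  have : (B i : ℂ) = B j := by rw [hB, hB, mu_eq_of_block ap am ap' h]
  exact_mod_cast this

theorem isHeis_Ktr (hB : ∀ i, (B i : ℂ) = -(mu ap am ap' i) ^ 2) (i : Fin 9) :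
    IsHeis (B i) (fun t => Complex.cos (lam ap am ap' i * t))
      (fun t => lam ap am ap' i * Complex.sin (lam ap am ap' i * t)) := by
  rw [hB, ← lam_sq]
  exact isHeis_tr _

theorem isHeis_Kdual (hB : ∀ i, (B i : ℂ) = -(mu ap am ap' i) ^ 2) (i : Fin 9) :
    IsHeis (B i) (fun t => -(lam ap am ap' i * Complex.sin (lam ap am ap' i * t)))
      (fun t => lam ap am ap' i ^ 2 * Complex.cos (lam ap am ap' i * t)) := by
  rw [hB, ← lam_sq]
  exact isHeis_dual _

theorem isKilling_of_mem (hB : ∀ i, (B i : ℂ) = -(mu ap am ap' i) ^ 2) {X : VField}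
    (hX : X ∈ Submodule.span ℂ (gens (lam ap am ap'))) : IsKilling B X := by
  induction hX using Submodule.span_induction with
  | mem X hX =>
    exact gens_cases (isKilling_Kplus B) (isKilling_Kminus B)
      (fun i => isKilling_heis B i (isHeis_Ktr hB i))
      (fun i => isKilling_heis B i (isHeis_Kdual hB i))
      (fun i j h => isKilling_Krot B (real_eq_of_block hB h)) X hX
  | zero => exact isKilling_zero B
  | add X Y _ _ hX hY => exact isKilling_add hX hY
  | smul z X _ hX => exact isKilling_smul z hX

end

theorem contDiff_of_mem {l : Fin 9 → ℂ} {X : VField} (hX : X ∈ Submodule.span ℂ (gens l)) :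
    ContDiff ℝ ∞ X := by
  induction hX using Submodule.span_induction with
  | mem X hX =>
    exact gens_cases contDiff_Kplus contDiff_Kminus (contDiff_Ktr l) (contDiff_Kdual l)
      (fun i j _ => contDiff_Krot i j) X hX
  | zero => exact contDiff_const
  | add X Y _ _ hX hY => exact hX.add hY
  | smul z X _ hX => exact hX.const_smul z

/-- A property of pairs of vector fields that is compatible with linear combinations and symmetric
holds on the span of the generators as soon as it holds for the generators. -/
theorem span_gens_induction {l : Fin 9 → ℂ} {P : VField → VField → Prop}
    (hsymm : ∀ X Y, X ∈ Submodule.span ℂ (gens l) → Y ∈ Submodule.span ℂ (gens l) → P X Y → P Y X)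
    (hzero : ∀ X ∈ Submodule.span ℂ (gens l), P X 0)
    (hadd : ∀ X ∈ Submodule.span ℂ (gens l), ∀ Y ∈ Submodule.span ℂ (gens l),
      ∀ Z ∈ Submodule.span ℂ (gens l), P X Y → P X Z → P X (Y + Z))
    (hsmul : ∀ X ∈ Submodule.span ℂ (gens l), ∀ Y ∈ Submodule.span ℂ (gens l), ∀ z : ℂ,
      P X Y → P X (z • Y))
    (hgen : ∀ X ∈ gens l, ∀ Y ∈ gens l, P X Y) {X Y : VField}
    (hX : X ∈ Submodule.span ℂ (gens l)) (hY : Y ∈ Submodule.span ℂ (gens l)) : P X Y := by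
  have h1 : ∀ X ∈ gens l, ∀ Y ∈ Submodule.span ℂ (gens l), P X Y := by
    intro X hX Y hY
    have hX' := Submodule.subset_span (R := ℂ) hX
    induction hY using Submodule.span_induction with
    | mem Y hY => exact hgen X hX Y hY
    | zero => exact hzero X hX'
    | add Y Z hY hZ ihY ihZ => exact hadd X hX' Y hY Z hZ ihY ihZ
    | smul z Y hY ih => exact hsmul X hX' Y hY z ih
  apply hsymm Y X hY hX
  induction hX using Submodule.span_induction with
  | mem X hX => exact hsymm X Y (Submodule.subset_span hX) hY (h1 X hX Y hY)
  | zero => exact hzero Y hY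
  | add X Z hX hZ ihX ihZ => exact hadd Y hY X hX Z hZ ihX ihZ
  | smul z X hX ih => exact hsmul Y hY X hX z ih

/-- The generators of the even part come in five families; a symmetric relation between generators
has to be checked for pairs of families only. -/
theorem gens_pair_cases {l : Fin 9 → ℂ} {P : VField → VField → Prop}
    (hsymm : ∀ X ∈ gens l, ∀ Y ∈ gens l, P X Y → P Y X)
    (hself : ∀ X ∈ gens l, P X X)
    (hp : ∀ Y ∈ gens l, P Kplus Y)
    (mtr : ∀ i, P Kminus (Ktr l i)) (md : ∀ i, P Kminus (Kdual l i))
    (mr : ∀ i j, block i = block j → P Kminus (Krot i j))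
    (trtr : ∀ i j, P (Ktr l i) (Ktr l j)) (trd : ∀ i j, P (Ktr l i) (Kdual l j))
    (dd : ∀ i j, P (Kdual l i) (Kdual l j))
    (rtr : ∀ i j k, block i = block j → P (Krot i j) (Ktr l k))
    (rd : ∀ i j k, block i = block j → P (Krot i j) (Kdual l k))
    (rr : ∀ i j k m, block i = block j → block k = block m → P (Krot i j) (Krot k m)) :
    ∀ X ∈ gens l, ∀ Y ∈ gens l, P X Y := by
  have gp : Kplus ∈ gens l := Or.inl (Or.inl (Or.inl (Or.inl rfl)))
  have gm : Kminus ∈ gens l := Or.inl (Or.inl (Or.inl (Or.inr rfl)))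
  have gt : ∀ i, Ktr l i ∈ gens l := fun i => Or.inl (Or.inl (Or.inr ⟨i, rfl⟩))
  have gd : ∀ i, Kdual l i ∈ gens l := fun i => Or.inl (Or.inr ⟨i, rfl⟩)
  have gr : ∀ i j, block i = block j → Krot i j ∈ gens l := fun i j h => Or.inr ⟨i, j, h, rfl⟩
  refine gens_cases hp ?_ (fun i => ?_) (fun i => ?_) (fun i j h => ?_)
  · exact gens_cases (hsymm _ gp _ gm (hp _ gm)) (hself _ gm) mtr md mr
  · exact gens_cases (hsymm _ gp _ (gt i) (hp _ (gt i))) (hsymm _ gm _ (gt i) (mtr i)) (trtr i)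
      (trd i) (fun j k h => hsymm _ (gr j k h) _ (gt i) (rtr j k i h))
  · exact gens_cases (hsymm _ gp _ (gd i) (hp _ (gd i))) (hsymm _ gm _ (gd i) (md i))
      (fun j => hsymm _ (gt j) _ (gd i) (trd j i)) (dd i)
      (fun j k h => hsymm _ (gr j k h) _ (gd i) (rd j k i h))
  · exact gens_cases (hsymm _ gp _ (gr i j h) (hp _ (gr i j h)))
      (hsymm _ gm _ (gr i j h) (mr i j h)) (fun k => rtr i j k h) (fun k => rd i j k h)
      (fun k m hk => rr i j k m h hk)

theorem lie_Kplus_Ktr (l : Fin 9 → ℂ) (i : Fin 9) : lie Kplus (Ktr l i) = 0 := by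
  rw [Ktr_eq]
  exact lie_Kplus_heis i (isHeis_tr (l i))

theorem lie_Kplus_Kdual (l : Fin 9 → ℂ) (i : Fin 9) : lie Kplus (Kdual l i) = 0 := by
  rw [Kdual_eq]
  exact lie_Kplus_heis i (isHeis_dual (l i))

theorem lie_Kplus_of_mem {l : Fin 9 → ℂ} {Y : VField} (hY : Y ∈ gens l) : lie Kplus Y = 0 :=
  gens_cases (P := fun Y => lie Kplus Y = 0) (lie_self _) lie_Kplus_Kminus
    (lie_Kplus_Ktr l) (lie_Kplus_Kdual l) (fun i j _ => lie_Kplus_Krot i j) Y hY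

theorem lie_mem_span {ap am ap' : ℂ} {X Y : VField}
    (hX : X ∈ Submodule.span ℂ (gens (lam ap am ap')))
    (hY : Y ∈ Submodule.span ℂ (gens (lam ap am ap'))) :
    lie X Y ∈ Submodule.span ℂ (gens (lam ap am ap')) := by
  set l := lam ap am ap' with hl
  refine span_gens_induction (P := fun X Y => lie X Y ∈ Submodule.span ℂ (gens l))
    (fun X Y _ _ h => ?_) (fun X _ => ?_) (fun X hX Y hY Z hZ h1 h2 => ?_)
    (fun X hX Y hY z h => ?_) (gens_pair_cases (fun X _ Y _ h => ?_) (fun X _ => ?_)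
      (fun Y hY => ?_) (fun i => ?_) (fun i => ?_) (fun i j _ => ?_) (fun i j => ?_) (fun i j => ?_)
      (fun i j => ?_) (fun i j k h => ?_) (fun i j k h => ?_) (fun i j k m h h' => ?_)) hX hY
  · rw [lie_swap]; exact Submodule.neg_mem _ h
  · rw [lie_zero_right]; exact Submodule.zero_mem _
  · rw [lie_add_right X (contDiff_of_mem hY) (contDiff_of_mem hZ)]
    exact Submodule.add_mem _ h1 h2
  · rw [lie_smul_right]; exact Submodule.smul_mem _ _ h
  · rw [lie_swap]; exact Submodule.neg_mem _ h
  · rw [lie_self]; exact Submodule.zero_mem _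
  · rw [lie_Kplus_of_mem hY]; exact Submodule.zero_mem _
  · rw [lie_Kminus_Ktr]; exact Submodule.neg_mem _ (Kdual_mem l i)
  · rw [lie_Kminus_Kdual]; exact Submodule.smul_mem _ _ (Ktr_mem l i)
  · rw [lie_Kminus_Krot]; exact Submodule.zero_mem _
  · rw [lie_Ktr_Ktr]; exact Submodule.zero_mem _
  · rw [lie_Ktr_Kdual]; exact Submodule.smul_mem _ _ (Kplus_mem l)
  · rw [lie_Kdual_Kdual]; exact Submodule.zero_mem _
  · rw [lie_Krot_Ktr l (lam_eq_of_block ap am ap' h)]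
    exact Submodule.sub_mem _ (Submodule.smul_mem _ _ (Ktr_mem l j))
      (Submodule.smul_mem _ _ (Ktr_mem l i))
  · rw [lie_Krot_Kdual l (lam_eq_of_block ap am ap' h)]
    exact Submodule.sub_mem _ (Submodule.smul_mem _ _ (Kdual_mem l j))
      (Submodule.smul_mem _ _ (Kdual_mem l i))
  -- A term of [K_(ij), K_(km)] survives only if two indices coincide, and the coincidence puts all
  -- indices into one block.
  · have hite : ∀ (p : Prop) [Decidable p] (a b : Fin 9), (p → block a = block b) →
        (if p then (1 : ℂ) else 0) • Krot a b ∈ Submodule.span ℂ (gens l) := by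
      intro p _ a b hab
      by_cases hp : p
      · rw [if_pos hp, one_smul]
        exact Krot_mem l (hab hp)
      · rw [if_neg hp, zero_smul]
        exact Submodule.zero_mem _
    rw [lie_Krot_Krot]
    refine Submodule.add_mem _ (Submodule.add_mem _ (Submodule.add_mem _ ?_ ?_) ?_) ?_
    · exact hite _ _ _ fun e => by rw [h', ← e, h]
    · exact hite _ _ _ fun e => by rw [h, h', e]
    · exact hite _ _ _ fun e => by rw [← h, e, h']
    · exact hite _ _ _ fun e => by rw [← h', h, e]

/-! ## The action of the even part on the odd part -/

section
variable (ρ : SpinRep S) (B : Fin 9 → ℝ)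

theorem ip_add (x : Pt) (u v w : Ix → ℂ) : ip B x u (v + w) = ip B x u v + ip B x u w := by
  simp [ip, mul_add, Finset.sum_add_distrib]

theorem ip_smul (x : Pt) (u v : Ix → ℂ) (z : ℂ) : ip B x u (z • v) = z * ip B x u v := by
  simp only [ip, Pi.smul_apply, smul_eq_mul, Finset.mul_sum]
  exact Finset.sum_congr rfl fun a _ => Finset.sum_congr rfl fun b _ => by ring

theorem lie_add_left {X Y : VField} (Z : VField) (hX : ContDiff ℝ ∞ X) (hY : ContDiff ℝ ∞ Y) :
    lie (X + Y) Z = lie X Z + lie Y Z := by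
  rw [lie_swap, lie_add_right Z hX hY, lie_swap X, lie_swap Y, neg_add]

theorem lie_smul_left (X Y : VField) (z : ℂ) : lie (z • X) Y = z • lie X Y := by
  rw [lie_swap, lie_smul_right, lie_swap X, smul_neg]

theorem spinLie_add {X Y : VField} (hX : ContDiff ℝ ∞ X) (hY : ContDiff ℝ ∞ Y) (ξ : Pt → S) :
    spinLie ρ B (X + Y) ξ = spinLie ρ B X ξ + spinLie ρ B Y ξ := by
  funext x
  simp only [Pi.add_apply, spinLie_eq, lie_add_left _ hX hY, ip_add, spinEnd_add, add_smul,
    Finset.sum_add_distrib, LinearMap.add_apply]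
  abel

theorem spinLie_smul (z : ℂ) (X : VField) (ξ : Pt → S) :
    spinLie ρ B (z • X) ξ = z • spinLie ρ B X ξ := by
  funext x
  simp only [Pi.smul_apply, spinLie_eq, lie_smul_left, ip_smul, spinEnd_smul, smul_eq_mul,
    mul_smul, ← Finset.smul_sum, LinearMap.smul_apply, smul_add]

theorem spinLie_zero (ξ : Pt → S) : spinLie ρ B 0 ξ = 0 := by
  simpa using spinLie_smul ρ B 0 0 ξ

theorem spinLie_spinor_add (X : VField) {ξ η : Pt → S} (hξ : ContDiff ℝ ∞ ξ)
    (hη : ContDiff ℝ ∞ η) : spinLie ρ B X (ξ + η) = spinLie ρ B X ξ + spinLie ρ B X η := by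
  funext x
  have h : ∀ a, pd a (ξ + η) x = pd a ξ x + pd a η x := fun a =>
    pd_add a (diffAt hξ x) (diffAt hη x)
  simp only [Pi.add_apply, spinLie_eq, h, map_add, smul_add, Finset.sum_add_distrib]
  abel

theorem spinLie_spinor_smul (X : VField) (z : ℂ) (ξ : Pt → S) :
    spinLie ρ B X (z • ξ) = z • spinLie ρ B X ξ := by
  funext x
  have h : ∀ a, pd a (z • ξ) x = z • pd a ξ x := fun a => by
    simp only [pd]
    rw [fderiv_const_smul_field]
    rfl
  simp only [Pi.smul_apply, spinLie_eq, h, map_smul, smul_add, Finset.smul_sum, smul_comm z]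

end

section
variable [FiniteDimensional ℂ S] (ρ : SpinRep S) {B : Fin 9 → ℝ} {ap am ap' : ℂ}

theorem spinLie_mem (hB : ∀ i, (B i : ℂ) = -(mu ap am ap' i) ^ 2)
    (hne : ∃ i, curvCoef B ap am i ≠ 0) {X : VField}
    (hX : X ∈ Submodule.span ℂ (gens (lam ap am ap'))) {ξ : Pt → S}
    (hξ : ξ ∈ parallelSpinors ρ B (cElt ρ ap am) (dElt ρ ap')) :
    spinLie ρ B X ξ ∈ parallelSpinors ρ B (cElt ρ ap am) (dElt ρ ap') := by
  have hV := value_mem_initSpace ρ hB hne hξ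
  induction hX using Submodule.span_induction with
  | mem X hX =>
    refine gens_cases
      (P := fun X => spinLie ρ B X ξ ∈ parallelSpinors ρ B (cElt ρ ap am) (dElt ρ ap'))
      ?_ ?_ (fun i => ?_) (fun i => ?_) (fun i j h => ?_) X hX
    · have : spinLie ρ B Kplus ξ = 0 := by
        funext x
        rw [spinLie_Kplus, pd_pl_parallel ρ hξ, neg_zero]
        rfl
      rw [this]
      exact Submodule.zero_mem _
    · have : spinLie ρ B Kminus ξ = -pd mi ξ := funext fun x => spinLie_Kminus ρ B ξ x
      rw [this]
      exact Submodule.neg_mem _ (pd_mi_mem_parallelSpinors ρ hξ)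
    · have h := isHeis_Ktr hB i
      rw [Ktr_eq]
      exact spinLie_heis_mem ρ hξ hB hV i h.1 h.2 h.3 h.4
    · have h := isHeis_Kdual hB i
      rw [Kdual_eq]
      exact spinLie_heis_mem ρ hξ hB hV i h.1 h.2 h.3 h.4
    · by_cases hij : i = j
      · subst hij
        rw [Krot_self, spinLie_zero]
        exact Submodule.zero_mem _
      · exact spinLie_Krot_mem ρ hξ hB hV hij h
  | zero => rw [spinLie_zero]; exact Submodule.zero_mem _
  | add X Y hX hY h1 h2 =>
    rw [spinLie_add ρ B (contDiff_of_mem hX) (contDiff_of_mem hY)]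
    exact Submodule.add_mem _ h1 h2
  | smul z X _ h => rw [spinLie_smul]; exact Submodule.smul_mem _ _ h

end

/-! ### The action on the initial values -/

section
variable (ρ : SpinRep S) {B : Fin 9 → ℝ} {ap am ap' : ℂ} {ξ : Pt → S}

theorem spinLie_Kplus_zero (hξ : ξ ∈ parallelSpinors ρ B (cElt ρ ap am) (dElt ρ ap')) :
    spinLie ρ B Kplus ξ 0 = 0 := by
  rw [spinLie_Kplus, pd_pl_parallel ρ hξ, neg_zero]

theorem spinLie_Kminus_zero (hξ : ξ ∈ parallelSpinors ρ B (cElt ρ ap am) (dElt ρ ap')) :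
    spinLie ρ B Kminus ξ 0 = -connTerm ρ (cElt ρ ap am) (dElt ρ ap') mi (ξ 0) := by
  rw [spinLie_Kminus, pd_mi_parallel ρ hξ, connCoef_apply_mi]
  simp

theorem spinLie_Ktr_zero (hB : ∀ i, (B i : ℂ) = -(mu ap am ap' i) ^ 2)
    (hξ : ξ ∈ parallelSpinors ρ B (cElt ρ ap am) (dElt ρ ap')) (hV : ∀ x, ξ x ∈ initSpace ρ)
    (i : Fin 9) : spinLie ρ B (Ktr (lam ap am ap') i) ξ 0
      = (mu ap am ap' i / 2) • gam ρ pl (gam123 ρ (gam ρ (tr i) (ξ 0))) := by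
  have h := isHeis_Ktr hB i
  rw [Ktr_eq, spinLie_heis_parallel ρ hξ hV i h.3 h.4]
  simp

theorem spinLie_Kdual_zero (hB : ∀ i, (B i : ℂ) = -(mu ap am ap' i) ^ 2)
    (hξ : ξ ∈ parallelSpinors ρ B (cElt ρ ap am) (dElt ρ ap')) (hV : ∀ x, ξ x ∈ initSpace ρ)
    (i : Fin 9) : spinLie ρ B (Kdual (lam ap am ap') i) ξ 0
      = (mu ap am ap' i ^ 2 / 2) • gam ρ pl (gam ρ (tr i) (ξ 0)) := by
  have h := isHeis_Kdual hB i
  rw [Kdual_eq, spinLie_heis_parallel ρ hξ hV i h.3 h.4]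
  simp [lam_sq]
  module

/-- The term with i = j compensates Γ_i² = -1, so that the formula also covers K_(ii) = 0 and
commutators of rotations need no exceptions. -/
theorem spinLie_Krot_zero (hB : ∀ i, (B i : ℂ) = -(mu ap am ap' i) ^ 2) {i j : Fin 9}
    (hb : block i = block j) :
    spinLie ρ B (Krot i j) ξ 0 = (1 / 2 : ℂ) • (gam ρ (tr i) (gam ρ (tr j) (ξ 0))
      + (if i = j then (1 : ℂ) else 0) • ξ 0) := by
  by_cases hij : i = j
  · subst hij
    rw [Krot_self, spinLie_zero]
    simp
  · rw [spinLie_Krot ρ B hij (real_eq_of_block hB hb)]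
    simp [hij]

end

/-! ### The action is a representation of the Lie algebra. -/

section
variable (ρ : SpinRep S) {B : Fin 9 → ℝ} {ap am ap' : ℂ}

theorem spinLie_spinor_zero (X : VField) : spinLie ρ B X (0 : Pt → S) = 0 := by
  simpa using spinLie_spinor_smul ρ B X 0 0

theorem contDiff_smul_field (z : ℂ) {X : VField} (hX : ContDiff ℝ ∞ X) : ContDiff ℝ ∞ (z • X) :=
  show ContDiff ℝ ∞ fun x => z • X x from hX.const_smul z

theorem contDiff_add_field {X Y : VField} (hX : ContDiff ℝ ∞ X) (hY : ContDiff ℝ ∞ Y) :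
    ContDiff ℝ ∞ (X + Y) :=
  show ContDiff ℝ ∞ fun x => X x + Y x from hX.add hY

theorem spinLie_sub {X Y : VField} (hX : ContDiff ℝ ∞ X) (hY : ContDiff ℝ ∞ Y) (ξ : Pt → S) :
    spinLie ρ B (X - Y) ξ = spinLie ρ B X ξ - spinLie ρ B Y ξ := by
  rw [sub_eq_add_neg, ← neg_one_smul ℂ Y, spinLie_add ρ B hX (contDiff_smul_field (-1) hY),
    spinLie_smul, neg_one_smul, ← sub_eq_add_neg]

theorem spinLie_swap (X Y : VField) (ξ : Pt → S) :
    spinLie ρ B (lie X Y) ξ = -spinLie ρ B (lie Y X) ξ := by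
  rw [lie_swap, ← neg_one_smul ℂ, spinLie_smul, neg_one_smul]

theorem rot_pl (i j : Fin 9) (ψ : S) : gam ρ (tr i) (gam ρ (tr j) (gam ρ pl ψ))
    = gam ρ pl (gam ρ (tr i) (gam ρ (tr j) ψ)) := by
  simp

theorem connTerm_mi_rot {i j : Fin 9} (hb : block i = block j) (ψ : S) :
    connTerm ρ (cElt ρ ap am) (dElt ρ ap') mi (gam ρ (tr i) (gam ρ (tr j) ψ))
      = gam ρ (tr i) (gam ρ (tr j) (connTerm ρ (cElt ρ ap am) (dElt ρ ap') mi ψ)) := by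
  have h2 : ∀ v, gam ρ (tr i) (gam ρ (tr j) (gam ρ mi v))
      = gam ρ mi (gam ρ (tr i) (gam ρ (tr j) v)) := fun v => by simp [tr_mi]
  simp only [connTerm_mi, map_add, map_smul, rot_gam123 ρ hb, gam1245_rot ρ hb, rot_pl, h2]

/-- At the origin, the commutator of spinorial Lie derivatives of a parallel spinor is the
spinorial Lie derivative along the commutator. -/
theorem spinLie_comm_apply_zero [FiniteDimensional ℂ S]
    (hB : ∀ i, (B i : ℂ) = -(mu ap am ap' i) ^ 2)
    (hne : ∃ i, curvCoef B ap am i ≠ 0) {X Y : VField}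
    (hX : X ∈ Submodule.span ℂ (gens (lam ap am ap')))
    (hY : Y ∈ Submodule.span ℂ (gens (lam ap am ap'))) {ξ : Pt → S}
    (hξ : ξ ∈ parallelSpinors ρ B (cElt ρ ap am) (dElt ρ ap')) :
    spinLie ρ B X (spinLie ρ B Y ξ) 0 - spinLie ρ B Y (spinLie ρ B X ξ) 0
      = spinLie ρ B (lie X Y) ξ 0 := by
  set l := lam ap am ap' with hl
  have hsub : ∀ {Z}, Z ∈ gens l → Z ∈ Submodule.span ℂ (gens l) := fun h => Submodule.subset_span h
  have hm : ∀ {Z}, Z ∈ Submodule.span ℂ (gens l) →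
      spinLie ρ B Z ξ ∈ parallelSpinors ρ B (cElt ρ ap am) (dElt ρ ap') :=
    fun hZ => spinLie_mem ρ hB hne hZ hξ
  have hV := value_mem_initSpace ρ hB hne hξ
  have hV' : ∀ {Z}, Z ∈ Submodule.span ℂ (gens l) → ∀ x, spinLie ρ B Z ξ x ∈ initSpace ρ :=
    fun hZ => value_mem_initSpace ρ hB hne (hm hZ)
  have hx := (mem_initSpace_iff ρ).1 (hV 0)
  have tp := Kplus_mem l
  have tm := Kminus_mem l
  have tt := Ktr_mem l
  have td := Kdual_mem l
  have vp : spinLie ρ B Kplus ξ 0 = 0 := spinLie_Kplus_zero ρ hξ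
  have vm := spinLie_Kminus_zero ρ hξ
  have vt := spinLie_Ktr_zero ρ hB hξ hV
  have vd := spinLie_Kdual_zero ρ hB hξ hV
  have wm : ∀ {Z}, Z ∈ Submodule.span ℂ (gens l) → _ := fun hZ => spinLie_Kminus_zero ρ (hm hZ)
  have wt : ∀ {Z}, Z ∈ Submodule.span ℂ (gens l) → _ :=
    fun hZ => spinLie_Ktr_zero ρ hB (hm hZ) (hV' hZ)
  have wd : ∀ {Z}, Z ∈ Submodule.span ℂ (gens l) → _ :=
    fun hZ => spinLie_Kdual_zero ρ hB (hm hZ) (hV' hZ)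
  refine span_gens_induction (P := fun X Y => spinLie ρ B X (spinLie ρ B Y ξ) 0
      - spinLie ρ B Y (spinLie ρ B X ξ) 0 = spinLie ρ B (lie X Y) ξ 0)
    (fun X Y _ _ h => ?_) (fun X _ => ?_) (fun X hX Y hY Z hZ h1 h2 => ?_)
    (fun X hX Y hY z h => ?_) (gens_pair_cases (fun X _ Y _ h => ?_) (fun X _ => ?_)
      (fun Y hY => ?_) (fun i => ?_) (fun i => ?_) (fun i j h => ?_) (fun i j => ?_) (fun i j => ?_)
      (fun i j => ?_) (fun i j k h => ?_) (fun i j k h => ?_) (fun i j k l' h h' => ?_)) hX hY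
  · rw [spinLie_swap, Pi.neg_apply, ← h, neg_sub]
  · rw [spinLie_zero, spinLie_spinor_zero, lie_zero_right, spinLie_zero, spinLie_zero]
    simp
  · rw [lie_add_right X (contDiff_of_mem hY) (contDiff_of_mem hZ),
      spinLie_add ρ B (contDiff_of_mem hY) (contDiff_of_mem hZ),
      spinLie_add ρ B (contDiff_of_mem hY) (contDiff_of_mem hZ),
      spinLie_add ρ B (contDiff_of_mem (lie_mem_span hX hY)) (contDiff_of_mem (lie_mem_span hX hZ)),
      spinLie_spinor_add ρ B X (hm hY).1 (hm hZ).1]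
    simp only [Pi.add_apply, ← h1, ← h2]
    abel
  · rw [lie_smul_right, spinLie_smul, spinLie_smul, spinLie_smul, spinLie_spinor_smul]
    simp only [Pi.smul_apply, ← h, smul_sub]
  · rw [spinLie_swap, Pi.neg_apply, ← h, neg_sub]
  · rw [lie_self, spinLie_zero, sub_self]
    rfl
  · have h0 : spinLie ρ B Kplus ξ = 0 := funext fun x => by
      rw [spinLie_Kplus, pd_pl_parallel ρ hξ, neg_zero]
      rfl
    rw [lie_Kplus_of_mem hY, h0, spinLie_spinor_zero, spinLie_zero,
      spinLie_Kplus_zero ρ (hm (hsub hY))]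
    simp
  · rw [lie_Kminus_Ktr, ← neg_one_smul ℂ (Kdual l i), spinLie_smul, Pi.smul_apply, vd, wm (tt i),
      wt tm, vm, vt]
    have h1 : eps i = 1 ∨ eps i = -1 := mul_self_eq_one_iff.1 (eps_sq i)
    have h2 : del i = 1 ∨ del i = -1 := mul_self_eq_one_iff.1 (del_sq i)
    simp [connTerm_mi, mu_eq, pl_tr_gam1245 ρ hx, pl_gam123_tr_gam1245 ρ hx]
    rcases h1 with h1 | h1 <;> rcases h2 with h2 | h2 <;> rw [h1, h2] <;> simp <;> module
  · rw [lie_Kminus_Kdual, spinLie_smul, Pi.smul_apply, vt, wm (td i), wd tm, vm, vd, hl, lam_sq]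
    have h1 : eps i = 1 ∨ eps i = -1 := mul_self_eq_one_iff.1 (eps_sq i)
    have h2 : del i = 1 ∨ del i = -1 := mul_self_eq_one_iff.1 (del_sq i)
    simp [connTerm_mi, mu_eq, pl_tr_gam1245 ρ hx, pl_gam123_tr_gam1245 ρ hx]
    rcases h1 with h1 | h1 <;> rcases h2 with h2 | h2 <;> rw [h1, h2] <;> simp <;> module
  · rw [lie_Kminus_Krot, spinLie_zero, wm (Krot_mem l h), spinLie_Krot_zero ρ hB h,
      spinLie_Krot_zero ρ hB h, vm]
    simp only [map_smul, map_add, map_neg, connTerm_mi_rot ρ h, smul_neg, Pi.zero_apply]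
    module
  · rw [lie_Ktr_Ktr, spinLie_zero, wt (tt j), wt (tt i), vt, vt]
    simp
  · rw [lie_Ktr_Kdual, spinLie_smul, Pi.smul_apply, vp, wt (td j), wd (tt i), vt, vd]
    simp
  · rw [lie_Kdual_Kdual, spinLie_zero, wd (td j), wd (td i), vd, vd]
    simp
  · rw [lie_Krot_Ktr l (lam_eq_of_block ap am ap' h),
      spinLie_sub ρ (contDiff_smul_field _ (contDiff_Ktr l j))
        (contDiff_smul_field _ (contDiff_Ktr l i)),
      Pi.sub_apply, spinLie_smul, spinLie_smul, Pi.smul_apply, Pi.smul_apply,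
      spinLie_Krot_zero ρ hB h, wt (Krot_mem l h), vt, vt, vt, spinLie_Krot_zero ρ hB h]
    simp only [map_smul, map_add, rot_pl, rot_gam123 ρ h, rot_tr ρ i j k, map_sub]
    have hmu := mu_eq_of_block ap am ap' h
    by_cases hi : k = i
    · subst hi
      by_cases hj : k = j <;> simp only [hj, hmu, if_true, if_false] <;> module
    · by_cases hj : k = j
      · subst hj
        simp only [hi, hmu, if_true, if_false]
        module
      · simp only [hi, hj, if_false]
        module
  · rw [lie_Krot_Kdual l (lam_eq_of_block ap am ap' h),
      spinLie_sub ρ (contDiff_smul_field _ (contDiff_Kdual l j))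
        (contDiff_smul_field _ (contDiff_Kdual l i)),
      Pi.sub_apply, spinLie_smul, spinLie_smul, Pi.smul_apply, Pi.smul_apply,
      spinLie_Krot_zero ρ hB h, wd (Krot_mem l h), vd, vd, vd, spinLie_Krot_zero ρ hB h]
    simp only [map_smul, map_add, rot_pl, rot_gam123 ρ h, rot_tr ρ i j k, map_sub]
    have hmu := mu_eq_of_block ap am ap' h
    by_cases hi : k = i
    · subst hi
      by_cases hj : k = j <;> simp only [hj, hmu, if_true, if_false] <;> module
    · by_cases hj : k = j
      · subst hj
        simp only [hi, hmu, if_true, if_false]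
        module
      · simp only [hi, hj, if_false]
        module
  · have hr : ∀ (p : Prop) [Decidable p] (a b : Fin 9), (p → block a = block b) →
        spinLie ρ B ((if p then (1 : ℂ) else 0) • Krot a b) ξ 0
          = (if p then (1 : ℂ) else 0) • (1 / 2 : ℂ) • (gam ρ (tr a) (gam ρ (tr b) (ξ 0))
            + (if a = b then (1 : ℂ) else 0) • ξ 0) := by
      intro p _ a b hab
      rw [spinLie_smul, Pi.smul_apply]
      by_cases hp : p
      · rw [spinLie_Krot_zero ρ hB (hab hp)]
      · simp only [if_neg hp, zero_smul]
    have hc : ∀ (p : Prop) [Decidable p] (a b : Fin 9),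
        ContDiff ℝ ∞ ((if p then (1 : ℂ) else 0) • Krot a b) := fun p _ a b =>
      contDiff_smul_field _ (contDiff_Krot a b)
    rw [lie_Krot_Krot, spinLie_add ρ B
        (contDiff_add_field (contDiff_add_field (hc _ _ _) (hc _ _ _)) (hc _ _ _)) (hc _ _ _),
      Pi.add_apply, spinLie_add ρ B (contDiff_add_field (hc _ _ _) (hc _ _ _)) (hc _ _ _),
      Pi.add_apply,
      spinLie_add ρ B (hc _ _ _) (hc _ _ _), Pi.add_apply, hr _ _ _ fun e => by rw [h', ← e, h],
      hr _ _ _ fun e => by rw [h, h', e], hr _ _ _ fun e => by rw [← h, e, h'],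
      hr _ _ _ fun e => by rw [← h', h, e], spinLie_Krot_zero ρ hB h, spinLie_Krot_zero ρ hB h',
      spinLie_Krot_zero ρ hB h', spinLie_Krot_zero ρ hB h]
    -- After `rot_tr`, two products appear in both orders; this relation makes them comparable and
    -- accounts for the Kronecker terms.
    have hs : ∀ (a b : Fin 9) (ψ : S), gam ρ (tr a) (gam ρ (tr b) ψ)
        = -(if b = a then (2 : ℂ) else 0) • ψ - gam ρ (tr b) (gam ρ (tr a) ψ) := by
      intro a b ψ
      rw [gam_gam_swap]
      congr 2
      by_cases hab : b = a
      · simp [eta, hab]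
      · simp [eta, hab, Ne.symm hab]
    simp only [map_smul, map_add]
    rw [rot_tr ρ i j k, rot_tr ρ i j l']
    simp only [map_smul, map_add, map_sub]
    rw [hs i k (ξ 0), hs l' i (ξ 0)]
    have h2 : ∀ (p : Prop) [Decidable p], (if p then (2 : ℂ) else 0) = 2 * (if p then 1 else 0) :=
      fun p _ => by split_ifs <;> simp
    simp only [h2]
    rw [if_congr (eq_comm (a := k) (b := i)) rfl rfl, if_congr (eq_comm (a := k) (b := j)) rfl rfl,
      if_congr (eq_comm (a := l') (b := i)) rfl rfl, if_congr (eq_comm (a := l') (b := j)) rfl rfl]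
    module

/-- The difference of the two sides is parallel and vanishes at the origin, hence vanishes
identically. -/
theorem spinLie_comm (hB : ∀ i, (B i : ℂ) = -(mu ap am ap' i) ^ 2)
    (hne : ∃ i, curvCoef B ap am i ≠ 0) {X Y : VField}
    (hX : X ∈ Submodule.span ℂ (gens (lam ap am ap')))
    (hY : Y ∈ Submodule.span ℂ (gens (lam ap am ap'))) {ξ : Pt → S} [FiniteDimensional ℂ S]
    (hξ : ξ ∈ parallelSpinors ρ B (cElt ρ ap am) (dElt ρ ap')) :
    spinLie ρ B X (spinLie ρ B Y ξ) - spinLie ρ B Y (spinLie ρ B X ξ)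
      = spinLie ρ B (lie X Y) ξ := by
  have hm : ∀ {Z η}, Z ∈ Submodule.span ℂ (gens (lam ap am ap')) →
      η ∈ parallelSpinors ρ B (cElt ρ ap am) (dElt ρ ap') →
      spinLie ρ B Z η ∈ parallelSpinors ρ B (cElt ρ ap am) (dElt ρ ap') :=
    fun hZ hη => spinLie_mem ρ hB hne hZ hη
  refine sub_eq_zero.1 (parallel_eq_zero ρ (Submodule.sub_mem _ (Submodule.sub_mem _
    (hm hX (hm hY hξ)) (hm hY (hm hX hξ))) (hm (lie_mem_span hX hY) hξ)) ?_)
  rw [Pi.sub_apply, Pi.sub_apply, spinLie_comm_apply_zero ρ hB hne hX hY hξ, sub_self]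

end

/-! ## Linear combinations of the generators -/

/-- The linear combination of the generators with given coefficients. -/
def comb (l : Fin 9 → ℂ) (p m : ℂ) (t d : Fin 9 → ℂ) (r : Fin 9 → Fin 9 → ℂ) : VField :=
  p • Kplus + m • Kminus + ∑ i, t i • Ktr l i + ∑ i, d i • Kdual l i
    + (1 / 2 : ℂ) • ∑ i, ∑ j, r i j • Krot i j

theorem Kdual_eq_zero {l : Fin 9 → ℂ} {i : Fin 9} (h : l i = 0) : Kdual l i = 0 := by
  funext x
  simp [Kdual, h]

theorem Krot_swap (i j : Fin 9) : Krot j i = -Krot i j := by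
  funext x
  simp [Krot]

/-- Reduces identities between fields to identities between coefficients. For λ_i = 0 the field
K_(i*) is zero, so its coefficient, which involves a division by λ_i, may be anything. -/
theorem comb_congr {l : Fin 9 → ℂ} {p m p' m' : ℂ} {t d t' d' : Fin 9 → ℂ}
    {r r' : Fin 9 → Fin 9 → ℂ} (hp : p = p') (hm : m = m') (ht : ∀ i, t i = t' i)
    (hd : ∀ i, l i ≠ 0 → d i = d' i) (hr : ∀ i j, r i j = r' i j) :
    comb l p m t d r = comb l p' m' t' d' r' := by
  have : ∀ i, d i • Kdual l i = d' i • Kdual l i := fun i => by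
    by_cases h : l i = 0
    · rw [Kdual_eq_zero h, smul_zero, smul_zero]
    · rw [hd i h]
  simp only [comb, hp, hm, ht, hr, this]

theorem comb_add (l : Fin 9 → ℂ) (p m p' m' : ℂ) (t d t' d' : Fin 9 → ℂ)
    (r r' : Fin 9 → Fin 9 → ℂ) :
    comb l p m t d r + comb l p' m' t' d' r'
      = comb l (p + p') (m + m') (fun i => t i + t' i) (fun i => d i + d' i)
        (fun i j => r i j + r' i j) := by
  simp only [comb, add_smul, Finset.sum_add_distrib, smul_add]
  abel

theorem comb_smul (l : Fin 9 → ℂ) (z p m : ℂ) (t d : Fin 9 → ℂ) (r : Fin 9 → Fin 9 → ℂ) :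
    z • comb l p m t d r = comb l (z * p) (z * m) (fun i => z * t i) (fun i => z * d i)
        (fun i j => z * r i j) := by
  simp only [comb, mul_smul, Finset.smul_sum, smul_add, smul_comm z (1 / 2 : ℂ)]

theorem comb_mem (l : Fin 9 → ℂ) (p m : ℂ) (t d : Fin 9 → ℂ) {r : Fin 9 → Fin 9 → ℂ}
    (hr : ∀ i j, block i ≠ block j → r i j = 0) :
    comb l p m t d r ∈ Submodule.span ℂ (gens l) := by
  refine Submodule.add_mem _ (Submodule.add_mem _ (Submodule.add_mem _ (Submodule.add_mem _
    (Submodule.smul_mem _ _ (Kplus_mem l)) (Submodule.smul_mem _ _ (Kminus_mem l)))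
    (Submodule.sum_mem _ fun i _ => Submodule.smul_mem _ _ (Ktr_mem l i)))
    (Submodule.sum_mem _ fun i _ => Submodule.smul_mem _ _ (Kdual_mem l i)))
    (Submodule.smul_mem _ _ (Submodule.sum_mem _ fun i _ => Submodule.sum_mem _ fun j _ => ?_))
  by_cases h : block i = block j
  · exact Submodule.smul_mem _ _ (Krot_mem l h)
  · rw [hr i j h, zero_smul]
    exact Submodule.zero_mem _

theorem contDiff_sum_field {Y : Fin 9 → VField} (hY : ∀ i, ContDiff ℝ ∞ (Y i)) :
    ContDiff ℝ ∞ (∑ i, Y i) := by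
  have h := ContDiff.sum (s := Finset.univ) fun i _ => hY i
  convert h using 1
  funext x
  simp

theorem lie_comb (X : VField) (l : Fin 9 → ℂ) (p m : ℂ) (t d : Fin 9 → ℂ)
    (r : Fin 9 → Fin 9 → ℂ) :
    lie X (comb l p m t d r) = p • lie X Kplus + m • lie X Kminus + ∑ i, t i • lie X (Ktr l i)
      + ∑ i, d i • lie X (Kdual l i) + (1 / 2 : ℂ) • ∑ i, ∑ j, r i j • lie X (Krot i j) := by
  have h1 := contDiff_smul_field p contDiff_Kplus
  have h2 := contDiff_smul_field m contDiff_Kminus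
  have h3 := fun i => contDiff_smul_field (t i) (contDiff_Ktr l i)
  have h4 := fun i => contDiff_smul_field (d i) (contDiff_Kdual l i)
  have h5 := fun i j => contDiff_smul_field (r i j) (contDiff_Krot i j)
  have h6 := fun i => contDiff_sum_field (h5 i)
  have a1 := contDiff_add_field h1 h2
  have a2 := contDiff_add_field a1 (contDiff_sum_field h3)
  have a3 := contDiff_add_field a2 (contDiff_sum_field h4)
  rw [comb, lie_add_right X a3 (contDiff_smul_field _ (contDiff_sum_field h6)),
    lie_add_right X a2 (contDiff_sum_field h4), lie_add_right X a1 (contDiff_sum_field h3),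
    lie_add_right X h1 h2, lie_smul_right, lie_smul_right, lie_smul_right, lie_sum_right _ X h3,
    lie_sum_right _ X h4, lie_sum_right _ X h6]
  simp only [lie_sum_right _ X (h5 _), lie_smul_right]

theorem lie_Kplus_comb (l : Fin 9 → ℂ) (p m : ℂ) (t d : Fin 9 → ℂ) (r : Fin 9 → Fin 9 → ℂ) :
    lie Kplus (comb l p m t d r) = 0 := by
  simp [lie_comb, lie_self, lie_Kplus_Kminus, lie_Kplus_Ktr, lie_Kplus_Kdual, lie_Kplus_Krot]

theorem lie_Kminus_comb (l : Fin 9 → ℂ) (p m : ℂ) (t d : Fin 9 → ℂ) (r : Fin 9 → Fin 9 → ℂ) :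
    lie Kminus (comb l p m t d r)
      = comb l 0 0 (fun i => l i ^ 2 * d i) (fun i => -t i) (fun _ _ => 0) := by
  rw [lie_comb]
  simp [lie_self, lie_swap Kminus Kplus, lie_Kplus_Kminus, lie_Kminus_Ktr,
    lie_Kminus_Kdual, lie_Kminus_Krot, comb, smul_smul, mul_comm]
  abel

/-! ### Commutators of generators with linear combinations. -/

section
variable (l : Fin 9 → ℂ) (p m : ℂ) (t d : Fin 9 → ℂ) {r : Fin 9 → Fin 9 → ℂ}

/-- Skewness makes the two Kronecker terms equal, which absorbs the factor 1/2. -/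
theorem sum_skew_smul (hs : ∀ a b, r b a = -r a b) (i : Fin 9) (K : Fin 9 → VField) :
    (1 / 2 : ℂ) • ∑ a, ∑ b, r a b • ((if i = b then (1 : ℂ) else 0) • K a
      - (if i = a then (1 : ℂ) else 0) • K b) = ∑ k, -r i k • K k := by
  simp only [smul_sub, Finset.sum_sub_distrib, ite_smul, one_smul, zero_smul, smul_ite, smul_zero,
    Finset.sum_ite_eq, Finset.mem_univ, if_true]
  rw [Finset.sum_comm (f := fun a b => if i = a then r a b • K b else 0)]
  simp only [Finset.sum_ite_eq, Finset.mem_univ, if_true, hs i, neg_smul, Finset.sum_neg_distrib]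
  module

theorem lie_Ktr_comb (hl : ∀ a b, l a ≠ l b → r a b = 0) (hs : ∀ a b, r b a = -r a b) (i : Fin 9) :
    lie (Ktr l i) (comb l p m t d r)
      = comb l (-(l i ^ 2 * d i)) 0 (fun k => -r i k) (fun k => if i = k then m else 0)
        (fun _ _ => 0) := by
  have hr : ∀ a b, r a b • lie (Ktr l i) (Krot a b)
      = r a b • ((if i = b then (1 : ℂ) else 0) • Ktr l a
        - (if i = a then (1 : ℂ) else 0) • Ktr l b) := fun a b => by
    by_cases h : l a = l b
    · rw [lie_swap, lie_Krot_Ktr l h, neg_sub]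
    · rw [hl a b h, zero_smul, zero_smul]
  have h1 : ∑ k, d k • lie (Ktr l i) (Kdual l k) = (-(l i ^ 2 * d i)) • Kplus := by
    simp only [lie_Ktr_Kdual, ite_smul, zero_smul, smul_ite, smul_zero, Finset.sum_ite_eq,
      Finset.mem_univ, if_true, smul_smul]
    congr 1
    ring
  rw [lie_comb, lie_swap _ Kplus, lie_Kplus_Ktr, lie_swap _ Kminus, lie_Kminus_Ktr, h1]
  simp only [hr, sum_skew_smul hs i]
  simp [comb, lie_Ktr_Ktr]
  abel

theorem lie_Kdual_comb (hl : ∀ a b, l a ≠ l b → r a b = 0) (hs : ∀ a b, r b a = -r a b)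
    (i : Fin 9) :
    lie (Kdual l i) (comb l p m t d r)
      = comb l (l i ^ 2 * t i) 0 (fun k => if i = k then -(l i ^ 2 * m) else 0) (fun k => -r i k)
        (fun _ _ => 0) := by
  have hr : ∀ a b, r a b • lie (Kdual l i) (Krot a b)
      = r a b • ((if i = b then (1 : ℂ) else 0) • Kdual l a
        - (if i = a then (1 : ℂ) else 0) • Kdual l b) := fun a b => by
    by_cases h : l a = l b
    · rw [lie_swap, lie_Krot_Kdual l h, neg_sub]
    · rw [hl a b h, zero_smul, zero_smul]
  have h1 : ∑ k, t k • lie (Kdual l i) (Ktr l k) = (l i ^ 2 * t i) • Kplus := by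
    have : ∀ k, lie (Kdual l i) (Ktr l k) = (if i = k then l k ^ 2 else 0) • Kplus := fun k => by
      rw [lie_swap, lie_Ktr_Kdual, ← neg_smul]
      by_cases h : i = k
      · simp [h]
      · simp [h, Ne.symm h]
    simp only [this, ite_smul, zero_smul, smul_ite, smul_zero, Finset.sum_ite_eq,
      Finset.mem_univ, if_true, smul_smul]
    rw [mul_comm]
  rw [lie_comb, lie_swap _ Kplus, lie_Kplus_Kdual, lie_swap _ Kminus, lie_Kminus_Kdual, h1]
  simp only [hr, sum_skew_smul hs i]
  simp [comb, lie_Kdual_Kdual, smul_smul, mul_comm]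
  abel

theorem lie_Krot_comb {i j : Fin 9} (hij : l i = l j) :
    lie (Krot i j) (comb l p m t d r)
      = comb l 0 0 (fun k => (if k = j then t i else 0) - if k = i then t j else 0)
        (fun k => (if k = j then d i else 0) - if k = i then d j else 0)
        (fun a b => (if b = j then r a i else 0) - (if a = i then r j b else 0)
          + (if a = j then r i b else 0) - (if b = i then r a j else 0)) := by
  have h1 : ∑ a, ∑ b, r a b • lie (Krot i j) (Krot a b) = ∑ a, ∑ b, ((if b = j then r a i else 0)
      - (if a = i then r j b else 0) + (if a = j then r i b else 0)
      - (if b = i then r a j else 0)) • Krot a b := by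
    simp only [lie_Krot_Krot, sub_smul, add_smul, smul_add, Finset.sum_add_distrib,
      Finset.sum_sub_distrib, ite_smul, one_smul, zero_smul, smul_ite, smul_zero, Finset.sum_ite_eq,
      Finset.sum_ite_eq', Finset.mem_univ, if_true]
    rw [Finset.sum_comm (f := fun a b => if i = a then r a b • Krot j b else 0),
      Finset.sum_comm (f := fun a b => if j = a then r a b • Krot b i else 0),
      Finset.sum_comm (f := fun a b => if a = i then r j b • Krot a b else 0),
      Finset.sum_comm (f := fun a b => if a = j then r i b • Krot a b else 0)]
    simp only [Finset.sum_ite_eq, Finset.sum_ite_eq', Finset.mem_univ, if_true, Krot_swap i,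
      smul_neg, Finset.sum_neg_distrib]
    abel
  have h2 : ∀ (c : Fin 9 → ℂ) (K : Fin 9 → VField),
      ∑ k, c k • ((if k = i then (1 : ℂ) else 0) • K j - (if k = j then (1 : ℂ) else 0) • K i)
        = ∑ k, ((if k = j then c i else 0) - if k = i then c j else 0) • K k := fun c K => by
    simp [smul_sub, sub_smul, Finset.sum_sub_distrib, smul_smul]
  rw [lie_comb, h1, lie_swap _ Kplus, lie_Kplus_Krot, lie_swap _ Kminus, lie_Kminus_Krot]
  simp only [lie_Krot_Ktr l hij, lie_Krot_Kdual l hij, h2]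
  simp [comb]

end

/-! ## The bracket of spinors -/

/-- The pair of signs (eps, del) takes four different values on the four blocks. -/
theorem eps_or_del_of_block_ne {i j : Fin 9} (h : block i ≠ block j) :
    eps i * eps j = -1 ∨ del i * del j = -1 := by
  simp only [eps, del]
  generalize block i = a at *
  generalize block j = b at *
  fin_cases a <;> fin_cases b <;> simp at h ⊢

section
variable {ρ : SpinRep S} {C : LinearMap.BilinForm ℂ S} (hC : IsChargeConjugation ρ C)

include hC

theorem C_gam123 (φ ψ : S) : C (gam123 ρ φ) ψ = C φ (gam123 ρ ψ) := by
  simp [gam123, hC.gam_skew, tr_tr_of_lt]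

theorem C_gam1245 (φ ψ : S) : C (gam1245 ρ φ) ψ = C φ (gam1245 ρ ψ) := by
  simp +decide [gam1245, hC.gam_skew, tr_tr_of_lt]

/-- If A is self-adjoint for the skew form C, then C(·, A·) is again skew. This is the source of the
vanishing statements that follow. -/
theorem C_apply_self_eq_zero {A : Module.End ℂ S} (hA : ∀ φ ψ, C (A φ) ψ = C φ (A ψ)) (φ : S) :
    C φ (A φ) = 0 := by
  have h := hC.skew φ (A φ)
  rw [hA] at h
  exact self_eq_neg.1 h

theorem C_pl_tr_tr {i j : Fin 9} (hij : i ≠ j) (φ : S) :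
    C φ (gam ρ pl (gam ρ (tr i) (gam ρ (tr j) φ))) = 0 :=
  C_apply_self_eq_zero hC (A := gam ρ pl * gam ρ (tr i) * gam ρ (tr j))
    (fun φ ψ => by simp [hC.gam_skew, tr_tr ρ hij.symm]) φ

theorem C_pl_gam123 (φ : S) : C φ (gam ρ pl (gam123 ρ φ)) = 0 :=
  C_apply_self_eq_zero hC (A := gam ρ pl * gam123 ρ)
    (fun φ ψ => by simp [hC.gam_skew, C_gam123 hC]) φ

theorem C_mi_gam123 (φ : S) : C φ (gam ρ mi (gam123 ρ φ)) = 0 :=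
  C_apply_self_eq_zero hC (A := gam ρ mi * gam123 ρ)
    (fun φ ψ => by simp [hC.gam_skew, C_gam123 hC]) φ

theorem C_mi_gam123_gam1245 (φ : S) : C φ (gam ρ mi (gam123 ρ (gam1245 ρ φ))) = 0 :=
  C_apply_self_eq_zero hC (A := gam ρ mi * gam123 ρ * gam1245 ρ)
    (fun φ ψ => by simp [hC.gam_skew, C_gam123 hC, C_gam1245 hC]) φ

theorem C_gam_symm (A : Ix) (φ ψ : S) : C φ (gam ρ A ψ) = C ψ (gam ρ A φ) := by
  rw [hC.skew, hC.gam_skew, neg_neg]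

theorem C_gam123_tr_symm (i : Fin 9) (φ ψ : S) :
    C φ (gam123 ρ (gam ρ (tr i) ψ)) = eps i * C ψ (gam123 ρ (gam ρ (tr i) φ)) := by
  rw [hC.skew]
  simp [hC.gam_skew, C_gam123 hC]

theorem C_rot_symm {i j : Fin 9} (hij : i ≠ j) (φ ψ : S) :
    C φ (gam ρ pl (gam123 ρ (gam ρ (tr i) (gam ρ (tr j) ψ))))
      = eps i * eps j * C ψ (gam ρ pl (gam123 ρ (gam ρ (tr i) (gam ρ (tr j) φ)))) := by
  rw [hC.skew]
  simp [hC.gam_skew, C_gam123 hC, tr_tr ρ hij.symm]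
  ring

/-- If the `eps` signs differ, the form is skew. Otherwise Γ_iΓ_j anticommutes with Γ_1245, which is
self-adjoint and fixes φ. Hence no rotations between different blocks are needed. -/
theorem C_rot_eq_zero {i j : Fin 9} (h : block i ≠ block j) {φ : S} (hφ : gam1245 ρ φ = φ) :
    C φ (gam ρ pl (gam123 ρ (gam ρ (tr i) (gam ρ (tr j) φ)))) = 0 := by
  have hij : i ≠ j := fun e => h (by rw [e])
  rcases eps_or_del_of_block_ne h with he | hd
  · have := C_rot_symm hC hij φ φ
    rw [he, neg_one_mul] at this
    exact self_eq_neg.1 this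
  · have h1 := C_gam1245 hC φ (gam ρ pl (gam123 ρ (gam ρ (tr i) (gam ρ (tr j) φ))))
    simp [hφ] at h1
    rw [← mul_assoc, hd, neg_one_mul] at h1
    exact self_eq_neg.1 h1

end

section
variable (ρ : SpinRep S) (C : LinearMap.BilinForm ℂ S) (l : Fin 9 → ℂ)

/-- The rotational components of the bracket. -/
def rotForm (φ ψ : S) (i j : Fin 9) : ℂ :=
  if block i = block j ∧ i ≠ j then
    -(Complex.I * l i * eps i) * C φ (gam ρ pl (gam123 ρ (gam ρ (tr i) (gam ρ (tr j) ψ))))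
  else 0

/-- The bracket in terms of the components `φ₁`, `ψ₁` in `S_-` and `φ₂`, `ψ₂` in `S_+`. -/
def bracketPair (φ₁ φ₂ ψ₁ ψ₂ : S) : VField :=
  comb l (C φ₁ (gam ρ mi ψ₁)) (C φ₂ (gam ρ pl ψ₂))
    (fun i => C φ₁ (gam ρ (tr i) ψ₂) + C ψ₁ (gam ρ (tr i) φ₂))
    (fun i => Complex.I / l i * (C φ₁ (gam123 ρ (gam ρ (tr i) ψ₂))
      + C ψ₁ (gam123 ρ (gam ρ (tr i) φ₂))))
    (rotForm ρ C l φ₂ ψ₂)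

end

/-! ### Compatibility of the bracket with the generators. -/

section
variable {ρ : SpinRep S} {C : LinearMap.BilinForm ℂ S} (hC : IsChargeConjugation ρ C)
  {ap am ap' : ℂ} {φ₁ φ₂ : S}

theorem rotForm_of_block_ne {l : Fin 9 → ℂ} {i j : Fin 9} (h : block i ≠ block j) (φ ψ : S) :
    rotForm ρ C l φ ψ i j = 0 :=
  if_neg fun h' => h h'.1

theorem rotForm_self_index {l : Fin 9 → ℂ} (i : Fin 9) (φ ψ : S) :
    rotForm ρ C l φ ψ i i = 0 :=
  if_neg fun h => h.2 rfl

theorem rotForm_eq {l : Fin 9 → ℂ} {i j : Fin 9} (h : block i = block j) (hij : i ≠ j)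
    (φ ψ : S) : rotForm ρ C l φ ψ i j = -(Complex.I * l i * eps i)
      * C φ (gam ρ pl (gam123 ρ (gam ρ (tr i) (gam ρ (tr j) ψ)))) :=
  if_pos ⟨h, hij⟩

theorem rotForm_skew (φ ψ : S) (i j : Fin 9) :
    rotForm ρ C (lam ap am ap') φ ψ j i = -rotForm ρ C (lam ap am ap') φ ψ i j := by
  by_cases hij : i = j
  · subst hij
    rw [rotForm_self_index, neg_zero]
  · by_cases h : block i = block j
    · rw [rotForm_eq h hij, rotForm_eq h.symm (Ne.symm hij), tr_tr ρ (Ne.symm hij),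
        lam_eq_of_block ap am ap' h, eps_eq_of_block h]
      simp
    · rw [rotForm_of_block_ne h, rotForm_of_block_ne (Ne.symm h), neg_zero]

include hC

theorem rotForm_symm {l : Fin 9 → ℂ} (φ ψ : S) (i j : Fin 9) :
    rotForm ρ C l φ ψ i j = rotForm ρ C l ψ φ i j := by
  by_cases h : block i = block j ∧ i ≠ j
  · rw [rotForm_eq h.1 h.2, rotForm_eq h.1 h.2, C_rot_symm hC h.2, eps_eq_of_block h.1, eps_sq,
      one_mul]
  · rw [rotForm, rotForm, if_neg h, if_neg h]

theorem rotForm_self {l : Fin 9 → ℂ} (hφ : gam1245 ρ φ₂ = φ₂) (i j : Fin 9) :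
    rotForm ρ C l φ₂ φ₂ i j = -(Complex.I * l i * eps i)
      * C φ₂ (gam ρ pl (gam123 ρ (gam ρ (tr i) (gam ρ (tr j) φ₂)))) := by
  by_cases h : block i = block j
  · by_cases hij : i = j
    · subst hij
      simp [rotForm_self_index, C_pl_gam123 hC]
    · exact rotForm_eq h hij φ₂ φ₂
  · rw [rotForm_of_block_ne h, C_rot_eq_zero hC h hφ, mul_zero]

/-- The S_+ component of the Lie derivative is zero. The coefficients of the K_(k) then reproduce
the rotational part, also for k outside the block of i, where both sides vanish; the K_(k*) with k ≠
i drop out and k = i gives the K_(-) coefficient. -/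
theorem bracketPair_Ktr (hp : gam ρ pl φ₁ = 0) (hH : gam1245 ρ φ₂ = φ₂) (i : Fin 9) :
    (2 : ℂ) • bracketPair ρ C (lam ap am ap')
        ((mu ap am ap' i / 2) • gam ρ pl (gam123 ρ (gam ρ (tr i) φ₂))) 0 φ₁ φ₂
      = lie (Ktr (lam ap am ap') i) (bracketPair ρ C (lam ap am ap') φ₁ φ₂ φ₁ φ₂) := by
  rw [bracketPair, comb_smul, bracketPair, lie_Ktr_comb _ _ _ _ _ (fun a b h =>
    rotForm_of_block_ne (fun e => h (lam_eq_of_block ap am ap' e)) _ _) (rotForm_skew _ _)]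
  have hmu := mu_eq_I_mul_lam ap am ap'
  have hp' : gam ρ pl (gam ρ mi φ₁) = -(2 : ℂ) • φ₁ := by
    have := mi_pl ρ φ₁
    rw [hp, map_zero, eq_comm, sub_eq_zero] at this
    exact this.symm
  refine comb_congr ?_ ?_ (fun k => ?_) (fun k hk => ?_) (fun a b => ?_)
  · simp [hC.gam_skew, C_gam123 hC, hp', hmu]
    rw [C_gam123_tr_symm hC i φ₂ φ₁]
    by_cases h0 : lam ap am ap' i = 0
    · simp [h0]
    · field_simp
      linear_combination (2 * C φ₁ (gam123 ρ (gam ρ (tr i) φ₂))) * eps_sq i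
  · simp
  · simp [rotForm_self hC hH, hC.gam_skew, C_gam123 hC, hmu]
    ring
  · simp [hC.gam_skew, C_gam123 hC, hmu]
    by_cases hik : i = k
    · subst hik
      simp
      field_simp
      simp
    · simp [hik, C_pl_tr_tr hC hik]
  · simp [rotForm]

theorem bracketPair_Kdual (hp : gam ρ pl φ₁ = 0) (hH : gam1245 ρ φ₂ = φ₂) (i : Fin 9) :
    (2 : ℂ) • bracketPair ρ C (lam ap am ap')
        ((mu ap am ap' i ^ 2 / 2) • gam ρ pl (gam ρ (tr i) φ₂)) 0 φ₁ φ₂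
      = lie (Kdual (lam ap am ap') i) (bracketPair ρ C (lam ap am ap') φ₁ φ₂ φ₁ φ₂) := by
  rw [bracketPair, comb_smul, bracketPair, lie_Kdual_comb _ _ _ _ _ (fun a b h =>
    rotForm_of_block_ne (fun e => h (lam_eq_of_block ap am ap' e)) _ _) (rotForm_skew _ _)]
  have hmu : mu ap am ap' i ^ 2 = -lam ap am ap' i ^ 2 := by rw [lam_sq, neg_neg]
  have hp' : gam ρ pl (gam ρ mi φ₁) = -(2 : ℂ) • φ₁ := by
    have := mi_pl ρ φ₁
    rw [hp, map_zero, eq_comm, sub_eq_zero] at this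
    exact this.symm
  refine comb_congr ?_ ?_ (fun k => ?_) (fun k hk => ?_) (fun a b => ?_)
  · simp [hC.gam_skew, hp', hmu]
    rw [C_gam_symm hC _ φ₂ φ₁]
    ring
  · simp
  · simp [hC.gam_skew, hmu]
    by_cases hik : i = k
    · subst hik
      simp
      ring
    · simp [hik, C_pl_tr_tr hC hik]
  · simp [hC.gam_skew, C_gam123 hC, hmu, rotForm_self hC hH]
    -- Within a block λ_k = λ_i cancels the denominator; between blocks the form itself vanishes.
    by_cases h : block i = block k
    · rw [← lam_eq_of_block ap am ap' h] at hk ⊢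
      field_simp
    · simp [C_rot_eq_zero hC h hH]
  · simp [rotForm]

theorem bracketPair_Kminus (hH : gam1245 ρ φ₂ = φ₂) :
    (2 : ℂ) • bracketPair ρ C (lam ap am ap') (cElt ρ ap am φ₁) (-dElt ρ ap' φ₂) φ₁ φ₂
      = lie Kminus (bracketPair ρ C (lam ap am ap') φ₁ φ₂ φ₁ φ₂) := by
  rw [bracketPair, comb_smul, bracketPair, lie_Kminus_comb]
  have hmu := mu_eq_I_mul_lam ap am ap'
  have h1 : ∀ k, eps k = 1 ∨ eps k = -1 := fun k => mul_self_eq_one_iff.1 (eps_sq k)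
  have h2 : ∀ k, del k = 1 ∨ del k = -1 := fun k => mul_self_eq_one_iff.1 (del_sq k)
  refine comb_congr ?_ ?_ (fun k => ?_) (fun k hk => ?_) (fun a b => ?_)
  · simp [cElt_apply, C_gam123 hC, C_gam1245 hC, C_mi_gam123 hC, C_mi_gam123_gam1245 hC]
  · simp [dElt_apply, hH, C_gam123 hC, C_pl_gam123 hC]
  · have : lam ap am ap' k ^ 2 * (Complex.I / lam ap am ap' k
        * (C φ₁ (gam123 ρ (gam ρ (tr k) φ₂)) + C φ₁ (gam123 ρ (gam ρ (tr k) φ₂))))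
        = 2 * mu ap am ap' k * C φ₁ (gam123 ρ (gam ρ (tr k) φ₂)) := by
      rw [hmu]
      -- For λ_k = 0 both sides are zero, since μ_k = iλ_k.
      by_cases h0 : lam ap am ap' k = 0
      · simp [h0]
      · field_simp
        ring
    rw [this, mu_eq]
    simp [cElt_apply, dElt_apply, hH, C_gam123 hC, C_gam1245 hC]
    rcases h1 k with h1 | h1 <;> rcases h2 k with h2 | h2 <;> simp [h1, h2] <;> ring
  · have : -(C φ₁ (gam ρ (tr k) φ₂) + C φ₁ (gam ρ (tr k) φ₂))
        = 2 * (Complex.I / lam ap am ap' k * (mu ap am ap' k * C φ₁ (gam ρ (tr k) φ₂))) := by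
      have hI : Complex.I / lam ap am ap' k * mu ap am ap' k = -1 := by
        rw [hmu]
        field_simp
        simp
      linear_combination (-2 * C φ₁ (gam ρ (tr k) φ₂)) * hI
    rw [this, mu_eq]
    simp [cElt_apply, dElt_apply, hH, C_gam123 hC, C_gam1245 hC]
    rcases h1 k with h1 | h1 <;> rcases h2 k with h2 | h2 <;> simp [h1, h2] <;>
      exact Or.inl (by ring)
  · by_cases h : block a = block b ∧ a ≠ b
    · rw [rotForm_eq h.1 h.2]
      simp [dElt_apply, hH, C_gam123 hC, C_pl_tr_tr hC h.2]
    · rw [rotForm, if_neg h, mul_zero]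

/-- Rotational invariance: R is skew for C, commutes with Γ_± and Γ_123, and rotates the Γ_k, so
every coefficient transforms as a tensor. -/
theorem bracketPair_Krot (hH : gam1245 ρ φ₂ = φ₂) {i j : Fin 9} (hij : block i = block j) :
    (2 : ℂ) • bracketPair ρ C (lam ap am ap')
        ((1 / 2 : ℂ) • (gam ρ (tr i) (gam ρ (tr j) φ₁) + (if i = j then (1 : ℂ) else 0) • φ₁))
        ((1 / 2 : ℂ) • (gam ρ (tr i) (gam ρ (tr j) φ₂) + (if i = j then (1 : ℂ) else 0) • φ₂)) φ₁ φ₂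
      = lie (Krot i j) (bracketPair ρ C (lam ap am ap') φ₁ φ₂ φ₁ φ₂) := by
  obtain ⟨z, hz⟩ : ∃ z : ℂ, z = if i = j then 1 else 0 := ⟨_, rfl⟩
  rw [← hz]
  set R : Module.End ℂ S := (1 / 2 : ℂ) • (gam ρ (tr i) * gam ρ (tr j) + z • 1) with hR
  have hl := lam_eq_of_block ap am ap' hij
  have hRa : ∀ φ, (1 / 2 : ℂ) • (gam ρ (tr i) (gam ρ (tr j) φ) + z • φ) = R φ := fun φ => by
    simp [hR]
  have hCR : ∀ φ ψ, C (R φ) ψ = -C φ (R ψ) := fun φ ψ => by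
    by_cases e : i = j
    · subst e
      simp [hR, hz]
    · simp [hR, hz, hC.gam_skew, e, tr_tr ρ (Ne.symm e)]
  have hRp : ∀ φ, R (gam ρ pl φ) = gam ρ pl (R φ) := fun φ => by simp [hR]
  have hRm : ∀ φ, R (gam ρ mi φ) = gam ρ mi (R φ) := fun φ => by simp [hR, tr_mi]
  have hRG : ∀ φ, R (gam123 ρ φ) = gam123 ρ (R φ) := fun φ => by
    simp only [hR, LinearMap.smul_apply, LinearMap.add_apply, Module.End.mul_apply,
      Module.End.one_apply, rot_gam123 ρ hij, map_smul, map_add]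
  have hRt : ∀ k φ, R (gam ρ (tr k) φ) = gam ρ (tr k) (R φ)
      + (if k = i then (1 : ℂ) else 0) • gam ρ (tr j) φ
      - (if k = j then (1 : ℂ) else 0) • gam ρ (tr i) φ := fun k φ => by
    simp only [hR, LinearMap.smul_apply, LinearMap.add_apply, Module.End.mul_apply,
      Module.End.one_apply, rot_tr ρ i j k, map_smul, map_add]
    split_ifs <;> module
  rw [hRa, hRa, bracketPair, comb_smul, bracketPair, lie_Krot_comb _ _ _ _ _ hl]
  refine comb_congr ?_ ?_ (fun k => ?_) (fun k hk => ?_) (fun a b => ?_)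
  · rw [self_eq_neg.1 ((hCR φ₁ (gam ρ mi φ₁)).trans (by rw [hRm, C_gam_symm hC])), mul_zero]
  · rw [self_eq_neg.1 ((hCR φ₂ (gam ρ pl φ₂)).trans (by rw [hRp, C_gam_symm hC])), mul_zero]
  · rw [hCR, hRt]
    simp only [map_add, map_sub, map_smul, smul_eq_mul]
    split_ifs <;> ring
  · rw [hCR, hRG, hRt, hl]
    simp only [map_add, map_sub, map_smul, smul_eq_mul]
    by_cases hkj : k = j
    · subst hkj
      split_ifs <;> ring
    · by_cases hki : k = i
      · subst hki
        simp only [hkj, hl, if_true, if_false]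
        ring
      · simp only [hkj, hki, if_false]
        ring
  · by_cases h : block a = block b
    · by_cases hab : a = b
      · subst hab
        rw [rotForm_self_index]
        rw [rotForm_skew φ₂ φ₂ a j, rotForm_skew φ₂ φ₂ a i]
        split_ifs <;> ring
      -- Within a block the rotational form is symmetric, so its two variations under R agree;
      -- skewness of R then expresses twice this variation through rotated indices.
      · have hs : C (R φ₂) (gam ρ pl (gam123 ρ (gam ρ (tr a) (gam ρ (tr b) φ₂))))
            = C φ₂ (gam ρ pl (gam123 ρ (gam ρ (tr a) (gam ρ (tr b) (R φ₂))))) := by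
          rw [C_rot_symm hC hab, eps_eq_of_block h, eps_sq, one_mul]
        have hs' := hCR φ₂ (gam ρ pl (gam123 ρ (gam ρ (tr a) (gam ρ (tr b) φ₂))))
        rw [hRp, hRG, hRt a, hRt b] at hs'
        simp only [map_add, map_sub, map_smul, smul_eq_mul, ← hs] at hs'
        have e : ∀ k m, block k = block a → rotForm ρ C (lam ap am ap') φ₂ φ₂ k m
            = -(Complex.I * lam ap am ap' a * eps a)
              * C φ₂ (gam ρ pl (gam123 ρ (gam ρ (tr k) (gam ρ (tr m) φ₂)))) := fun k m hk => by
          rw [rotForm_self hC hH, lam_eq_of_block ap am ap' hk, eps_eq_of_block hk]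
        have f2 : ∀ (p : Prop) [Decidable p] k m, (p → block k = block a) →
            (if p then rotForm ρ C (lam ap am ap') φ₂ φ₂ k m else 0)
              = (if p then 1 else 0) * (-(Complex.I * lam ap am ap' a * eps a)
                * C φ₂ (gam ρ pl (gam123 ρ (gam ρ (tr k) (gam ρ (tr m) φ₂))))) := by
          intro p _ k m hp
          by_cases h' : p
          · rw [if_pos h', if_pos h', e k m (hp h'), one_mul]
          · rw [if_neg h', if_neg h', zero_mul]
        rw [rotForm_eq h hab, f2 _ a i fun _ => rfl, f2 _ j b fun e' => by rw [e', hij],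
          f2 _ i b fun e' => by rw [e', hij], f2 _ a j fun _ => rfl]
        linear_combination (-(Complex.I * lam ap am ap' a * eps a)) * hs'
    · rw [rotForm_of_block_ne h, mul_zero]
      have e1 : b = j → rotForm ρ C (lam ap am ap') φ₂ φ₂ a i = 0 := fun e =>
        rotForm_of_block_ne (fun e' => h (by rw [e', hij, e])) _ _
      have e2 : a = i → rotForm ρ C (lam ap am ap') φ₂ φ₂ j b = 0 := fun e =>
        rotForm_of_block_ne (fun e' => h (by rw [← e', e, hij])) _ _
      have e3 : a = j → rotForm ρ C (lam ap am ap') φ₂ φ₂ i b = 0 := fun e =>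
        rotForm_of_block_ne (fun e' => h (by rw [← e', e, hij])) _ _
      have e4 : b = i → rotForm ρ C (lam ap am ap') φ₂ φ₂ a j = 0 := fun e =>
        rotForm_of_block_ne (fun e' => h (by rw [e', ← hij, e])) _ _
      rw [ite_eq_right_iff.2 e1, ite_eq_right_iff.2 e2, ite_eq_right_iff.2 e3,
        ite_eq_right_iff.2 e4]
      ring

end

section
variable (ρ : SpinRep S) (C : LinearMap.BilinForm ℂ S) (l : Fin 9 → ℂ)

/-- The symmetric bracket of spinors with values in the vector fields. -/
def spinBracket (φ ψ : S) : VField :=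
  bracketPair ρ C l (sigMinus ρ φ) (sigPlus ρ φ) (sigMinus ρ ψ) (sigPlus ρ ψ)

theorem spinBracket_add_left (φ φ' ψ : S) :
    spinBracket ρ C l (φ + φ') ψ = spinBracket ρ C l φ ψ + spinBracket ρ C l φ' ψ := by
  simp only [spinBracket, bracketPair, comb_add]
  refine comb_congr ?_ ?_ (fun i => ?_) (fun i _ => ?_) (fun i j => ?_)
  · simp
  · simp
  · simp; ring
  · simp; ring
  · simp only [rotForm]
    split_ifs <;> simp
    ring

theorem spinBracket_smul_left (z : ℂ) (φ ψ : S) :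
    spinBracket ρ C l (z • φ) ψ = z • spinBracket ρ C l φ ψ := by
  simp only [spinBracket, bracketPair, comb_smul]
  refine comb_congr ?_ ?_ (fun i => ?_) (fun i _ => ?_) (fun i j => ?_)
  · simp
  · simp
  · simp; ring
  · simp; ring
  · simp only [rotForm]
    split_ifs <;> simp
    ring

theorem spinBracket_mem (φ ψ : S) :
    spinBracket ρ C l φ ψ ∈ Submodule.span ℂ (gens l) :=
  comb_mem l _ _ _ _ fun _ _ h => rotForm_of_block_ne h _ _

theorem spinBracket_symm {C : LinearMap.BilinForm ℂ S} (hC : IsChargeConjugation ρ C) (φ ψ : S) :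
    spinBracket ρ C l φ ψ = spinBracket ρ C l ψ φ := by
  simp only [spinBracket, bracketPair]
  exact comb_congr (C_gam_symm hC _ _ _) (C_gam_symm hC _ _ _) (fun i => add_comm _ _)
    (fun i _ => by rw [add_comm]) (fun i j => rotForm_symm hC _ _ _ _)

theorem spinBracket_add_right {C : LinearMap.BilinForm ℂ S} (hC : IsChargeConjugation ρ C)
    (φ ψ ψ' : S) :
    spinBracket ρ C l φ (ψ + ψ') = spinBracket ρ C l φ ψ + spinBracket ρ C l φ ψ' := by
  simp only [spinBracket_symm ρ l hC φ, spinBracket_add_left]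

theorem spinBracket_smul_right {C : LinearMap.BilinForm ℂ S} (hC : IsChargeConjugation ρ C)
    (z : ℂ) (φ ψ : S) : spinBracket ρ C l φ (z • ψ) = z • spinBracket ρ C l φ ψ := by
  simp only [spinBracket_symm ρ l hC φ, spinBracket_smul_left]

/-- The uniform sign -`eps i` matches the stated formulas: Γ_123Γ_1Γ_2 = -Γ_3 in the first block,
and eps = -1 in the last two. -/
theorem rotForm_eq_rotCoeff (ap am ap' : ℂ) (φ : S) (i j : Fin 9) :
    rotForm ρ C (lam ap am ap') φ φ i j = rotCoeff ρ C (lam ap am ap') φ i j := by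
  have h0 : lam ap am ap' 1 = lam ap am ap' 0 := lam_eq_of_block ap am ap' rfl
  have h3 : lam ap am ap' 4 = lam ap am ap' 3 := lam_eq_of_block ap am ap' rfl
  have h6 : lam ap am ap' 6 = lam ap am ap' 5 := lam_eq_of_block ap am ap' rfl
  have h7 : lam ap am ap' 7 = lam ap am ap' 5 := lam_eq_of_block ap am ap' rfl
  have h8 : lam ap am ap' 8 = lam ap am ap' 5 := lam_eq_of_block ap am ap' rfl
  by_cases h : block i = block j ∧ i ≠ j
  · rw [rotForm_eq h.1 h.2]
    fin_cases i <;> fin_cases j <;> simp [block] at h <;>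
      simp +decide [rotCoeff, eps, block, h0, h3, h6, h7, h8, gam123, tr_tr_of_lt, tr_self]
  · rw [rotForm, if_neg h]
    fin_cases i <;> fin_cases j <;> simp [block] at h <;> simp +decide [rotCoeff]

theorem bracketField_eq (ap am ap' : ℂ) (ψ : S) :
    bracketField ρ C (lam ap am ap') ψ = spinBracket ρ C (lam ap am ap') ψ ψ := by
  refine (comb_congr rfl rfl (fun i => ?_) (fun i _ => ?_) (fun i j => ?_) :
    comb (lam ap am ap') _ _ _ _ _ = _)
  · ring
  · simp only [Module.End.mul_apply]
    ring
  · rw [rotForm_eq_rotCoeff]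

end

/-! ### Compatibility of the bracket with the whole even part. -/

section
variable {ρ : SpinRep S} {C : LinearMap.BilinForm ℂ S} (hC : IsChargeConjugation ρ C)
  {B : Fin 9 → ℝ} {ap am ap' : ℂ} {ξ : Pt → S}

theorem sigMinus_pl (ψ : S) : sigMinus ρ (gam ρ pl ψ) = gam ρ pl ψ := by
  simp [sigMinus_apply]

theorem sigPlus_pl (ψ : S) : sigPlus ρ (gam ρ pl ψ) = 0 := by
  simp [sigPlus_apply]

theorem pl_sigMinus (ψ : S) : gam ρ pl (sigMinus ρ ψ) = 0 := by
  simp [sigMinus_apply]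

theorem pl_gam123_tr_sigPlus (i : Fin 9) (ψ : S) :
    gam ρ pl (gam123 ρ (gam ρ (tr i) (sigPlus ρ ψ))) = gam ρ pl (gam123 ρ (gam ρ (tr i) ψ)) := by
  simp [sigPlus_apply, tr_mi, gam123_mi]

theorem pl_tr_sigPlus (i : Fin 9) (ψ : S) :
    gam ρ pl (gam ρ (tr i) (sigPlus ρ ψ)) = gam ρ pl (gam ρ (tr i) ψ) := by
  simp [sigPlus_apply, tr_mi]

theorem gam1245_sigPlus {ψ : S} (hψ : ψ ∈ initSpace ρ) :
    gam1245 ρ (sigPlus ρ ψ) = sigPlus ρ ψ := by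
  rw [initSpace, LinearMap.mem_ker, Module.End.mul_apply, projMinus_apply, smul_eq_zero,
    sub_eq_zero] at hψ
  exact (hψ.resolve_left (by norm_num)).symm

theorem sigMinus_connTerm_mi (ψ : S) :
    sigMinus ρ (-connTerm ρ (cElt ρ ap am) (dElt ρ ap') mi ψ) = cElt ρ ap am (sigMinus ρ ψ) := by
  simp [connTerm_mi, sigMinus_apply, cElt_apply, gam123_mi, gam1245_mi]
  module

theorem sigPlus_connTerm_mi (ψ : S) :
    sigPlus ρ (-connTerm ρ (cElt ρ ap am) (dElt ρ ap') mi ψ) = -dElt ρ ap' (sigPlus ρ ψ) := by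
  simp [connTerm_mi, sigPlus_apply, dElt_apply, gam123_mi, gam1245_mi]
  module

theorem sigMinus_rot (i j : Fin 9) (ψ : S) :
    sigMinus ρ (gam ρ (tr i) (gam ρ (tr j) ψ)) = gam ρ (tr i) (gam ρ (tr j) (sigMinus ρ ψ)) := by
  simp [sigMinus_apply, tr_mi]

theorem sigPlus_rot (i j : Fin 9) (ψ : S) :
    sigPlus ρ (gam ρ (tr i) (gam ρ (tr j) ψ)) = gam ρ (tr i) (gam ρ (tr j) (sigPlus ρ ψ)) := by
  simp [sigPlus_apply, tr_mi]

include hC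

/-- The bracket only sees initial values, on which the generators act explicitly; linearity in X
extends the four generator computations, K_(+) being central and acting by zero. -/
theorem spinBracket_compat [FiniteDimensional ℂ S]
    (hB : ∀ i, (B i : ℂ) = -(mu ap am ap' i) ^ 2) (hne : ∃ i, curvCoef B ap am i ≠ 0)
    (hξ : ξ ∈ parallelSpinors ρ B (cElt ρ ap am) (dElt ρ ap')) {X : VField}
    (hX : X ∈ Submodule.span ℂ (gens (lam ap am ap'))) :
    (2 : ℂ) • spinBracket ρ C (lam ap am ap') (spinLie ρ B X ξ 0) (ξ 0)
      = lie X (spinBracket ρ C (lam ap am ap') (ξ 0) (ξ 0)) := by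
  have hV := value_mem_initSpace ρ hB hne hξ
  have hH := gam1245_sigPlus (hV 0)
  have hp : gam ρ pl (sigMinus ρ (ξ 0)) = 0 := pl_sigMinus (ξ 0)
  have h0 : ∀ ψ, spinBracket ρ C (lam ap am ap') 0 ψ = 0 := fun ψ => by
    simpa using spinBracket_smul_left ρ C (lam ap am ap') 0 0 ψ
  induction hX using Submodule.span_induction with
  | mem X hX =>
    revert X
    refine gens_cases ?_ ?_ (fun i => ?_) (fun i => ?_) (fun i j h => ?_)
    · rw [spinLie_Kplus_zero ρ hξ, h0, smul_zero, spinBracket, bracketPair, lie_Kplus_comb]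
    · rw [spinLie_Kminus_zero ρ hξ, spinBracket, sigMinus_connTerm_mi, sigPlus_connTerm_mi,
        bracketPair_Kminus hC hH]
      rfl
    · rw [spinLie_Ktr_zero ρ hB hξ hV, spinBracket, map_smul, map_smul, sigMinus_pl, sigPlus_pl,
        smul_zero, ← pl_gam123_tr_sigPlus, bracketPair_Ktr hC hp hH]
      rfl
    · rw [spinLie_Kdual_zero ρ hB hξ hV, spinBracket, map_smul, map_smul, sigMinus_pl, sigPlus_pl,
        smul_zero, ← pl_tr_sigPlus, bracketPair_Kdual hC hp hH]
      rfl
    · rw [spinLie_Krot_zero ρ hB h, spinBracket, map_smul, map_smul, map_add, map_add, map_smul,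
        map_smul, sigMinus_rot, sigPlus_rot, bracketPair_Krot hC hH h]
      rfl
  | zero => rw [spinLie_zero, Pi.zero_apply, h0, smul_zero, lie_swap, lie_zero_right, neg_zero]
  | add X Y hX hY h1 h2 =>
    rw [spinLie_add ρ B (contDiff_of_mem hX) (contDiff_of_mem hY),
      lie_add_left _ (contDiff_of_mem hX) (contDiff_of_mem hY), Pi.add_apply,
      spinBracket_add_left, smul_add, h1, h2]
  | smul z X _ h =>
    rw [spinLie_smul, lie_smul_left, Pi.smul_apply, spinBracket_smul_left, smul_comm, h]

end

/-! ## The geometric superalgebra -/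

theorem gam123_injective (ρ : SpinRep S) : Function.Injective (gam123 ρ) := fun φ ψ h => by
  rw [← gam123_gam123 ρ φ, h, gam123_gam123]


section
variable (ρ : SpinRep S) {C : LinearMap.BilinForm ℂ S}
  {B : Fin 9 → ℝ} {ap am ap' : ℂ}

theorem contDiff_of_parallel {ρ : SpinRep S} {c d : Module.End ℂ S} {ξ : Pt → S}
    (hξ : ξ ∈ parallelSpinors ρ B c d) : ContDiff ℝ ∞ ξ :=
  hξ.1

/-- The action of the even part on the parallel spinors. -/
def spinLieMap [FiniteDimensional ℂ S] (hB : ∀ i, (B i : ℂ) = -(mu ap am ap' i) ^ 2)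
    (hne : ∃ i, curvCoef B ap am i ≠ 0) :
    Submodule.span ℂ (gens (lam ap am ap')) →ₗ[ℂ]
      Module.End ℂ (parallelSpinors ρ B (cElt ρ ap am) (dElt ρ ap')) :=
  LinearMap.mk₂ ℂ (fun X ξ => ⟨spinLie ρ B X.1 ξ.1, spinLie_mem ρ hB hne X.2 ξ.2⟩)
    (fun X Y ξ => by
      refine Subtype.ext ?_
      show spinLie ρ B (X.1 + Y.1) ξ.1 = spinLie ρ B X.1 ξ.1 + spinLie ρ B Y.1 ξ.1
      exact spinLie_add ρ B (contDiff_of_mem X.2) (contDiff_of_mem Y.2) ξ.1)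
    (fun z X ξ => by
      refine Subtype.ext ?_
      show spinLie ρ B (z • X.1) ξ.1 = z • spinLie ρ B X.1 ξ.1
      exact spinLie_smul ρ B z X.1 ξ.1)
    (fun X ξ η => by
      refine Subtype.ext ?_
      simp only [Submodule.coe_add]
      exact spinLie_spinor_add ρ B X.1 (contDiff_of_parallel ξ.2) (contDiff_of_parallel η.2))
    (fun z X ξ => by
      refine Subtype.ext ?_
      simp only [Submodule.coe_smul]
      exact spinLie_spinor_smul ρ B X.1 z ξ.1)

theorem coe_spinLieMap [FiniteDimensional ℂ S] (hB : ∀ i, (B i : ℂ) = -(mu ap am ap' i) ^ 2)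
    (hne : ∃ i, curvCoef B ap am i ≠ 0) (X : Submodule.span ℂ (gens (lam ap am ap')))
    (ξ : parallelSpinors ρ B (cElt ρ ap am) (dElt ρ ap')) :
    (spinLieMap ρ hB hne X ξ : Pt → S) = spinLie ρ B X.1 ξ.1 :=
  rfl

/-- The bracket of parallel spinors. -/
def spinBracketMap (hC : IsChargeConjugation ρ C) :
    parallelSpinors ρ B (cElt ρ ap am) (dElt ρ ap') →ₗ[ℂ]
      parallelSpinors ρ B (cElt ρ ap am) (dElt ρ ap') →ₗ[ℂ]
        Submodule.span ℂ (gens (lam ap am ap')) :=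
  LinearMap.mk₂ ℂ
    (fun ξ η => ⟨spinBracket ρ C (lam ap am ap') (ξ.1 0) (η.1 0), spinBracket_mem ρ C _ _ _⟩)
    (fun ξ ξ' η => Subtype.ext (spinBracket_add_left ρ C _ (ξ.1 0) (ξ'.1 0) (η.1 0)))
    (fun z ξ η => Subtype.ext (spinBracket_smul_left ρ C _ z (ξ.1 0) (η.1 0)))
    (fun ξ η η' => Subtype.ext (spinBracket_add_right ρ _ hC (ξ.1 0) (η.1 0) (η'.1 0)))
    (fun z ξ η => Subtype.ext (spinBracket_smul_right ρ _ hC z (ξ.1 0) (η.1 0)))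

/-- The geometric superalgebra with all parallel spinors as its odd part. -/
def superalgebra [FiniteDimensional ℂ S] (hC : IsChargeConjugation ρ C)
    (hB : ∀ i, (B i : ℂ) = -(mu ap am ap' i) ^ 2) (hne : ∃ i, curvCoef B ap am i ≠ 0) :
    GeometricSuperalgebra ρ B (cElt ρ ap am) (dElt ρ ap') where
  K0 := Submodule.span ℂ (gens (lam ap am ap'))
  killing _ hX := isKilling_of_mem hB hX
  lie_mem _ hX _ hY := lie_mem_span hX hY
  K1 := parallelSpinors ρ B (cElt ρ ap am) (dElt ρ ap')
  parallel := le_rfl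
  L := spinLieMap ρ hB hne
  L_eq _ _ := rfl
  L_lie X Y := LinearMap.ext fun ξ => by
    refine Subtype.ext ?_
    simp only [LinearMap.sub_apply, Module.End.mul_apply, Submodule.coe_sub, coe_spinLieMap]
    exact spinLie_comm ρ hB hne X.2 Y.2 ξ.2
  bracket := spinBracketMap ρ hC
  symm ξ η := Subtype.ext (spinBracket_symm ρ _ hC _ _)
  compat X ξ := spinBracket_compat hC hB hne ξ.2 X.2

/-- Parallel spinors correspond to their initial values. -/
def parallelEquiv [FiniteDimensional ℂ S] (hB : ∀ i, (B i : ℂ) = -(mu ap am ap' i) ^ 2)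
    (hne : ∃ i, curvCoef B ap am i ≠ 0) :
    parallelSpinors ρ B (cElt ρ ap am) (dElt ρ ap') ≃ₗ[ℂ] initSpace ρ :=
  LinearEquiv.ofBijective
    { toFun := fun ξ => ⟨ξ.1 0, value_mem_initSpace ρ hB hne ξ.2 0⟩
      map_add' := fun _ _ => rfl
      map_smul' := fun _ _ => rfl }
    ⟨fun ξ η h => Subtype.ext (sub_eq_zero.1 (parallel_eq_zero ρ (Submodule.sub_mem _ ξ.2 η.2)
        (sub_eq_zero.2 (congrArg Subtype.val h)))),
      fun ψ => ⟨⟨sol ρ ap am ap' ψ, sol_mem ρ hB ψ.2⟩, Subtype.ext (sol_zero ρ ap am ap' ψ)⟩⟩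

/-- On eigenvectors of Γ_1245, c is α_± Γ_123 and, for eigenvalue 1, d is α'_+ Γ_123; since Γ_123 is
injective, the scalars can be read off. -/
theorem param_injective [Nontrivial S] {bp bm bp' : ℂ} (hc : cElt ρ ap am = cElt ρ bp bm)
    (hd : dElt ρ ap' = dElt ρ bp') : ap = bp ∧ am = bm ∧ ap' = bp' := by
  obtain ⟨ψ, hψ, h⟩ := exists_gam1245_eq ρ
  obtain ⟨φ, hφ, h'⟩ := exists_gam1245_eq_neg ρ
  have key : ∀ {a b : ℂ} {v : S}, v ≠ 0 → a • gam123 ρ v = b • gam123 ρ v → a = b :=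
    fun hv e => smul_left_injective ℂ (fun e' => hv (gam123_injective ρ (by rw [e', map_zero]))) e
  refine ⟨key hψ ?_, key hφ ?_, key hψ ?_⟩
  · have := LinearMap.congr_fun hc ψ
    simp only [cElt_apply, h] at this
    calc ap • gam123 ρ ψ = _ := by module
      _ = _ := this
      _ = bp • gam123 ρ ψ := by module
  · have := LinearMap.congr_fun hc φ
    simp only [cElt_apply, h', map_neg] at this
    calc am • gam123 ρ φ = _ := by module
      _ = _ := this
      _ = bm • gam123 ρ φ := by module
  · have := LinearMap.congr_fun hd ψ
    simp only [dElt_apply, h] at this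
    calc ap' • gam123 ρ ψ = _ := by module
      _ = _ := this
      _ = bp' • gam123 ρ ψ := by module

end
end CahenWallach

end

open CahenWallach in
theorem proposition2 {S : Type*} [NormedAddCommGroup S] [NormedSpace ℂ S] [FiniteDimensional ℂ S]
    (ρ : SpinRep S) (hρ : IsIrreducible ρ)
    (C : LinearMap.BilinForm ℂ S) (hC : IsChargeConjugation ρ C) :
    -- different parameters give different connections
    (∀ ap am ap' bp bm bp' : ℂ, cElt ρ ap am = cElt ρ bp bm → dElt ρ ap' = dElt ρ bp' →
      ap = bp ∧ am = bm ∧ ap' = bp') ∧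
    ∀ (ap am ap' : ℂ) (B : Fin 9 → ℝ), (∀ i, (B i : ℂ) = -(mu ap am ap' i) ^ 2) →
      -- the members of the family with a flat connection
      (IsFlat ρ B (cElt ρ ap am) (dElt ρ ap') ↔ ap' = 0 ∧ ap ^ 2 = am ^ 2) ∧
      -- all others define a non-restricted geometric superalgebra with the given bracket
      (¬ IsFlat ρ B (cElt ρ ap am) (dElt ρ ap') →
        ∃ K : GeometricSuperalgebra ρ B (cElt ρ ap am) (dElt ρ ap'),
          K.K0 = killingSpan (lam ap am ap') (fun i j => block i = block j) ∧
          K.NonRestricted ∧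
          K.nu = 3 / 4 ∧
          Set.BijOn (fun ξ : Pt → S => ξ 0) K.K1 {ψ | projMinus ρ (sigPlus ρ ψ) = 0} ∧
          ∀ ξ : K.K1, (K.bracket ξ ξ : VField)
            = bracketField ρ C (lam ap am ap') ((ξ : Pt → S) 0)) ∧
      -- if the four blocks are the eigenspaces, all rotations of the eigenspaces are present
      ((∀ i j, B i = B j → block i = block j) →
        killingSpan (lam ap am ap') (fun i j => block i = block j)
          = killingSpan (lam ap am ap') (fun i j => B i = B j)) := by
  have : Nontrivial S := hρ.1
  refine ⟨fun ap am ap' bp bm bp' hc hd => param_injective ρ hc hd,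
    fun ap am ap' B hB => ⟨?_, ?_, ?_⟩⟩
  · rw [isFlat_iff_curvCoef ρ B ap am ap' hB, curvCoef_eq_zero_iff B ap am ap' hB]
  · intro hflat
    rw [isFlat_iff_curvCoef ρ B ap am ap' hB, not_forall] at hflat
    refine ⟨superalgebra ρ hC hB hflat, rfl, le_refl _, ?_, ⟨?_, ?_, ?_⟩, fun ξ => ?_⟩
    · have h1 := (parallelEquiv ρ hB hflat).finrank_eq
      have h2 := finrank_initSpace ρ
      have h3 : (0 : ℚ) < Module.finrank ℂ S := by exact_mod_cast Module.finrank_pos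
      change (Module.finrank ℂ (parallelSpinors ρ B (cElt ρ ap am) (dElt ρ ap')) : ℚ) / _ = _
      rw [h1, div_eq_div_iff h3.ne' (by norm_num)]
      have h4 : (4 : ℚ) * Module.finrank ℂ (initSpace ρ) = 3 * Module.finrank ℂ S := by
        exact_mod_cast h2
      linarith
    · intro ξ hξ
      exact value_mem_initSpace ρ hB hflat hξ 0
    · intro ξ hξ η hη h
      exact sub_eq_zero.1 (parallel_eq_zero ρ (Submodule.sub_mem _ hξ hη) (sub_eq_zero.2 h))
    · intro ψ hψ
      exact ⟨sol ρ ap am ap' ψ, sol_mem ρ hB hψ, sol_zero ρ ap am ap' ψ⟩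
    · exact (bracketField_eq ρ C ap am ap' _).symm
  · intro h
    have : (fun i j => block i = block j) = fun i j => B i = B j := by
      funext i j
      exact propext ⟨real_eq_of_block hB, h i j⟩
    rw [this]
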